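/- Let $G=(V,E)$ be a finite simple graph with a linear order on $V$, and for $v\in V$ let $E(v)$ be the set of edges incident to $v$. Put $$\tilde P_G=\prod_{\{i,j\}\in E,\ i<j}\Big(\big(\sum_{e\in E(i)}x_e+x_i\big)-\big(\sum_{e\in E(j)}x_e+x_j\big)\Big)\in\mathbb{C}[x_z: z\in V\cup E],$$ $$P_G=\prod_{\{i,j\}\in E,\ i<j}\Big(\sum_{e\in E(i)}x_e-\sum_{e\in E(j)}x_e\Big)\in\mathbb{C}[x_e: e\in E].$$ The graph $G$ is called nice if it has no isolated edge, that is, every edge shares an end vertex with some other edge. It is called algebraic (total weight) $(k,k')$-choosable if there is $K:V\cup E\to\mathbb{N}$ with $\sum_{z\in V\cup E}K(z)=|E|$, $K(v)<k$ for every vertex $v$ and $K(e)<k'$ for every edge $e$, such that the monomial $\prod_{z\in V\cup E}x_z^{K(z)}$ has a nonzero coefficient in $\tilde P_G$. **Theorem.** Every nice graph $G$ is algebraic $(1,5)$-choosable. In terms of $P_G$: there is $K:E\to\mathbb{N}$ with $\sum_{e\in E}K(e)=|E|$ and $K(e)\le 4$ for every edge $e$, such that the monomial $\prod_{e\in E}x_e^{K(e)}$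 has a nonzero coefficient in $P_G$. -/

import Mathlib

noncomputable section

namespace TotalWeight

open MvPolynomial

/-- `e` is an isolated edge of `G`: an edge of `G` that shares no end vertex with another edge. -/
def IsIsolatedEdge {V : Type*} (G : SimpleGraph V) (e : Sym2 V) : Prop :=
  e ∈ G.edgeSet ∧ ∀ e' ∈ G.edgeSet, (∃ v, v ∈ e ∧ v ∈ e') → e' = e

/-- A graph is nice if it has no isolated edges. -/
def IsNice {V : Type*} (G : SimpleGraph V) : Prop :=
  ∀ e : Sym2 V, ¬ IsIsolatedEdge G e

section Polynomials

variable {V : Type*} [Fintype V] [LinearOrder V] (G : SimpleGraph V) [DecidableRel G.Adj]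

/-- The polynomial `∑_{e ∈ E(v)} x_e + x_v` in the variables `x_z`, `z ∈ V ∪ E`. -/
def totalVertexSum (v : V) : MvPolynomial (V ⊕ G.edgeSet) ℂ :=
  (∑ e ∈ Finset.univ.filter (fun e : G.edgeSet => v ∈ e.val), X (Sum.inr e)) + X (Sum.inl v)

/-- The product, over the edges `{i, j}` with `i < j`, of
`(∑_{e ∈ E(i)} x_e + x_i) - (∑_{e ∈ E(j)} x_e + x_j)`. -/
def totalGraphPoly : MvPolynomial (V ⊕ G.edgeSet) ℂ :=
  ∏ e : G.edgeSet, (totalVertexSum G (e : Sym2 V).inf - totalVertexSum G (e : Sym2 V).sup)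

/-- The polynomial `∑_{e ∈ E(v)} x_e` in the variables `x_e`, `e ∈ E`. -/
def vertexSum (v : V) : MvPolynomial G.edgeSet ℂ :=
  ∑ e ∈ Finset.univ.filter (fun e : G.edgeSet => v ∈ e.val), X e

/-- The product, over the edges `{i, j}` with `i < j`, of
`∑_{e ∈ E(i)} x_e - ∑_{e ∈ E(j)} x_e`. -/
def graphPoly : MvPolynomial G.edgeSet ℂ :=
  ∏ e : G.edgeSet, (vertexSum G (e : Sym2 V).inf - vertexSum G (e : Sym2 V).sup)

/-- `G` is algebraic total weight `(k, k')`-choosable: some monomial `x^K` of total degree `|E|`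
has a nonzero coefficient in `totalGraphPoly G`, with `K(v) < k` for all vertices `v` and
`K(e) < k'` for all edges `e`. -/
def AlgebraicChoosable (k k' : ℕ) : Prop :=
  ∃ K : V ⊕ G.edgeSet →₀ ℕ,
    ∑ z, K z = Fintype.card G.edgeSet ∧
    (∀ v : V, K (Sum.inl v) < k) ∧
    (∀ e : G.edgeSet, K (Sum.inr e) < k') ∧
    (totalGraphPoly G).coeff K ≠ 0

end Polynomials

end TotalWeight

end

set_option linter.unusedSectionVars false

/-! Up to a positive factor, a coefficient of a product of linear forms is the permanent of the
coefficient matrix with column `e` repeated `K e` times (`sum_perm_prod_eq_coeff`). By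
multilinearity it suffices to find `|E|` linear combinations of the edge columns, each edge
occurring in at most four of them, whose matrix has nonzero permanent
(`exists_coeff_ne_zero_of_perm`). A combination `c` is read as the vertex function `x ↦ ∑ c e` over
the edges `e ∋ x`; its entry in the row of an edge is the difference of its values at the two ends.
Let a weight on the vertices drop from one end of each edge to the other, and give each function a
token vertex such that it is supported at weights at least that of its token and the tokens are
exactly the heavier ends of the edges. Then only weight-preserving permutations survive, and the
permanent becomes a coefficient of the product of the leading forms
(`exists_coeff_ne_zero_of_leading`).

For a connected graph with at least three vertices, a maximum independent set `A` is put on the top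
level and the outer vertices on distinct lower levels. An edge between outer vertices receives a
difference of two edges at its larger end, with a single variable as leading form. The edges meeting
`A` require each `a ∈ A` as a token `deg a` times. An alternating edge sum along a walk lives only
at the two ends of the walk, giving `y_a ± y_a'`. Using each walk twice makes the `A`-part a square
`P * P`; since the coefficients of `P` are symmetric up to sign, the middle coefficient of `P * P`
is plus or minus a sum of squares, hence nonzero. One further unsquared factor does no harm
(`SignedPair.coeff_prod_sq_mul_form_ne_zero`).

It remains to find walks having each `a ∈ A` as an end `deg a` times and using no edge too often
(`hasSmallExponent_of_trails`). Ideally each outer vertex delivers each of its neighbours in `A`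
once and pairs these tokens by walks of length two. Parity obstructs this in two ways. Inside a
component of the outer graph, vertices with an odd number of tokens are paired along edge-disjoint
shortest paths. For a component with an odd total, some links of a tree on components and `A`
deliver their token twice or not at all, half of the marked links at each `a` being doubled. At most
one token is left over, at the root, and it is used by the single unsquared walk. A walk that would
begin and end at the same vertex with even length must be avoided; this is where the extremal choice
of `A` enters (`Frame.Rigid.adj`). -/

namespace TotalWeight

open MvPolynomial

/-! ### Coefficients as permanents, and the reduction to leading forms. -/

section Algebra

lemma coeff_prod_linear {I V R : Type*} [Fintype I] [Fintype V] [DecidableEq I] [DecidableEq V]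
    [CommSemiring R] (M : I → V → R) (K : V →₀ ℕ) :
    coeff K (∏ i, ∑ v, C (M i v) * X v) =
      ∑ ψ : I → V, if ∑ i, Finsupp.single (ψ i) 1 = K then ∏ i, M i (ψ i) else 0 := by
  rw [Finset.prod_univ_sum, coeff_sum]
  rw [Fintype.piFinset_univ]
  refine Finset.sum_congr rfl fun ψ _ => ?_
  rw [← coeff_monomial]
  congr 1
  rw [Finset.prod_mul_distrib, ← map_prod]
  have : ∏ i, (X (ψ i) : MvPolynomial V R) = monomial (∑ i, Finsupp.single (ψ i) 1) 1 := by
    rw [MvPolynomial.monomial_sum_one]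
    rfl
  rw [this, C_mul_monomial, mul_one]

lemma sum_single_apply {I V : Type*} [Fintype I] [DecidableEq V] (φ : I → V) (v : V) :
    (∑ i, Finsupp.single (φ i) 1 : V →₀ ℕ) v = (Finset.univ.filter (fun i => φ i = v)).card := by
  rw [Finsupp.finsetSum_apply, Finset.card_filter]
  exact Finset.sum_congr rfl fun i _ => by rw [Finsupp.single_apply]

lemma exists_equiv_of_sum_single_eq {I J V : Type*} [Fintype I] [Fintype J] 
    {φ : I → V} {ψ : J → V}
    (h : (∑ i, Finsupp.single (φ i) 1 : V →₀ ℕ) = ∑ j, Finsupp.single (ψ j) 1) :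
    ∃ θ : I ≃ J, ∀ i, ψ (θ i) = φ i := by
  classical
  have key : ∀ v, Nonempty ({i // φ i = v} ≃ {j // ψ j = v}) := fun v => by
    rw [← Fintype.card_eq, Fintype.card_subtype, Fintype.card_subtype]
    have := DFunLike.congr_fun h v
    rw [sum_single_apply, sum_single_apply] at this
    convert this
  exact ⟨Equiv.ofFiberEquiv fun v => (key v).some, fun i => Equiv.ofFiberEquiv_map _ i⟩

/-- Group the permutations by `φ ∘ σ`. Each rearrangement `ψ` of `φ` arises from a coset of the
stabilizer of `φ`, so all occur equally often; `c` is the order of the stabilizer. -/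
lemma sum_perm_prod_eq_coeff {I V R : Type*} [Fintype I] [Fintype V] [DecidableEq I]
    [DecidableEq V] [CommSemiring R] (M : I → V → R) (φ : I → V) :
    ∃ c : ℕ, 0 < c ∧ ∑ σ : Equiv.Perm I, ∏ i, M i (φ (σ i)) =
      c • coeff (∑ i, Finsupp.single (φ i) 1) (∏ i, ∑ v, C (M i v) * X v) := by
  refine ⟨(Finset.univ.filter fun σ : Equiv.Perm I => φ ∘ σ = φ).card,
    Finset.card_pos.2 ⟨1, by simp⟩, ?_⟩
  rw [coeff_prod_linear, Finset.smul_sum]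
  rw [← Finset.sum_fiberwise (s := Finset.univ) (g := fun σ : Equiv.Perm I => φ ∘ σ)]
  refine Finset.sum_congr rfl fun ψ _ => ?_
  rw [Finset.sum_congr rfl (g := fun _ => ∏ i, M i (ψ i)), Finset.sum_const]
  · split_ifs with h
    · congr 1
      obtain ⟨τ, hτ⟩ := exists_equiv_of_sum_single_eq h
      refine Finset.card_bij' (fun σ _ => σ * τ⁻¹) (fun σ _ => σ * τ) ?_ ?_ ?_ ?_
      · intro σ hσ
        simp only [Finset.mem_filter, Finset.mem_univ, true_and] at hσ ⊢
        funext i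
        have := congrFun hσ (τ⁻¹ i)
        simp only [Function.comp_apply, Equiv.Perm.coe_mul] at this ⊢
        rw [this, ← hτ]; simp
      · intro σ hσ
        simp only [Finset.mem_filter, Finset.mem_univ, true_and] at hσ ⊢
        funext i
        have := congrFun hσ (τ i)
        simp only [Function.comp_apply, Equiv.Perm.coe_mul] at this ⊢
        rw [this, ← hτ]
      · intro σ _; simp
      · intro σ _; simp
    · rw [smul_zero, Finset.card_eq_zero.2, zero_smul]
      refine Finset.filter_eq_empty_iff.2 fun σ _ hσ => h ?_
      rw [← hσ]
      exact Equiv.sum_comp σ (fun i => Finsupp.single (φ i) 1)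
  · intro σ hσ
    simp only [Finset.mem_filter, Finset.mem_univ, true_and] at hσ
    rw [← hσ]; rfl

/-- Value at `x` of the linear form with coefficients `c` in the edges `e = {u e, v e}`. -/
def incForm {E W : Type*} [Fintype E] [DecidableEq W] (u v : E → W) (c : E → ℝ) (x : W) : ℝ :=
  ∑ e, if x = u e ∨ x = v e then c e else 0

/-- Expanding the permanent over the combinations leaves some choice `φ` of one edge per combination
with a nonzero contribution. Edge `e` is chosen only by combinations containing it, hence at most
`N` times. -/
lemma exists_coeff_ne_zero_of_perm {E : Type*} [Fintype E] [DecidableEq E]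
    (M c : E → E → ℝ) (N : ℕ)
    (hN : ∀ e, (Finset.univ.filter fun t => c t e ≠ 0).card ≤ N)
    (hne : ∑ σ : Equiv.Perm E, ∏ i, ∑ e, c (σ i) e * M i e ≠ 0) :
    ∃ K : E →₀ ℕ, (∀ e, K e ≤ N) ∧ coeff K (∏ i, ∑ e, C (M i e) * X e) ≠ 0 := by
  have h1 : ∑ σ : Equiv.Perm E, ∏ i, ∑ e, c (σ i) e * M i e =
      ∑ φ : E → E, (∏ t, c t (φ t)) * ∑ σ : Equiv.Perm E, ∏ i, M i (φ (σ i)) := by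
    simp_rw [Finset.mul_sum]
    rw [Finset.sum_comm]
    refine Finset.sum_congr rfl fun σ _ => ?_
    rw [Equiv.prod_comp σ.symm (fun i => ∑ e, c (σ i) e * M i e) |>.symm]
    simp only [Equiv.apply_symm_apply]
    rw [Finset.prod_univ_sum, Fintype.piFinset_univ]
    refine Finset.sum_congr rfl fun φ _ => ?_
    rw [Finset.prod_mul_distrib]
    congr 1
    rw [← Equiv.prod_comp σ]
    simp
  rw [h1] at hne
  obtain ⟨φ, -, hφ⟩ := Finset.exists_ne_zero_of_sum_ne_zero hne
  refine ⟨∑ i, Finsupp.single (φ i) 1, fun e => ?_, ?_⟩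
  · rw [sum_single_apply]
    refine le_trans (Finset.card_le_card fun t ht => ?_) (hN e)
    simp only [Finset.mem_filter, Finset.mem_univ, true_and] at ht ⊢
    rw [← ht]
    exact Finset.prod_ne_zero_iff.1 (left_ne_zero_of_mul hφ) t (Finset.mem_univ _)
  · obtain ⟨k, -, hk⟩ := sum_perm_prod_eq_coeff M φ
    rw [hk] at hφ
    exact right_ne_zero_of_smul (right_ne_zero_of_mul hφ)

/-- A triangularity argument for permanents: the weights force every surviving permutation to match
tokens and rows of equal weight, and in those entries the lighter end contributes zero. -/
lemma exists_coeff_ne_zero_of_leading {E W : Type*} [Fintype E] [DecidableEq E] [Fintype W]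
    [DecidableEq W] (u v : E → W) (h : W → ℕ) (hh : ∀ e, h (v e) < h (u e))
    {T : Type*} [Fintype T] (tok : T → W)
    (htok : (∑ t, Finsupp.single (tok t) 1 : W →₀ ℕ) = ∑ e, Finsupp.single (u e) 1)
    (c : T → E → ℝ) (N : ℕ) (hN : ∀ e, (Finset.univ.filter fun t => c t e ≠ 0).card ≤ N)
    (hsupp : ∀ t x, incForm u v (c t) x ≠ 0 → h (tok t) ≤ h x)
    (hcoeff : coeff (∑ t, Finsupp.single (tok t) 1)
      (∏ t, ∑ x, C (if h x = h (tok t) then incForm u v (c t) x else 0) * X x) ≠ 0) :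
    ∃ K : E →₀ ℕ, (∀ e, K e ≤ N) ∧
      coeff K (∏ i, ∑ e, C ((if u i = u e ∨ u i = v e then 1 else 0) -
        (if v i = u e ∨ v i = v e then 1 else 0) : ℝ) * X e) ≠ 0 := by
  obtain ⟨θ, hθ⟩ := exists_equiv_of_sum_single_eq htok.symm
  set f : E → W → ℝ := fun t => incForm u v (c (θ t)) with hf
  have hsupp' : ∀ t x, f t x ≠ 0 → h (u t) ≤ h x := fun t x hx => by
    rw [← hθ]; exact hsupp _ _ hx
  have hcoeff' : coeff (∑ t, Finsupp.single (u t) 1)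
      (∏ t, ∑ x, C (if h x = h (u t) then f t x else 0) * X x) ≠ 0 := by
    rw [← htok]
    convert hcoeff using 2
    rw [← Equiv.prod_comp θ]
    simp [hθ, hf]
  refine exists_coeff_ne_zero_of_perm _ (fun t e => c (θ t) e) N (fun e => ?_) ?_
  · refine le_trans (le_of_eq ?_) (hN e)
    refine Finset.card_bij (fun t _ => θ t) ?_ ?_ ?_
    · intro a ha; simpa using ha
    · intro a _ b _ hab; exact θ.injective hab
    · intro b hb; exact ⟨θ.symm b, by simpa using hb, by simp⟩
  · have h1 : ∀ t i, ∑ e, c (θ t) e * ((if u i = u e ∨ u i = v e then 1 else 0) -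
        (if v i = u e ∨ v i = v e then 1 else 0) : ℝ) = f t (u i) - f t (v i) := by
      intro t i
      simp only [hf, incForm, ← Finset.sum_sub_distrib]
      refine Finset.sum_congr rfl fun e _ => ?_
      split_ifs <;> simp
    simp only [h1]
    have h2 : ∀ σ : Equiv.Perm E, ∏ i, (f (σ i) (u i) - f (σ i) (v i)) =
        ∏ i, (if h (u i) = h (u (σ i)) then f (σ i) (u i) else 0) := by
      intro σ
      by_cases hσ : ∀ i, h (u (σ i)) ≤ h (u i)
      · have heq : ∀ i ∈ Finset.univ, h (u (σ i)) = h (u i) := by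
          refine (Finset.sum_eq_sum_iff_of_le fun i _ => hσ i).1 ?_
          exact Equiv.sum_comp σ fun i => h (u i)
        refine Finset.prod_congr rfl fun i hi => ?_
        rw [if_pos (heq i hi).symm]
        have : f (σ i) (v i) = 0 := by
          by_contra hc
          have := hsupp' _ _ hc
          have := hh i
          have := heq i hi
          omega
        rw [this, sub_zero]
      · push Not at hσ
        obtain ⟨i, hi⟩ := hσ
        rw [Finset.prod_eq_zero (Finset.mem_univ i), Finset.prod_eq_zero (Finset.mem_univ i)]
        · rw [if_neg hi.ne]
        · have e1 : f (σ i) (u i) = 0 := by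
            by_contra hc
            have := hsupp' _ _ hc
            omega
          have e2 : f (σ i) (v i) = 0 := by
            by_contra hc
            have := hsupp' _ _ hc
            have := hh i
            omega
          rw [e1, e2, sub_zero]
    simp only [h2]
    obtain ⟨k, hk, hk'⟩ := sum_perm_prod_eq_coeff
      (fun t x => if h x = h (u t) then f t x else 0) u
    have h3 : ∑ σ : Equiv.Perm E, ∏ i, (if h (u i) = h (u (σ i)) then f (σ i) (u i) else 0) =
        ∑ σ : Equiv.Perm E, ∏ i, (if h (u (σ i)) = h (u i) then f i (u (σ i)) else 0) := by
      rw [← Equiv.sum_comp (Equiv.inv (Equiv.Perm E))]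
      refine Finset.sum_congr rfl fun σ _ => ?_
      rw [← Equiv.prod_comp σ]
      simp
    rw [h3, hk']
    exact smul_ne_zero hk.ne' hcoeff'

end Algebra

/-! ### Squares of products of signed pairs have a nonzero middle coefficient. -/

section Squares

variable {W : Type*}

/-- The coefficients of `P` are supported below `κ`, and symmetric up to the factor `ε` under
`α ↦ κ - α`. -/
def IsPalindromic (κ : W →₀ ℕ) (ε : ℝ) (P : MvPolynomial W ℝ) : Prop :=
  (∀ α, coeff α P ≠ 0 → α ≤ κ) ∧ ∀ α β, α + β = κ → coeff α P = ε * coeff β P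

/-- The reflection `(a, b) ↦ (κ - a, μ - b)` exchanges the nonzero terms of the two convolution
sums; truncated subtraction is harmless because the supports lie below `κ` and `μ`. -/
lemma IsPalindromic.mul {κ μ : W →₀ ℕ} {ε δ : ℝ} {P Q : MvPolynomial W ℝ}
    (hP : IsPalindromic κ ε P) (hQ : IsPalindromic μ δ Q) :
    IsPalindromic (κ + μ) (ε * δ) (P * Q) := by
  classical
  constructor
  · intro α hα
    rw [coeff_mul] at hα
    obtain ⟨⟨a, b⟩, hab, hne⟩ := Finset.exists_ne_zero_of_sum_ne_zero hα
    rw [Finset.HasAntidiagonal.mem_antidiagonal] at hab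
    rw [← hab]
    exact add_le_add (hP.1 a (left_ne_zero_of_mul hne)) (hQ.1 b (right_ne_zero_of_mul hne))
  · intro α β hαβ
    rw [coeff_mul, coeff_mul, Finset.mul_sum]
    have key : ∀ (α β : W →₀ ℕ), α + β = κ + μ → ∀ x : (W →₀ ℕ) × (W →₀ ℕ),
        x.1 + x.2 = α → coeff x.1 P * coeff x.2 Q ≠ 0 →
        (κ - x.1) + (μ - x.2) = β ∧ x.1 ≤ κ ∧ x.2 ≤ μ := by
      intro α β hαβ x hx hne
      have h1 := hP.1 _ (left_ne_zero_of_mul hne)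
      have h2 := hQ.1 _ (right_ne_zero_of_mul hne)
      refine ⟨?_, h1, h2⟩
      ext w
      have e1 := h1 w
      have e2 := h2 w
      have e3 := DFunLike.congr_fun hαβ w
      have e4 := DFunLike.congr_fun hx w
      simp only [Finsupp.add_apply, Finsupp.tsub_apply] at *
      omega
    have hval : ∀ x : (W →₀ ℕ) × (W →₀ ℕ), x.1 ≤ κ → x.2 ≤ μ →
        coeff x.1 P * coeff x.2 Q =
          ε * δ * (coeff (κ - x.1) P * coeff (μ - x.2) Q) := by
      intro x h1 h2
      rw [hP.2 x.1 (κ - x.1) (add_tsub_cancel_of_le h1),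
        hQ.2 x.2 (μ - x.2) (add_tsub_cancel_of_le h2)]
      ring
    refine Finset.sum_bij_ne_zero (fun x _ _ => (κ - x.1, μ - x.2)) ?_ ?_ ?_ ?_
    · intro x hx hne
      rw [Finset.HasAntidiagonal.mem_antidiagonal] at hx ⊢
      exact (key α β hαβ x hx hne).1
    · intro x hx hne y hy hne' hxy
      rw [Finset.HasAntidiagonal.mem_antidiagonal] at hx hy
      obtain ⟨-, h1, h2⟩ := key α β hαβ x hx hne
      obtain ⟨-, h3, h4⟩ := key α β hαβ y hy hne'
      simp only [Prod.mk.injEq] at hxy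
      ext1
      · rw [← tsub_tsub_cancel_of_le h1, hxy.1, tsub_tsub_cancel_of_le h3]
      · rw [← tsub_tsub_cancel_of_le h2, hxy.2, tsub_tsub_cancel_of_le h4]
    · intro y hy hne
      rw [Finset.HasAntidiagonal.mem_antidiagonal] at hy
      have hne2 := right_ne_zero_of_mul hne
      obtain ⟨h0, h3, h4⟩ := key β α (by rw [add_comm]; exact hαβ) y hy hne2
      refine ⟨(κ - y.1, μ - y.2), Finset.HasAntidiagonal.mem_antidiagonal.2 h0, ?_, ?_⟩
      · rw [hval _ tsub_le_self tsub_le_self]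
        simp only [tsub_tsub_cancel_of_le h3, tsub_tsub_cancel_of_le h4]
        exact hne
      · simp only [tsub_tsub_cancel_of_le h3, tsub_tsub_cancel_of_le h4]
    · intro x hx hne
      rw [Finset.HasAntidiagonal.mem_antidiagonal] at hx
      obtain ⟨-, h1, h2⟩ := key α β hαβ x hx hne
      exact hval x h1 h2

lemma isPalindromic_one : IsPalindromic (0 : W →₀ ℕ) 1 1 := by
  classical
  constructor
  · intro α hα
    rw [coeff_one] at hα
    simp only [ne_eq, ite_eq_right_iff, one_ne_zero, imp_false, not_not] at hα
    exact hα.symm.le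
  · intro α β h
    obtain ⟨h1, h2⟩ := add_eq_zero.1 h
    rw [h1, h2, one_mul]

lemma isPalindromic_binomial (o z : W) {s : ℝ} (hs : s = 1 ∨ s = -1) :
    IsPalindromic (Finsupp.single o 1 + Finsupp.single z 1) s (X o + C s * X z) := by
  classical
  have hc : ∀ α, coeff α (X o + C s * X z : MvPolynomial W ℝ) =
      (if Finsupp.single o 1 = α then 1 else 0) + s * if Finsupp.single z 1 = α then 1 else 0 := by
    intro α
    rw [coeff_add, coeff_C_mul, coeff_X, coeff_X]
  have hs2 : s * s = 1 := by rcases hs with rfl | rfl <;> norm_num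
  constructor
  · intro α hα
    rw [hc] at hα
    split_ifs at hα with h1 h2 h2
    · rw [← h1]; exact le_self_add
    · rw [← h1]; exact le_self_add
    · rw [← h2]; exact le_add_self
    · simp at hα
  · intro α β h
    have e1 : (Finsupp.single o 1 = α) ↔ (Finsupp.single z 1 = β) := by
      constructor
      · rintro rfl; exact (add_left_cancel h).symm
      · rintro rfl; exact (add_right_cancel h).symm
    have e2 : (Finsupp.single z 1 = α) ↔ (Finsupp.single o 1 = β) := by
      rw [add_comm (Finsupp.single o 1)] at h
      constructor
      · rintro rfl; exact (add_left_cancel h).symm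
      · rintro rfl; exact (add_right_cancel h).symm
    rw [hc, hc, mul_add, ← mul_assoc, hs2]
    simp only [e1, e2]
    ring

/-- The symmetry turns the convolution at `κ` into `ε` times a sum of squares of real numbers. -/
lemma IsPalindromic.coeff_sq_ne_zero {κ : W →₀ ℕ} {ε : ℝ} {P : MvPolynomial W ℝ} (hε : ε ≠ 0)
    (hP : IsPalindromic κ ε P) (h0 : P ≠ 0) : coeff κ (P * P) ≠ 0 := by
  classical
  obtain ⟨α, hα⟩ := ne_zero_iff.1 h0
  rw [coeff_mul, Finset.sum_congr rfl (g := fun x => ε * (coeff x.2 P) ^ 2), ← Finset.mul_sum]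
  · refine mul_ne_zero hε (Finset.sum_pos' (fun x _ => sq_nonneg _) ⟨(κ - α, α), ?_, ?_⟩).ne'
    · rw [Finset.HasAntidiagonal.mem_antidiagonal]
      exact tsub_add_cancel_of_le (hP.1 α hα)
    · positivity
  · intro x hx
    rw [Finset.HasAntidiagonal.mem_antidiagonal] at hx
    rw [hP.2 x.1 x.2 hx]
    ring

lemma binomial_ne_zero {o z : W} {s : ℝ} (h : o ≠ z ∨ s = 1) :
    (X o + C s * X z : MvPolynomial W ℝ) ≠ 0 := by
  classical
  intro h0
  have := congrArg (coeff (Finsupp.single o 1)) h0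
  rw [coeff_add, coeff_C_mul, coeff_X, coeff_X, if_pos rfl, coeff_zero] at this
  split_ifs at this with h1
  · rcases h with h | h
    · exact h (Finsupp.single_left_injective one_ne_zero h1).symm
    · rw [h] at this; norm_num at this
  · norm_num at this

/-- The data of a linear form `y_o + s y_z`. -/
structure SignedPair (W : Type*) where
  fst : W
  snd : W
  sign : ℝ
  sign_eq : sign = 1 ∨ sign = -1
  nondeg : fst ≠ snd ∨ sign = 1

namespace SignedPair

noncomputable def form (p : SignedPair W) : MvPolynomial W ℝ := X p.fst + C p.sign * X p.snd

noncomputable def deg (p : SignedPair W) : W →₀ ℕ := Finsupp.single p.fst 1 + Finsupp.single p.snd 1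

lemma sign_mul_self (p : SignedPair W) : p.sign * p.sign = 1 := by
  rcases p.sign_eq with h | h <;> rw [h] <;> norm_num

lemma isPalindromic_prod (S : Multiset (SignedPair W)) :
    ∃ ε : ℝ, ε * ε = 1 ∧ IsPalindromic (S.map deg).sum ε (S.map form).prod := by
  induction S using Multiset.induction_on with
  | empty => exact ⟨1, by norm_num, by simpa using isPalindromic_one⟩
  | cons p S ih =>
    obtain ⟨ε, h1, h2⟩ := ih
    refine ⟨p.sign * ε, ?_, ?_⟩
    · rw [mul_mul_mul_comm, h1, p.sign_mul_self, one_mul]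
    · rw [Multiset.map_cons, Multiset.map_cons, Multiset.sum_cons, Multiset.prod_cons]
      exact (isPalindromic_binomial _ _ p.sign_eq).mul h2

lemma prod_form_ne_zero (S : Multiset (SignedPair W)) : (S.map form).prod ≠ 0 := by
  refine Multiset.prod_ne_zero fun h => ?_
  obtain ⟨p, -, hp⟩ := Multiset.mem_map.1 h
  exact binomial_ne_zero p.nondeg hp

lemma coeff_prod_sq_ne_zero (S : Multiset (SignedPair W)) :
    coeff (S.map deg).sum ((S.map form).prod * (S.map form).prod) ≠ 0 := by
  obtain ⟨ε, h1, h2⟩ := isPalindromic_prod S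
  have hε : ε ≠ 0 := by rintro rfl; norm_num at h1
  exact h2.coeff_sq_ne_zero hε (prod_form_ne_zero S)

/-- Multiply by `p.form` once more: the result is a full square, with nonzero middle coefficient.
That coefficient is a sum of two coefficients of the present product, which palindromicity makes
equal up to sign, so it is `± 2` times the coefficient in question. -/
lemma coeff_prod_sq_mul_form_ne_zero (S : Multiset (SignedPair W)) (p : SignedPair W) :
    coeff ((S.map deg).sum + Finsupp.single p.fst 1)
      ((S.map form).prod * (S.map form).prod * p.form) ≠ 0 := by
  classical
  obtain ⟨ε, h1, h2⟩ := isPalindromic_prod S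
  have h3 := coeff_prod_sq_ne_zero (p ::ₘ S)
  have h4 := (h2.mul h2).mul (isPalindromic_binomial p.fst p.snd p.sign_eq)
  set κ := (S.map deg).sum
  set H := (S.map form).prod
  have h5 := h4.2 (κ + Finsupp.single p.snd 1) (κ + Finsupp.single p.fst 1) (by abel)
  rw [h1, one_mul] at h5
  change coeff _ (H * H * p.form) = p.sign * coeff _ (H * H * p.form) at h5
  rw [Multiset.map_cons, Multiset.map_cons, Multiset.sum_cons, Multiset.prod_cons] at h3
  have h6 : p.form * H * (p.form * H) =
      H * H * p.form * X p.fst + C p.sign * (H * H * p.form * X p.snd) := by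
    have : p.form * H * (p.form * H) = H * H * p.form * p.form := by ring
    rw [this]
    conv_lhs => rw [form, mul_add]
    rw [form]
    ring
  rw [h6, coeff_add, coeff_C_mul] at h3
  have h7 : p.deg + κ = (κ + Finsupp.single p.snd 1) + Finsupp.single p.fst 1 := by
    rw [deg]; abel
  have h8 : p.deg + κ = (κ + Finsupp.single p.fst 1) + Finsupp.single p.snd 1 := by
    rw [deg]; abel
  change coeff (p.deg + κ) _ + p.sign * coeff (p.deg + κ) _ ≠ 0 at h3
  rw [h7, coeff_mul_X, ← h7, h8, coeff_mul_X, h5] at h3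
  intro h
  rw [h] at h3
  simp at h3

end SignedPair

end Squares

/-! ### Reduction to connected graphs on at least three vertices. -/

section Components

/-- Some monomial with exponents at most `4` has a nonzero coefficient in the product, over all
edges `e = {p e, q e}`, of the differences of the edge sums at `p e` and `q e`. -/
def HasSmallExponent {W : Type*} (H : SimpleGraph W) [Fintype H.edgeSet] [DecidableEq W] : Prop :=
  ∀ p q : H.edgeSet → W, (∀ e, e.val = s(p e, q e)) →
    ∃ K : H.edgeSet →₀ ℕ, (∀ e, K e ≤ 4) ∧
      coeff K (∏ i, ∑ e : H.edgeSet, C ((if p i ∈ e.val then 1 else 0) -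
        (if q i ∈ e.val then 1 else 0) : ℝ) * X e) ≠ 0

lemma coeff_mul_of_disjoint {E R : Type*} [CommSemiring R] (S T : Set E) (hST : Disjoint S T)
    (P Q : MvPolynomial E R) (K L : E →₀ ℕ)
    (hP : ∀ a, coeff a P ≠ 0 → ∀ e, a e ≠ 0 → e ∈ S)
    (hQ : ∀ a, coeff a Q ≠ 0 → ∀ e, a e ≠ 0 → e ∈ T)
    (hK : ∀ e, K e ≠ 0 → e ∈ S) (hL : ∀ e, L e ≠ 0 → e ∈ T) :
    coeff (K + L) (P * Q) = coeff K P * coeff L Q := by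
  classical
  rw [coeff_mul]
  refine Finset.sum_eq_single (K, L) ?_ ?_
  · rintro ⟨a, b⟩ hab hne
    rw [Finset.HasAntidiagonal.mem_antidiagonal] at hab
    by_contra h
    refine hne ?_
    have ha := hP a (left_ne_zero_of_mul h)
    have hb := hQ b (right_ne_zero_of_mul h)
    have key : ∀ e, a e = K e ∧ b e = L e := by
      intro e
      have h1 := DFunLike.congr_fun hab e
      simp only [Finsupp.add_apply] at h1
      by_cases hS : e ∈ S
      · have hT : e ∉ T := Set.disjoint_left.1 hST hS
        have : b e = 0 := by by_contra h; exact hT (hb e h)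
        have : L e = 0 := by by_contra h; exact hT (hL e h)
        omega
      · have : a e = 0 := by by_contra h; exact hS (ha e h)
        have : K e = 0 := by by_contra h; exact hS (hK e h)
        omega
    rw [Prod.mk.injEq]
    exact ⟨Finsupp.ext fun e => (key e).1, Finsupp.ext fun e => (key e).2⟩
  · intro h
    rw [Finset.HasAntidiagonal.mem_antidiagonal] at h
    exact absurd rfl h

/-- Factors in disjoint sets of variables do not interact; the support statement is carried along
for the induction. -/
lemma coeff_prod_of_disjoint {E R ι : Type*} [CommSemiring R] (comp : E → ι)
    (P : ι → MvPolynomial E R) (K : ι → E →₀ ℕ)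
    (hP : ∀ c a, coeff a (P c) ≠ 0 → ∀ e, a e ≠ 0 → comp e = c)
    (hK : ∀ c e, K c e ≠ 0 → comp e = c) (s : Finset ι) :
    (∀ a, coeff a (∏ c ∈ s, P c) ≠ 0 → ∀ e, a e ≠ 0 → comp e ∈ s) ∧
      coeff (∑ c ∈ s, K c) (∏ c ∈ s, P c) = ∏ c ∈ s, coeff (K c) (P c) := by
  classical
  induction s using Finset.induction_on with
  | empty =>
    constructor
    · intro a ha e he
      rw [Finset.prod_empty, coeff_one] at ha
      have : a = 0 := by by_contra h; rw [if_neg (fun h' => h h'.symm)] at ha; exact ha rfl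
      rw [this] at he; exact absurd rfl he
    · simp
  | insert c s hc ih =>
    obtain ⟨ih1, ih2⟩ := ih
    rw [Finset.prod_insert hc, Finset.sum_insert hc, Finset.prod_insert hc]
    constructor
    · intro a ha e he
      rw [coeff_mul] at ha
      obtain ⟨⟨x, y⟩, hxy, hne⟩ := Finset.exists_ne_zero_of_sum_ne_zero ha
      rw [Finset.HasAntidiagonal.mem_antidiagonal] at hxy
      have h1 := DFunLike.congr_fun hxy e
      simp only [Finsupp.add_apply] at h1
      rw [Finset.mem_insert]
      by_cases hx : x e = 0
      · exact Or.inr (ih1 y (right_ne_zero_of_mul hne) e (by omega))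
      · exact Or.inl (hP c x (left_ne_zero_of_mul hne) e hx)
    · rw [← ih2]
      refine coeff_mul_of_disjoint {e | comp e = c} {e | comp e ∈ s} ?_ _ _ _ _ (hP c) ih1 (hK c) ?_
      · rw [Set.disjoint_left]
        intro e he he'
        simp only [Set.mem_ofPred_eq] at he he'
        rw [he] at he'; exact hc he'
      · intro e he
        rw [Finsupp.finsetSum_apply] at he
        obtain ⟨d, hd, hde⟩ := Finset.exists_ne_zero_of_sum_ne_zero he
        rw [Set.mem_ofPred_eq, hK d e hde]; exact hd

lemma coeff_killCompl {σ τ R : Type*} [CommSemiring R] {f : σ → τ} (hf : Function.Injective f)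
    (P : MvPolynomial τ R) (K : σ →₀ ℕ) :
    coeff K (killCompl hf P) = coeff (K.mapDomain f) P := by
  classical
  induction P using MvPolynomial.induction_on' with
  | monomial s c =>
    by_cases hs : (s.support : Set τ) ⊆ Set.range f
    · obtain ⟨t, rfl⟩ : ∃ t : σ →₀ ℕ, t.mapDomain f = s :=
        ⟨_, Finsupp.mapDomain_comapDomain f hf s hs⟩
      rw [killCompl_monomial_mapDomain, coeff_monomial, coeff_monomial]
      simp only [(Finsupp.mapDomain_injective hf).eq_iff]
    · rw [killCompl_monomial_eq_zero_of_not_subset hf c hs, coeff_zero, coeff_monomial, if_neg]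
      rintro rfl
      refine hs fun x hx => ?_
      by_contra hx'
      exact Finsupp.mem_support_iff.1 hx (Finsupp.mapDomain_of_notMem_range _ _ hx')
  | add p q hp hq => rw [map_add, coeff_add, coeff_add, hp, hq]

universe u

lemma sym2_map_val_inf_sup {V : Type*} [LinearOrder V] {s : Set V} (e : Sym2 s) :
    (e.map Subtype.val).inf = (e.inf : s).val ∧ (e.map Subtype.val).sup = (e.sup : s).val := by
  induction e with
  | _ a b =>
    simp only [Sym2.map_mk, Sym2.inf_mk, Sym2.sup_mk]
    constructor
    · exact (Monotone.map_inf (f := (Subtype.val : s → V)) (fun _ _ h => h) a b).symm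
    · exact (Monotone.map_sup (f := (Subtype.val : s → V)) (fun _ _ h => h) a b).symm

variable {V : Type u} [Fintype V] [LinearOrder V] (G : SimpleGraph V) [DecidableRel G.Adj]

lemma sym2_eq_mk_inf_sup {α : Type*} [LinearOrder α] (e : Sym2 α) : e = s(e.inf, e.sup) := by
  induction e with
  | _ a b =>
    rcases le_total a b with h | h
    · simp [h]
    · simp [h, Sym2.eq_swap]

/-- The graph polynomial factors over the components into polynomials in disjoint variables.
Niceness enters only here: a component with at most two vertices has no edge, since its only edge
would be isolated. -/
theorem exists_coeff_graphPoly_ne_zero (hG : IsNice G)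
    (core : ∀ (W : Type u) [Fintype W] [DecidableEq W] (H : SimpleGraph W) [Fintype H.edgeSet],
      H.Connected → 3 ≤ Fintype.card W → HasSmallExponent H) :
    ∃ K : G.edgeSet →₀ ℕ, (∀ e, K e ≤ 4) ∧ coeff K (graphPoly G) ≠ 0 := by
  classical
  let H : (c : G.ConnectedComponent) → SimpleGraph c.supp := fun c => G.induce c.supp
  let ι : (c : G.ConnectedComponent) → (H c).edgeSet → G.edgeSet := fun c e =>
    ⟨e.val.map Subtype.val, by
      have := e.2
      generalize e.val = z at this
      induction z with
      | _ a b => simpa [H] using this⟩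
  have ι_inj : ∀ c, Function.Injective (ι c) := fun c x y hxy => by
    have := congrArg Subtype.val hxy
    exact Subtype.ext (Sym2.map.injective Subtype.val_injective this)
  let comp : G.edgeSet → G.ConnectedComponent := fun e => G.connectedComponentMk (e.val.inf)
  have comp_eq : ∀ (e : G.edgeSet) (x : V), x ∈ e.val → G.connectedComponentMk x = comp e := by
    rintro ⟨e, he⟩ x hx
    have h1 := sym2_eq_mk_inf_sup e
    have h2 : G.Adj e.inf e.sup := by rw [← SimpleGraph.mem_edgeSet, ← h1]; exact he
    simp only at hx
    rw [h1, Sym2.mem_iff] at hx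
    rcases hx with rfl | rfl
    · rfl
    · exact SimpleGraph.ConnectedComponent.sound h2.symm.reachable
  have comp_ι : ∀ c e, comp (ι c e) = c := by
    intro c e
    have : (ι c e).val.inf = e.val.inf.val := (sym2_map_val_inf_sup e.val).1
    change G.connectedComponentMk _ = c
    rw [this]
    exact e.val.inf.2
  have ι_surj : ∀ c (e : G.edgeSet), comp e = c → ∃ e', ι c e' = e := by
    rintro c ⟨e, he⟩ rfl
    have h1 := sym2_eq_mk_inf_sup e
    have h2 : G.Adj e.inf e.sup := by rw [← SimpleGraph.mem_edgeSet, ← h1]; exact he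
    refine ⟨⟨s(⟨e.inf, rfl⟩, ⟨e.sup, ?_⟩), ?_⟩, ?_⟩
    · exact SimpleGraph.ConnectedComponent.sound h2.symm.reachable
    · exact h2
    · apply Subtype.ext
      simp only [ι, Sym2.map_mk]
      exact h1.symm
  have small : ∀ c, HasSmallExponent (H c) := by
    intro c
    by_cases hcard : 3 ≤ Fintype.card c.supp
    · exact core c.supp (H c) c.connected_toSimpleGraph hcard
    · have hempty : IsEmpty (H c).edgeSet := by
        refine ⟨fun e => hG (ι c e).val ⟨(ι c e).2, ?_⟩⟩
        rintro e' he' ⟨v, hv, hv'⟩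
        have h1 : comp ⟨e', he'⟩ = c := by
          rw [← comp_eq ⟨e', he'⟩ v hv', comp_eq (ι c e) v hv, comp_ι]
        obtain ⟨e0, h3⟩ := ι_surj c ⟨e', he'⟩ h1
        have h4 : e' = (ι c e0).val := by rw [h3]
        rw [h4]
        congr 2
        apply Subtype.ext
        obtain ⟨x, hx⟩ := e
        obtain ⟨y, hy⟩ := e0
        simp only
        induction x with
        | _ a b =>
        induction y with
        | _ a' b' =>
          rw [SimpleGraph.mem_edgeSet] at hx hy
          have e1 := hx.ne
          have e2 := hy.ne
          have h5 : Fintype.card c.supp ≤ 2 := by omega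
          have h6 : ({a, b} : Finset c.supp) = Finset.univ := by
            apply Finset.eq_univ_of_card
            rw [Finset.card_pair e1]
            have := Finset.card_le_univ ({a, b} : Finset c.supp)
            rw [Finset.card_pair e1] at this
            omega
          have h7 : a' ∈ ({a, b} : Finset c.supp) := h6 ▸ Finset.mem_univ _
          have h8 : b' ∈ ({a, b} : Finset c.supp) := h6 ▸ Finset.mem_univ _
          simp only [Finset.mem_insert, Finset.mem_singleton] at h7 h8
          rw [Sym2.eq_iff]
          rcases h7 with h7 | h7 <;> rcases h8 with h8 | h8
          · exact absurd (h7.trans h8.symm) e2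
          · exact Or.inl ⟨h7, h8⟩
          · exact Or.inr ⟨h7, h8⟩
          · exact absurd (h7.trans h8.symm) e2
      intro p q _
      exact ⟨0, by simp, by simp⟩
  choose K hK4 hK using fun c => small c (fun e => e.val.inf) (fun e => e.val.sup)
    (fun e => sym2_eq_mk_inf_sup e.val)
  let P : (c : G.ConnectedComponent) → MvPolynomial G.edgeSet ℂ := fun c =>
    rename (ι c) (map (algebraMap ℝ ℂ) (∏ i : (H c).edgeSet, ∑ e : (H c).edgeSet,
      C ((if i.val.inf ∈ e.val then 1 else 0) - (if i.val.sup ∈ e.val then 1 else 0) : ℝ) * X e))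
  have hP : graphPoly G = ∏ c, P c := by
    rw [graphPoly, ← Finset.prod_fiberwise (s := Finset.univ) (g := comp)]
    refine Finset.prod_congr rfl fun c _ => ?_
    simp only [P, map_prod]
    symm
    refine Finset.prod_bij (fun e _ => ι c e) ?_ ?_ ?_ ?_
    · intro e _
      rw [Finset.mem_filter]; exact ⟨Finset.mem_univ _, comp_ι c e⟩
    · intro a _ b _ h; exact ι_inj c h
    · intro e he
      rw [Finset.mem_filter] at he
      obtain ⟨e', he'⟩ := ι_surj c e he.2
      exact ⟨e', Finset.mem_univ _, he'⟩
    · intro i _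
      have hsum : ∀ x : c.supp, vertexSum G x.val =
          ∑ e : (H c).edgeSet, if x ∈ e.val then X (ι c e) else 0 := by
        intro x
        rw [vertexSum, ← Finset.sum_filter]
        symm
        refine Finset.sum_bij (fun e _ => ι c e) ?_ ?_ ?_ ?_
        · intro e he
          rw [Finset.mem_filter] at he ⊢
          exact ⟨Finset.mem_univ _, Sym2.mem_map.2 ⟨x, he.2, rfl⟩⟩
        · intro a _ b _ h; exact ι_inj c h
        · intro e he
          rw [Finset.mem_filter] at he
          obtain ⟨e', he'⟩ := ι_surj c e (by rw [← comp_eq e x.val he.2]; exact x.2)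
          refine ⟨e', ?_, he'⟩
          rw [Finset.mem_filter]
          refine ⟨Finset.mem_univ _, ?_⟩
          have h2 := he.2
          rw [← he'] at h2
          obtain ⟨y, hy, hyx⟩ := Sym2.mem_map.1 h2
          rwa [← Subtype.ext hyx]
        · intro _ _; rfl
      have h1 := sym2_map_val_inf_sup i.val
      change _ = vertexSum G ((i.val.map Subtype.val).inf) - vertexSum G ((i.val.map Subtype.val).sup)
      rw [h1.1, h1.2, hsum, hsum, ← Finset.sum_sub_distrib, map_sum, map_sum]
      refine Finset.sum_congr rfl fun e _ => ?_
      split_ifs <;> simp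
  have hsuppP : ∀ c a, coeff a (P c) ≠ 0 → ∀ e, a e ≠ 0 → comp e = c := by
    intro c a ha e he
    obtain ⟨b, hb, -⟩ := coeff_rename_ne_zero _ _ _ ha
    rw [← hb] at he
    by_contra hne
    refine he (Finsupp.mapDomain_of_notMem_range _ _ ?_)
    rintro ⟨e', rfl⟩
    exact hne (comp_ι c e')
  refine ⟨∑ c, (K c).mapDomain (ι c), ?_, ?_⟩
  · intro e
    rw [Finsupp.finsetSum_apply, Finset.sum_eq_single (comp e)]
    · obtain ⟨e', he'⟩ := ι_surj _ e rfl
      conv_lhs => rw [← he']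
      rw [comp_ι, Finsupp.mapDomain_apply (ι_inj _)]
      exact hK4 _ _
    · intro c _ hc
      refine Finsupp.mapDomain_of_notMem_range _ _ ?_
      rintro ⟨e', rfl⟩
      exact hc (comp_ι c e').symm
    · intro h; exact absurd (Finset.mem_univ _) h
  · rw [hP, (coeff_prod_of_disjoint comp P _ hsuppP ?_ Finset.univ).2]
    · refine Finset.prod_ne_zero_iff.2 fun c _ => ?_
      simp only [P]
      rw [coeff_rename_mapDomain _ (ι_inj c), coeff_map]
      intro h
      exact hK c ((map_eq_zero _).1 h)
    · intro c e he
      by_contra hne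
      refine he (Finsupp.mapDomain_of_notMem_range _ _ ?_)
      rintro ⟨e', rfl⟩
      exact hne (comp_ι c e')

lemma sum_eq_card_of_coeff_graphPoly_ne_zero (K : G.edgeSet →₀ ℕ)
    (hK : coeff K (graphPoly G) ≠ 0) : ∑ e, K e = Fintype.card G.edgeSet := by
  have h : (graphPoly G).IsHomogeneous (∑ _e : G.edgeSet, 1) := by
    refine IsHomogeneous.prod _ _ _ fun e _ => ?_
    have : ∀ x, (vertexSum G x).IsHomogeneous 1 := fun x =>
      IsHomogeneous.sum _ _ _ fun e _ => isHomogeneous_X _ _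
    exact (this _).sub (this _)
  have h2 := h hK
  rw [Finsupp.weight_apply, Finsupp.sum_fintype _ _ (by simp)] at h2
  simpa using h2

/-- Setting the vertex variables to zero turns one polynomial into the other and keeps the
coefficients of monomials in edge variables. -/
lemma coeff_totalGraphPoly (K : G.edgeSet →₀ ℕ) :
    coeff (K.mapDomain Sum.inr) (totalGraphPoly G) = coeff K (graphPoly G) := by
  rw [← coeff_killCompl Sum.inr_injective]
  congr 1
  have h : ∀ v, killCompl (Sum.inr_injective (α := V)) (totalVertexSum G v) = vertexSum G v := by
    intro v
    simp only [totalVertexSum, vertexSum, map_add, map_sum]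
    have hX : ∀ e : G.edgeSet, killCompl (Sum.inr_injective (α := V)) (X (Sum.inr e)) =
        (X e : MvPolynomial G.edgeSet ℂ) := fun e => by
      rw [← rename_X, killCompl_rename_app]
    have hX' : killCompl (Sum.inr_injective (β := G.edgeSet)) (X (Sum.inl v)) =
        (0 : MvPolynomial G.edgeSet ℂ) := by
      rw [killCompl, aeval_X, dif_neg (by simp)]
    rw [hX', add_zero]
    exact Finset.sum_congr rfl fun e _ => hX e
  simp only [totalGraphPoly, graphPoly, map_prod, map_sub, h]

theorem algebraicChoosable_one_five (K : G.edgeSet →₀ ℕ) (hK4 : ∀ e, K e ≤ 4)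
    (hK : coeff K (graphPoly G) ≠ 0) : AlgebraicChoosable G 1 5 := by
  refine ⟨K.mapDomain Sum.inr, ?_, ?_, ?_, ?_⟩
  · rw [← sum_eq_card_of_coeff_graphPoly_ne_zero G K hK, Fintype.sum_sum_type]
    rw [Finset.sum_eq_zero, zero_add]
    · exact Finset.sum_congr rfl fun e _ => Finsupp.mapDomain_apply Sum.inr_injective _ _
    · intro v _
      exact Finsupp.mapDomain_of_notMem_range _ _ (by simp)
  · intro v
    rw [Finsupp.mapDomain_of_notMem_range _ _ (by simp)]
    exact one_pos
  · intro e
    rw [Finsupp.mapDomain_apply Sum.inr_injective]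
    exact Nat.lt_succ_of_le (hK4 e)
  · rwa [coeff_totalGraphPoly]

end Components

/-! ### Alternating edge sums along walks. -/

section Trails

variable {W : Type*}

/-- A walk whose alternating edge sum is a nonzero form `y_u ± y_v` in its ends. -/
structure Trail (H : SimpleGraph W) where
  fst : W
  snd : W
  walk : H.Walk fst snd
  nondeg : fst ≠ snd ∨ Odd walk.length

/-- The coefficients of the alternating sum of the edges of a walk. -/
noncomputable def altCoeff [DecidableEq W] {H : SimpleGraph W} : {u v : W} → H.Walk u v → Sym2 W → ℝ
  | _, _, .nil => 0
  | u, _, .cons (v := w) _ p => fun e => (if e = s(u, w) then 1 else 0) - altCoeff p e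

lemma mem_edges_of_altCoeff_ne_zero [DecidableEq W] {H : SimpleGraph W} {u v : W} (p : H.Walk u v) {e : Sym2 W}
    (h : altCoeff p e ≠ 0) : e ∈ p.edges := by
  induction p with
  | nil => exact absurd rfl h
  | cons hadj p ih =>
    rw [SimpleGraph.Walk.edges_cons, List.mem_cons]
    by_contra hne
    push Not at hne
    refine h ?_
    simp only [altCoeff]
    rw [if_neg hne.1, zero_sub, neg_eq_zero]
    by_contra h'
    exact hne.2 (ih h')

/-- Telescoping: consecutive edges meet at an inner vertex with opposite signs. In particular a
closed walk of odd length still gives `2 y_u`, while one of even length gives zero. -/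
lemma sum_altCoeff [Fintype W] [DecidableEq W] {H : SimpleGraph W} {u v : W} (p : H.Walk u v)
    (x : W) : ∑ e : Sym2 W, (if x ∈ e then altCoeff p e else 0) =
      (if x = u then 1 else 0) + (-1) ^ (p.length + 1) * (if x = v then 1 else 0) := by
  induction p with
  | nil => simp [altCoeff]; split_ifs <;> norm_num
  | @cons u w v hadj p ih =>
    have h1 : ∀ e : Sym2 W, (if x ∈ e then altCoeff (SimpleGraph.Walk.cons hadj p) e else 0) =
        (if e = s(u, w) then (if x ∈ e then 1 else 0) else 0) -
          (if x ∈ e then altCoeff p e else 0) := by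
      intro e
      simp only [altCoeff]
      split_ifs <;> simp
    rw [Finset.sum_congr rfl fun e _ => h1 e, Finset.sum_sub_distrib, ih,
      Finset.sum_ite_eq' Finset.univ, if_pos (Finset.mem_univ _), SimpleGraph.Walk.length_cons]
    have h2 : ((if x ∈ s(u, w) then 1 else 0 : ℝ)) =
        (if x = u then 1 else 0) + (if x = w then 1 else 0) := by
      have := hadj.ne
      simp only [Sym2.mem_iff]
      by_cases hu : x = u
      · have : x ≠ w := fun h => this (hu.symm.trans h)
        simp [hu, hadj.ne]
      · simp [hu]
    rw [h2]
    ring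

namespace Trail

variable {H : SimpleGraph W}

noncomputable def sign (t : Trail H) : ℝ := (-1) ^ (t.walk.length + 1)

noncomputable def toSignedPair (t : Trail H) : SignedPair W where
  fst := t.fst
  snd := t.snd
  sign := t.sign
  sign_eq := neg_one_pow_eq_or ℝ _
  nondeg := t.nondeg.imp_right fun h => (h.add_odd odd_one).neg_one_pow

end Trail

end Trails

/-! ### Levels, forms for the outer edges, and the criterion in terms of trails. -/

section Assembly

lemma sum_edgeSet_eq_sum {W β : Type*} [Fintype W] [DecidableEq W] [AddCommMonoid β]
    (H : SimpleGraph W) [Fintype H.edgeSet] (f : Sym2 W → β) (hf : ∀ e, f e ≠ 0 → e ∈ H.edgeSet) :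
    ∑ e : H.edgeSet, f e.val = ∑ e, f e := by
  classical
  rw [← Finset.sum_subset (Finset.subset_univ (Finset.univ.filter (· ∈ H.edgeSet)))]
  · exact (Finset.sum_subtype _ (by simp) f).symm
  · intro e _ he
    by_contra h
    exact he (by simpa using hf e h)

variable {W : Type*} [Fintype W] [LinearOrder W] (H : SimpleGraph W) (A : Finset W)

/-- The end of an edge lying in `A` if there is one, the smaller end otherwise. -/
def mainEnd (e : Sym2 W) : W :=
  if e.inf ∈ A then e.inf else if e.sup ∈ A then e.sup else e.inf

def minorEnd (e : Sym2 W) : W :=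
  if e.inf ∈ A then e.sup else if e.sup ∈ A then e.inf else e.sup

/-- All of `A` shares the top level, and each outer vertex has a level of its own, higher for
smaller vertices. The leading product thus separates into a polynomial in the variables of `A` and
single outer variables. -/
def levelWeight (x : W) : ℕ :=
  if x ∈ A then Fintype.card W else (Finset.univ.filter fun v => x < v).card

open Classical in
/-- The neighbours of the larger end of `e` outside `A` that are smaller than both ends. -/
noncomputable def lowerMates (e : Sym2 W) : Finset W :=
  Finset.univ.filter fun b => b ∉ A ∧ H.Adj b e.sup ∧ b < e.inf

variable (ex : W → W)

/-- The largest lower mate of `e`, or the exit neighbour of the larger end of `e`. -/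
noncomputable def mate (e : Sym2 W) : W :=
  open Classical in
  if h : (lowerMates H A e).Nonempty then (lowerMates H A e).max' h else ex e.sup

lemma levelWeight_lt_card {x : W} (hx : x ∉ A) : levelWeight A x < Fintype.card W := by
  rw [levelWeight, if_neg hx]
  refine Finset.card_lt_univ_of_notMem (x := x) ?_
  simp

lemma levelWeight_lt_of_lt {x y : W} (hx : x ∉ A) (hy : y ∉ A) (h : x < y) :
    levelWeight A y < levelWeight A x := by
  rw [levelWeight, levelWeight, if_neg hx, if_neg hy]
  refine Finset.card_lt_card ?_
  rw [Finset.ssubset_iff_of_subset]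
  · exact ⟨y, by simpa using h, by simp⟩
  · intro z hz
    simp only [Finset.mem_filter, Finset.mem_univ, true_and] at hz ⊢
    exact h.trans hz

lemma levelWeight_eq_iff {x y : W} (hy : y ∉ A) :
    levelWeight A x = levelWeight A y ↔ x = y := by
  constructor
  · intro h
    by_cases hx : x ∈ A
    · have := levelWeight_lt_card A hy
      rw [← h, levelWeight, if_pos hx] at this
      exact absurd this (lt_irrefl _)
    · rcases lt_trichotomy x y with h1 | h1 | h1
      · exact absurd h (levelWeight_lt_of_lt A hx hy h1).ne'
      · exact h1
      · exact absurd h (levelWeight_lt_of_lt A hy hx h1).ne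
  · rintro rfl; rfl

variable {H A ex}

lemma sym2_eq_mk_mainEnd {W : Type*} [LinearOrder W] {A : Finset W} (e : Sym2 W) : e = s(mainEnd A e, minorEnd A e) := by
  have := sym2_eq_mk_inf_sup e
  rw [mainEnd, minorEnd]
  split_ifs
  · exact this
  · rw [Sym2.eq_swap]; exact this
  · exact this

lemma inf_lt_sup {W : Type*} [LinearOrder W] {H : SimpleGraph W} {e : Sym2 W} (he : e ∈ H.edgeSet) : e.inf < e.sup := by
  refine lt_of_le_of_ne (Sym2.inf_le_sup e) ?_
  have := sym2_eq_mk_inf_sup e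
  rw [this, SimpleGraph.mem_edgeSet] at he
  exact he.ne

lemma levelWeight_minorEnd_lt (hA : ∀ a ∈ A, ∀ b ∈ A, ¬ H.Adj a b) {e : Sym2 W}
    (he : e ∈ H.edgeSet) : levelWeight A (minorEnd A e) < levelWeight A (mainEnd A e) := by
  have h1 := inf_lt_sup he
  have h2 : H.Adj e.inf e.sup := by
    have := sym2_eq_mk_inf_sup e
    rwa [this, SimpleGraph.mem_edgeSet] at he
  rw [mainEnd, minorEnd]
  split_ifs with ha hb
  · have hb : e.sup ∉ A := fun hb => hA _ ha _ hb h2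
    have := levelWeight_lt_card A hb
    conv_rhs => rw [levelWeight, if_pos ha]
    exact this
  · have := levelWeight_lt_card A ha
    conv_rhs => rw [levelWeight, if_pos hb]
    exact this
  · exact levelWeight_lt_of_lt A ha hb h1

lemma adj_inf_sup {W : Type*} [LinearOrder W] {H : SimpleGraph W} {e : Sym2 W}
    (he : e ∈ H.edgeSet) : H.Adj e.inf e.sup := by
  have := sym2_eq_mk_inf_sup e
  rwa [this, SimpleGraph.mem_edgeSet] at he

/-- The edge `e` and its mate edge share `e.sup`, so their difference lives at `e.inf` and the mate;
the weight inequality makes `e.inf` the leading vertex. -/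
lemma mate_spec (hex : ∀ b ∉ A, (∃ b' ∉ A, H.Adj b' b ∧ b' < b) → ex b ∈ A ∧ H.Adj (ex b) b)
    {e : Sym2 W} (he : e ∈ H.edgeSet) (h1 : e.inf ∉ A) (h2 : e.sup ∉ A) :
    H.Adj (mate H A ex e) e.sup ∧ mate H A ex e ≠ e.inf ∧
      levelWeight A e.inf < levelWeight A (mate H A ex e) := by
  classical
  rw [mate]
  split_ifs with h
  · have := (lowerMates H A e).max'_mem h
    simp only [lowerMates, Finset.mem_filter, Finset.mem_univ, true_and] at this
    exact ⟨this.2.1, this.2.2.ne, levelWeight_lt_of_lt A this.1 h1 this.2.2⟩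
  · obtain ⟨h3, h4⟩ := hex _ h2 ⟨_, h1, adj_inf_sup he, inf_lt_sup he⟩
    refine ⟨h4, fun h5 => h1 (h5 ▸ h3), ?_⟩
    conv_rhs => rw [levelWeight, if_pos h3]
    exact levelWeight_lt_card A h1

/-- Two edges outside `A` with the same larger end and the same mate coincide. -/
lemma mate_injOn (hex : ∀ b ∉ A, (∃ b' ∉ A, H.Adj b' b ∧ b' < b) → ex b ∈ A ∧ H.Adj (ex b) b)
    {e e' : Sym2 W} (he : e ∈ H.edgeSet) (h1 : e.inf ∉ A) (h2 : e.sup ∉ A)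
    (he' : e' ∈ H.edgeSet) (h1' : e'.inf ∉ A)
    (hs : e.sup = e'.sup) (hm : mate H A ex e = mate H A ex e') : e = e' := by
  classical
  have key : ∀ e e' : Sym2 W, e ∈ H.edgeSet → e.inf ∉ A → e.sup ∉ A → e' ∈ H.edgeSet → e'.inf ∉ A →
      e.sup = e'.sup → mate H A ex e = mate H A ex e' → ¬ e.inf < e'.inf := by
    intro e e' he h1 h2 he' h1' hs hm hlt
    -- If `e.inf < e'.inf`, then `e.inf` is a candidate for the mate of `e'`, so that mate is outer
    -- and at least `e.inf`. The mate of `e` has greater weight than `e.inf`, so the two cannot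
    -- agree.
    have hmem : e.inf ∈ lowerMates H A e' := by
      simp only [lowerMates, Finset.mem_filter, Finset.mem_univ, true_and]
      exact ⟨h1, hs ▸ adj_inf_sup he, hlt⟩
    have hle : e.inf ≤ mate H A ex e' := by
      rw [mate, dif_pos ⟨_, hmem⟩]
      exact Finset.le_max' _ _ hmem
    have hnot : mate H A ex e' ∉ A := by
      rw [mate, dif_pos ⟨_, hmem⟩]
      have := (lowerMates H A e').max'_mem ⟨_, hmem⟩
      simp only [lowerMates, Finset.mem_filter, Finset.mem_univ, true_and] at this
      exact this.1
    have h3 := (mate_spec hex he h1 h2).2.2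
    rw [hm] at h3
    rcases hle.eq_or_lt with h | h
    · rw [h] at h3; exact lt_irrefl _ h3
    · exact lt_asymm h3 (levelWeight_lt_of_lt A h1 hnot h)
  have hinf : e.inf = e'.inf := by
    rcases lt_trichotomy e.inf e'.inf with h | h | h
    · exact absurd h (key e e' he h1 h2 he' h1' hs hm)
    · exact h
    · exact absurd h (key e' e he' h1' (hs ▸ h2) he h1 hs.symm hm.symm)
  rw [sym2_eq_mk_inf_sup e, sym2_eq_mk_inf_sup e', hinf, hs]

/-- The coefficients of the form attached to an edge outside `A`. -/
noncomputable def chainCoeff (H : SimpleGraph W) (A : Finset W) (ex : W → W) (t e : Sym2 W) : ℝ :=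
  (if e = t then 1 else 0) - if e = s(mate H A ex t, t.sup) then 1 else 0

lemma sum_chainCoeff (hex : ∀ b ∉ A, (∃ b' ∉ A, H.Adj b' b ∧ b' < b) → ex b ∈ A ∧ H.Adj (ex b) b)
    {t : Sym2 W} (he : t ∈ H.edgeSet) (h1 : t.inf ∉ A) (h2 : t.sup ∉ A) (x : W) :
    ∑ e : Sym2 W, (if x ∈ e then chainCoeff H A ex t e else 0) =
      (if x = t.inf then 1 else 0) - if x = mate H A ex t then 1 else 0 := by
  have h3 : ∀ e : Sym2 W, (if x ∈ e then chainCoeff H A ex t e else 0) =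
      (if e = t then (if x ∈ e then 1 else 0) else 0) -
        if e = s(mate H A ex t, t.sup) then (if x ∈ e then 1 else 0) else 0 := by
    intro e
    simp only [chainCoeff]
    split_ifs <;> simp
  have h4 : ∀ a b : W, a ≠ b → ((if x ∈ s(a, b) then 1 else 0 : ℝ)) =
        (if x = a then 1 else 0) + (if x = b then 1 else 0) := by
    intro a b hab
    simp only [Sym2.mem_iff]
    by_cases hu : x = a
    · simp [hu, hab]
    · simp [hu]
  rw [Finset.sum_congr rfl fun e _ => h3 e, Finset.sum_sub_distrib,
    Finset.sum_ite_eq' Finset.univ, Finset.sum_ite_eq' Finset.univ, if_pos (Finset.mem_univ _),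
    if_pos (Finset.mem_univ _), h4 _ _ (mate_spec hex he h1 h2).1.ne]
  have h5 : (if x ∈ t then 1 else 0 : ℝ) = if x ∈ s(t.inf, t.sup) then 1 else 0 := by
    rw [← sym2_eq_mk_inf_sup]
  rw [h5, h4 _ _ (inf_lt_sup he).ne]
  ring

/-- The edges outside `A`. -/
abbrev OuterEdge (H : SimpleGraph W) (A : Finset W) : Type _ :=
  {e : H.edgeSet // e.val.inf ∉ A ∧ e.val.sup ∉ A}

open Classical in
-- The outer edges with a common larger end form a chain of consecutive differences ending in the
-- exit edge. An edge therefore occurs at most once positively, as itself, and at most once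
-- negatively, as a mate edge.
lemma card_chainCoeff_le [Fintype H.edgeSet]
    (hex : ∀ b ∉ A, (∃ b' ∉ A, H.Adj b' b ∧ b' < b) → ex b ∈ A ∧ H.Adj (ex b) b)
    (e : Sym2 W) :
    (Finset.univ.filter fun t : OuterEdge H A => chainCoeff H A ex t.1.1 e ≠ 0).card ≤
      (if e.inf ∉ A ∧ e.sup ∉ A then 1 else 0) + 
      if ∃ t : OuterEdge H A, e = s(mate H A ex t.1.1, t.1.1.sup) then 1 else 0 := by
  have hsub : (Finset.univ.filter fun t : OuterEdge H A => chainCoeff H A ex t.1.1 e ≠ 0) ⊆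
      (Finset.univ.filter fun t : OuterEdge H A => e = t.1.1) ∪
      (Finset.univ.filter fun t : OuterEdge H A => e = s(mate H A ex t.1.1, t.1.1.sup)) := by
    intro t ht
    simp only [Finset.mem_filter, Finset.mem_univ, true_and, Finset.mem_union] at ht ⊢
    by_contra hne
    push Not at hne
    rw [chainCoeff, if_neg hne.1, if_neg hne.2] at ht
    exact ht (sub_self _)
  refine (Finset.card_le_card hsub).trans ((Finset.card_union_le _ _).trans (add_le_add ?_ ?_))
  · split_ifs with h
    · refine Finset.card_le_one.2 fun a ha b hb => ?_
      simp only [Finset.mem_filter, Finset.mem_univ, true_and] at ha hb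
      exact Subtype.ext (Subtype.ext (ha.symm.trans hb))
    · rw [Nat.le_zero, Finset.card_eq_zero, Finset.filter_eq_empty_iff]
      rintro t - rfl
      exact h t.2
  · split_ifs with h
    · refine Finset.card_le_one.2 fun a ha b hb => ?_
      simp only [Finset.mem_filter, Finset.mem_univ, true_and] at ha hb
      have hab := ha.symm.trans hb
      obtain ⟨s1, s2⟩ | ⟨s1, s2⟩ := Sym2.eq_iff.1 hab
      · exact Subtype.ext (Subtype.ext
          (mate_injOn hex a.1.2 a.2.1 a.2.2 b.1.2 b.2.1 s2 s1))
      -- The same edge cannot be a mate edge at both of its ends: the weights would increase around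
      -- a cycle.
      · exfalso
        have ha' := mate_spec hex a.1.2 a.2.1 a.2.2
        have hb' := mate_spec hex b.1.2 b.2.1 b.2.2
        have l1 := levelWeight_lt_of_lt A a.2.1 a.2.2 (inf_lt_sup a.1.2)
        have l2 := levelWeight_lt_of_lt A b.2.1 b.2.2 (inf_lt_sup b.1.2)
        have l3 := ha'.2.2
        have l4 := hb'.2.2
        rw [s1] at l3
        rw [← s2] at l4
        omega
    · rw [Nat.le_zero, Finset.card_eq_zero, Finset.filter_eq_empty_iff]
      rintro t - ht
      exact h ⟨t, ht⟩

end Assembly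

section Assembly

variable {W : Type*} [Fintype W] [LinearOrder W] {H : SimpleGraph W} {A : Finset W} {ex : W → W}

lemma incForm_mainEnd [Fintype H.edgeSet] (f : Sym2 W → ℝ) (hf : ∀ e, f e ≠ 0 → e ∈ H.edgeSet)
    (x : W) :
    incForm (fun e : H.edgeSet => mainEnd A e.val) (fun e => minorEnd A e.val)
      (fun e => f e.val) x = ∑ e : Sym2 W, if x ∈ e then f e else 0 := by
  rw [incForm, ← sum_edgeSet_eq_sum H]
  · refine Finset.sum_congr rfl fun e _ => ?_
    have : x ∈ e.val ↔ (x = mainEnd A e.val ∨ x = minorEnd A e.val) := by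
      conv_lhs => rw [sym2_eq_mk_mainEnd (A := A) e.val]
      exact Sym2.mem_iff
    simp only [this]
  · intro e he
    refine hf e fun h => he ?_
    rw [h, ite_self]

lemma Trail.altCoeff_mem_edgeSet {W : Type*} [DecidableEq W] {H : SimpleGraph W} (t : Trail H) (e : Sym2 W) (h : altCoeff t.walk e ≠ 0) :
    e ∈ H.edgeSet :=
  t.walk.edges_subset_edgeSet (mem_edges_of_altCoeff_ne_zero _ h)

lemma chainCoeff_mem_edgeSet
    (hex : ∀ b ∉ A, (∃ b' ∉ A, H.Adj b' b ∧ b' < b) → ex b ∈ A ∧ H.Adj (ex b) b)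
    {t : Sym2 W} (he : t ∈ H.edgeSet) (h1 : t.inf ∉ A) (h2 : t.sup ∉ A) (e : Sym2 W)
    (h : chainCoeff H A ex t e ≠ 0) : e ∈ H.edgeSet := by
  rw [chainCoeff] at h
  by_cases h3 : e = t
  · rw [h3]; exact he
  · by_cases h4 : e = s(mate H A ex t, t.sup)
    · rw [h4]; exact (mate_spec hex he h1 h2).1
    · rw [if_neg h3, if_neg h4, sub_self] at h
      exact absurd rfl h

lemma sum_C_mul_X_single (x : W) :
    ∑ y, (C (if y = x then 1 else 0) * X y : MvPolynomial W ℝ) = X x := by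
  rw [Finset.sum_eq_single x]
  · simp
  · intro y _ hy; simp [hy]
  · intro h; exact absurd (Finset.mem_univ _) h

lemma levelForm_trail (t : Trail H) (h1 : t.fst ∈ A) (h2 : t.snd ∈ A) (x : W) (hx : x ∈ A) :
    ∑ y, (C (if levelWeight A y = levelWeight A x then
      ∑ e : Sym2 W, (if y ∈ e then altCoeff t.walk e else 0) else 0) * X y : MvPolynomial W ℝ) =
      t.toSignedPair.form := by
  have key : ∀ y, (C (if levelWeight A y = levelWeight A x then
      ∑ e : Sym2 W, (if y ∈ e then altCoeff t.walk e else 0) else 0) * X y : MvPolynomial W ℝ) =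
      C (if y = t.fst then 1 else 0) * X y +
        C t.sign * (C (if y = t.snd then 1 else 0) * X y) := by
    intro y
    rw [sum_altCoeff]
    have : levelWeight A y = levelWeight A x ↔ y ∈ A := by
      by_cases hy : y ∈ A
      · simp [levelWeight, hx, hy]
      · have := levelWeight_lt_card A hy
        have h3 : levelWeight A x = Fintype.card W := by rw [levelWeight, if_pos hx]
        simp only [hy, iff_false]
        omega
    simp only [this]
    by_cases h3 : y ∈ A
    · rw [if_pos h3, C_add, C_mul, Trail.sign]
      ring
    · have h4 : y ≠ t.fst := fun h => h3 (h ▸ h1)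
      have h5 : y ≠ t.snd := fun h => h3 (h ▸ h2)
      simp [h3, h4, h5]
  rw [Finset.sum_congr rfl fun y _ => key y, Finset.sum_add_distrib, ← Finset.mul_sum,
    sum_C_mul_X_single, sum_C_mul_X_single]
  rfl

lemma levelForm_chain
    (hex : ∀ b ∉ A, (∃ b' ∉ A, H.Adj b' b ∧ b' < b) → ex b ∈ A ∧ H.Adj (ex b) b)
    {t : Sym2 W} (he : t ∈ H.edgeSet) (h1 : t.inf ∉ A) (h2 : t.sup ∉ A) :
    ∑ y, (C (if levelWeight A y = levelWeight A t.inf then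
      ∑ e : Sym2 W, (if y ∈ e then chainCoeff H A ex t e else 0) else 0) * X y :
        MvPolynomial W ℝ) = X t.inf := by
  rw [← sum_C_mul_X_single t.inf]
  refine Finset.sum_congr rfl fun y _ => ?_
  congr 2
  rw [sum_chainCoeff hex he h1 h2]
  have h3 := (mate_spec hex he h1 h2).2.1
  have h4 : y = t.inf → y ≠ mate H A ex t := fun h h' => h3 (h'.symm.trans h)
  simp only [levelWeight_eq_iff A h1]
  split_ifs with h5 h6
  · exact absurd h6 (h4 h5)
  · simp
  · rfl

lemma mainEnd_mem_iff {W : Type*} [LinearOrder W] {A : Finset W} {e : Sym2 W} : mainEnd A e ∈ A ↔ ¬ (e.inf ∉ A ∧ e.sup ∉ A) := by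
  rw [mainEnd]
  split_ifs with h1 h2 <;> simp [*]

lemma card_mainEnd_eq [Fintype H.edgeSet] (hA : ∀ a ∈ A, ∀ b ∈ A, ¬ H.Adj a b) (x : W) :
    open Classical in
    (Finset.univ.filter fun e : {e : H.edgeSet // ¬ (e.val.inf ∉ A ∧ e.val.sup ∉ A)} =>
      mainEnd A e.1.1 = x).card =
      if x ∈ A then (Finset.univ.filter fun y => H.Adj x y).card else 0 := by
  classical
  split_ifs with hx
  · symm
    have hs : ∀ y, H.Adj x y → mainEnd A s(x, y) = x := by
      intro y hy
      have h1 := sym2_eq_mk_mainEnd (A := A) s(x, y)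
      have hy' : y ∉ A := fun h => hA x hx y h hy
      have h2 : mainEnd A s(x, y) ∈ A := by
        rw [mainEnd_mem_iff]
        rintro ⟨h3, h4⟩
        have h5 : x ∈ s(x, y) := Sym2.mem_mk_left _ _
        rw [sym2_eq_mk_inf_sup s(x, y), Sym2.mem_iff] at h5
        rcases h5 with h5 | h5
        · exact h3 (h5 ▸ hx)
        · exact h4 (h5 ▸ hx)
      obtain ⟨h3, -⟩ | ⟨-, h3⟩ := Sym2.eq_iff.1 h1
      · exact h3.symm
      · exact absurd (h3 ▸ h2) hy'
    refine Finset.card_bij (fun y hy => ⟨⟨s(x, y), (Finset.mem_filter.1 hy).2⟩, ?_⟩) ?_ ?_ ?_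
    · rw [← mainEnd_mem_iff, hs y (Finset.mem_filter.1 hy).2]
      exact hx
    · intro y hy
      rw [Finset.mem_filter]
      exact ⟨Finset.mem_univ _, hs y (Finset.mem_filter.1 hy).2⟩
    · intro y _ z _ h
      have := congrArg (fun e => e.1.1) h
      exact Sym2.congr_right.1 this
    · intro e he
      have h1 := (Finset.mem_filter.1 he).2
      have h2 := sym2_eq_mk_mainEnd (A := A) e.1.1
      rw [h1] at h2
      refine ⟨minorEnd A e.1.1, ?_, Subtype.ext (Subtype.ext h2.symm)⟩
      rw [Finset.mem_filter, ← SimpleGraph.mem_edgeSet, ← h2]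
      exact ⟨Finset.mem_univ _, e.1.2⟩
  · rw [Finset.card_eq_zero, Finset.filter_eq_empty_iff]
    rintro e - rfl
    exact hx (mainEnd_mem_iff.2 e.2)

/-- A system of trails delivering every vertex `a ∈ A` as an end `deg a` times, the trails of `L`
only at their first end, gives a small exponent if no edge is used too often. -/
theorem hasSmallExponent_of_trails [Fintype H.edgeSet] (hA : ∀ a ∈ A, ∀ b ∈ A, ¬ H.Adj a b)
    (hex : ∀ b ∉ A, (∃ b' ∉ A, H.Adj b' b ∧ b' < b) → ex b ∈ A ∧ H.Adj (ex b) b)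
    {ι κ : Type*} [Fintype ι] [Fintype κ] (R : ι → Trail H) (L : κ → Trail H)
    (hL : Fintype.card κ ≤ 1) (hLA : ∀ j, (L j).snd ∈ A)
    (htok : ∀ x, (Finset.univ.filter fun i => (R i).fst = x).card +
      (Finset.univ.filter fun i => (R i).snd = x).card +
      (Finset.univ.filter fun j => (L j).fst = x).card =
        open Classical in if x ∈ A then (Finset.univ.filter fun y => H.Adj x y).card else 0)
    (huse : ∀ a ∈ A, ∀ b ∉ A, H.Adj a b →
      2 * (Finset.univ.filter fun i => s(a, b) ∈ (R i).walk.edges).card +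
        (Finset.univ.filter fun j => s(a, b) ∈ (L j).walk.edges).card ≤
          if a = ex b then 3 else 4)
    (huse' : ∀ b ∉ A, ∀ b' ∉ A, H.Adj b b' → b < b' →
      2 * (Finset.univ.filter fun i => s(b, b') ∈ (R i).walk.edges).card +
        (Finset.univ.filter fun j => s(b, b') ∈ (L j).walk.edges).card ≤
          open Classical in if ∀ b'' ∉ A, H.Adj b'' b' → b'' < b' → b'' ≤ b then 3 else 2) :
    HasSmallExponent H := by
  classical
  intro p q hpq
  set u : H.edgeSet → W := fun e => mainEnd A e.val with hu
  set v : H.edgeSet → W := fun e => minorEnd A e.val with hv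
  have hends : (∀ i, (R i).fst ∈ A) ∧ (∀ i, (R i).snd ∈ A) ∧ ∀ j, (L j).fst ∈ A := by
    refine ⟨fun i => ?_, fun i => ?_, fun j => ?_⟩
    · by_contra h
      have := htok (R i).fst
      rw [if_neg h] at this
      have h2 : i ∈ Finset.univ.filter fun i' => (R i').fst = (R i).fst := by simp
      have := Finset.card_pos.2 ⟨i, h2⟩
      omega
    · by_contra h
      have := htok (R i).snd
      rw [if_neg h] at this
      have h2 : i ∈ Finset.univ.filter fun i' => (R i').snd = (R i).snd := by simp
      have := Finset.card_pos.2 ⟨i, h2⟩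
      omega
    · by_contra h
      have := htok (L j).fst
      rw [if_neg h] at this
      have h2 : j ∈ Finset.univ.filter fun i' => (L i').fst = (L j).fst := by simp
      have := Finset.card_pos.2 ⟨j, h2⟩
      omega
  obtain ⟨hR1, hR2, hL1⟩ := hends
  -- The same alternating sum of a trail in `R` is entered twice, once with each end as its token;
  -- this produces the square. A trail in `L` is entered once, and an outer edge has its smaller end
  -- as token.
  let tok : (ι × Bool) ⊕ (κ ⊕ OuterEdge H A) → W :=
    Sum.elim (fun i => if i.2 then (R i.1).fst else (R i.1).snd)
      (Sum.elim (fun j => (L j).fst) (fun e => e.1.1.inf))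
  let c0 : (ι × Bool) ⊕ (κ ⊕ OuterEdge H A) → Sym2 W → ℝ :=
    Sum.elim (fun i => altCoeff (R i.1).walk)
      (Sum.elim (fun j => altCoeff (L j).walk) (fun e => chainCoeff H A ex e.1.1))
  have hc0 : ∀ t e, c0 t e ≠ 0 → e ∈ H.edgeSet := by
    rintro (i | j | t) e h
    · exact (R i.1).altCoeff_mem_edgeSet e h
    · exact (L j).altCoeff_mem_edgeSet e h
    · exact chainCoeff_mem_edgeSet hex t.1.2 t.2.1 t.2.2 e h
  have hform : ∀ t x, incForm u v (fun e => c0 t e.val) x =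
      ∑ e : Sym2 W, if x ∈ e then c0 t e else 0 := fun t x => incForm_mainEnd (c0 t) (hc0 t) x
  have main := exists_coeff_ne_zero_of_leading u v (levelWeight A)
    (fun e => levelWeight_minorEnd_lt hA e.2) tok ?_ (fun t e => c0 t e.val) 4 ?_ ?_ ?_
  · obtain ⟨K, hK4, hK⟩ := main
    refine ⟨K, hK4, ?_⟩
    -- Reorienting an edge changes only the sign of its factor.
    have hsign : ∀ i : H.edgeSet, ∃ s : ℝ, s ≠ 0 ∧ ∑ e : H.edgeSet,
        (C ((if p i ∈ e.val then 1 else 0) - (if q i ∈ e.val then 1 else 0) : ℝ) * X e :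
          MvPolynomial H.edgeSet ℝ) =
        C s * ∑ e, C ((if u i = u e ∨ u i = v e then 1 else 0) -
          (if v i = u e ∨ v i = v e then 1 else 0) : ℝ) * X e := by
      intro i
      have hmem : ∀ (x : W) (e : H.edgeSet), (x = u e ∨ x = v e) ↔ x ∈ e.val := by
        intro x e
        conv_rhs => rw [sym2_eq_mk_mainEnd (A := A) e.val]
        exact Sym2.mem_iff.symm
      simp only [hmem]
      have h1 := (hpq i).symm.trans (sym2_eq_mk_mainEnd (A := A) i.val)
      obtain ⟨h2, h3⟩ | ⟨h2, h3⟩ := Sym2.eq_iff.1 h1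
      · exact ⟨1, one_ne_zero, by rw [h2, h3, C_1, one_mul]⟩
      · refine ⟨-1, by norm_num, ?_⟩
        rw [h2, h3, Finset.mul_sum]
        refine Finset.sum_congr rfl fun e _ => ?_
        rw [← mul_assoc, ← C_mul]
        congr 2
        ring
    choose s hs0 hs using hsign
    rw [Finset.prod_congr rfl fun i _ => hs i, Finset.prod_mul_distrib, ← map_prod, coeff_C_mul]
    exact mul_ne_zero (Finset.prod_ne_zero_iff.2 fun i _ => hs0 i) hK
  · ext x
    rw [Finsupp.finsetSum_apply, Finsupp.finsetSum_apply]
    simp only [Finsupp.single_apply]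
    rw [Fintype.sum_sum_type, Fintype.sum_sum_type, Fintype.sum_prod_type]
    have l1 : ∑ i, ∑ b, (if tok (Sum.inl (i, b)) = x then 1 else 0) =
        (Finset.univ.filter fun i => (R i).fst = x).card +
          (Finset.univ.filter fun i => (R i).snd = x).card := by
      rw [Finset.card_filter, Finset.card_filter, ← Finset.sum_add_distrib]
      exact Finset.sum_congr rfl fun i _ => Fintype.sum_bool _
    have l2 : ∑ j, (if tok (Sum.inr (Sum.inl j)) = x then 1 else 0) =
        (Finset.univ.filter fun j => (L j).fst = x).card := by
      rw [Finset.card_filter]; rfl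
    rw [l1, l2, ← add_assoc, htok, ← card_mainEnd_eq hA, add_comm,
      ← Fintype.sum_subtype_add_sum_subtype (fun e : H.edgeSet => e.val.inf ∉ A ∧ e.val.sup ∉ A),
      Finset.card_filter]
    congr 1
    refine Finset.sum_congr rfl fun e _ => ?_
    have : u e.1 = e.1.1.inf := by
      simp only [hu, mainEnd]
      rw [if_neg e.2.1, if_neg e.2.2]
    rw [this]
    rfl
  · intro e
    rw [Finset.card_filter, Fintype.sum_sum_type, Fintype.sum_sum_type, Fintype.sum_prod_type]
    have l1 : ∑ i, ∑ b, (if c0 (Sum.inl (i, b)) e.val ≠ 0 then 1 else 0) =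
        2 * (Finset.univ.filter fun i => altCoeff (R i).walk e.val ≠ 0).card := by
      rw [Finset.card_filter, Finset.mul_sum]
      exact Finset.sum_congr rfl fun i _ => (Fintype.sum_bool _).trans (two_mul _).symm
    have l2 : ∑ j, (if c0 (Sum.inr (Sum.inl j)) e.val ≠ 0 then 1 else 0) =
        (Finset.univ.filter fun j => altCoeff (L j).walk e.val ≠ 0).card := by
      rw [Finset.card_filter]; rfl
    have l3 : ∑ j, (if c0 (Sum.inr (Sum.inr j)) e.val ≠ 0 then 1 else 0) =
        (Finset.univ.filter fun t : OuterEdge H A => chainCoeff H A ex t.1.1 e.val ≠ 0).card := by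
      rw [Finset.card_filter]; rfl
    rw [l1, l2, l3]
    have e1 : (Finset.univ.filter fun i => altCoeff (R i).walk e.val ≠ 0).card ≤
        (Finset.univ.filter fun i => e.val ∈ (R i).walk.edges).card :=
      Finset.card_le_card fun i hi => by
        simp only [Finset.mem_filter, Finset.mem_univ, true_and] at hi ⊢
        exact mem_edges_of_altCoeff_ne_zero _ hi
    have e2 : (Finset.univ.filter fun i => altCoeff (L i).walk e.val ≠ 0).card ≤
        (Finset.univ.filter fun i => e.val ∈ (L i).walk.edges).card :=
      Finset.card_le_card fun i hi => by
        simp only [Finset.mem_filter, Finset.mem_univ, true_and] at hi ⊢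
        exact mem_edges_of_altCoeff_ne_zero _ hi
    have e3 := card_chainCoeff_le hex e.val
    by_cases hout : e.val.inf ∉ A ∧ e.val.sup ∉ A
    · have e4 := huse' _ hout.1 _ hout.2 (adj_inf_sup e.2) (inf_lt_sup e.2)
      rw [← sym2_eq_mk_inf_sup] at e4
      rw [if_pos hout] at e3
      -- The last edge of a chain, to the largest smaller outer neighbour, is never subtracted. This
      -- spares one use, hence the bound `3` in place of `2`.
      have e5 : (if ∃ t : OuterEdge H A, e.val = s(mate H A ex t.1.1, t.1.1.sup) then 1 else 0) ≤
          if ∀ b'' ∉ A, H.Adj b'' e.val.sup → b'' < e.val.sup → b'' ≤ e.val.inf then 0 else 1 := by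
        split_ifs with h1 h2
        · exfalso
          obtain ⟨t, ht⟩ := h1
          have h3 := mate_spec hex t.1.2 t.2.1 t.2.2
          rw [sym2_eq_mk_inf_sup e.val] at ht
          have h6 := levelWeight_lt_of_lt A t.2.1 t.2.2 (inf_lt_sup t.1.2)
          obtain ⟨h4, h5⟩ | ⟨h4, h5⟩ := Sym2.eq_iff.1 ht
          · have h7 := h2 _ t.2.1 (h5 ▸ adj_inf_sup t.1.2) (h5 ▸ inf_lt_sup t.1.2)
            rw [h4] at h7
            rcases h7.eq_or_lt with h8 | h8
            · exact h3.2.1 h8.symm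
            · have := levelWeight_lt_of_lt A t.2.1 (h4 ▸ hout.1) h8
              have := h3.2.2
              omega
          · have h7 := levelWeight_lt_of_lt A hout.1 hout.2 (inf_lt_sup e.2)
            rw [h4, h5] at h7
            have := h3.2.2
            omega
        · simp
        · simp
        · simp
      by_cases h6 : ∀ b'' ∉ A, H.Adj b'' e.val.sup → b'' < e.val.sup → b'' ≤ e.val.inf
      · rw [if_pos h6] at e4 e5
        omega
      · rw [if_neg h6] at e4 e5
        omega
    · have hm := mainEnd_mem_iff.2 hout
      have hs := sym2_eq_mk_mainEnd (A := A) e.val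
      have hadj : H.Adj (mainEnd A e.val) (minorEnd A e.val) := by
        rw [← SimpleGraph.mem_edgeSet, ← hs]; exact e.2
      have hm' : minorEnd A e.val ∉ A := fun h => hA _ hm _ h hadj
      have e4 := huse _ hm _ hm' hadj
      rw [← hs] at e4
      rw [if_neg hout] at e3
      -- An edge meeting `A` enters the chains only as the exit edge of its outer end.
      have e5 : (if ∃ t : OuterEdge H A, e.val = s(mate H A ex t.1.1, t.1.1.sup) then 1 else 0) ≤
          if mainEnd A e.val = ex (minorEnd A e.val) then 1 else 0 := by
        split_ifs with h1 h2
        · exact le_rfl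
        · exfalso
          obtain ⟨t, ht⟩ := h1
          rw [hs] at ht
          obtain ⟨h4, h5⟩ | ⟨h4, h5⟩ := Sym2.eq_iff.1 ht
          · refine h2 ?_
            rw [h4, h5, mate, dif_neg]
            intro hne
            have := (lowerMates H A t.1.1).max'_mem hne
            have h6 : mate H A ex t.1.1 ∉ A := by
              rw [mate, dif_pos hne]
              exact (Finset.mem_filter.1 this).2.1
            exact h6 (h4 ▸ hm)
          · exact t.2.2 (h4 ▸ hm)
        · simp
        · simp
      by_cases h6 : mainEnd A e.val = ex (minorEnd A e.val)
      · rw [if_pos h6] at e4 e5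
        omega
      · rw [if_neg h6] at e4 e5
        omega
  · have hlev : ∀ x ∈ A, ∀ y ∈ A, levelWeight A x ≤ levelWeight A y := fun x hx y hy => by
      rw [levelWeight, levelWeight, if_pos hx, if_pos hy]
    have htrail : ∀ (t : Trail H) (x : W), t.fst ∈ A → t.snd ∈ A →
        (∑ e : Sym2 W, if x ∈ e then altCoeff t.walk e else 0) ≠ 0 → x ∈ A := by
      intro t x h1 h2 hne
      rw [sum_altCoeff] at hne
      by_contra h
      rw [if_neg (fun h' : x = t.fst => h (h' ▸ h1)), if_neg (fun h' : x = t.snd => h (h' ▸ h2)), mul_zero, add_zero] at hne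
      exact hne rfl
    rintro (i | j | t) x hx
    · rw [hform] at hx
      refine hlev _ ?_ _ (htrail (R i.1) x (hR1 _) (hR2 _) hx)
      simp only [tok, Sum.elim_inl]
      split_ifs
      · exact hR1 _
      · exact hR2 _
    · rw [hform] at hx
      exact hlev _ (hL1 j) _ (htrail (L j) x (hL1 _) (hLA _) hx)
    · rw [hform] at hx
      change ∑ e : Sym2 W, (if x ∈ e then chainCoeff H A ex t.1.1 e else 0) ≠ 0 at hx
      change levelWeight A t.1.1.inf ≤ _
      rw [sum_chainCoeff hex t.1.2 t.2.1 t.2.2] at hx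
      by_cases h1 : x = t.1.1.inf
      · rw [h1]
      · by_cases h2 : x = mate H A ex t.1.1
        · rw [h2]; exact (mate_spec hex t.1.2 t.2.1 t.2.2).2.2.le
        · rw [if_neg h1, if_neg h2, sub_self] at hx
          exact absurd rfl hx
  · have hprod : ∏ t, ∑ x, C (if levelWeight A x = levelWeight A (tok t) then
        incForm u v (fun e => c0 t e.val) x else 0) * X x =
        ((∏ i, (R i).toSignedPair.form) * (∏ i, (R i).toSignedPair.form)) *
        (∏ j, (L j).toSignedPair.form) *
          monomial (∑ t : OuterEdge H A, Finsupp.single t.1.1.inf 1) 1 := by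
      rw [Fintype.prod_sum_type, Fintype.prod_sum_type, Fintype.prod_prod_type]
      simp only [Fintype.prod_bool]
      rw [Finset.prod_mul_distrib, mul_assoc (_ * _) _ (monomial _ _)]
      simp only [hform]
      congr 1
      · congr 1
        · exact Finset.prod_congr rfl fun i _ => levelForm_trail (R i) (hR1 i) (hR2 i) _ (hR1 i)
        · exact Finset.prod_congr rfl fun i _ => levelForm_trail (R i) (hR1 i) (hR2 i) _ (hR2 i)
      · congr 1
        · exact Finset.prod_congr rfl fun i _ => levelForm_trail (L i) (hL1 i) (hLA i) _ (hL1 i)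
        · rw [monomial_sum_one]
          exact Finset.prod_congr rfl fun t _ => levelForm_chain hex t.1.2 t.2.1 t.2.2
    rw [hprod]
    have hdeg : ∑ t, Finsupp.single (tok t) 1 = (∑ i, (R i).toSignedPair.deg +
        ∑ j, Finsupp.single (L j).fst 1) + ∑ t : OuterEdge H A, Finsupp.single t.1.1.inf 1 := by
      rw [Fintype.sum_sum_type, Fintype.sum_sum_type, Fintype.sum_prod_type]
      simp only [tok, Sum.elim_inl, Sum.elim_inr, Fintype.sum_bool, if_true, Bool.false_eq_true,
        if_false]
      rw [add_assoc]
      rfl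
    rw [hdeg, coeff_mul_monomial, mul_one]
    set S : Multiset (SignedPair W) := Finset.univ.val.map fun i => (R i).toSignedPair with hS
    have hS1 : ∑ i, (R i).toSignedPair.deg = (S.map SignedPair.deg).sum := by
      rw [hS, Multiset.map_map]; rfl
    have hS2 : ∏ i, (R i).toSignedPair.form = (S.map SignedPair.form).prod := by
      rw [hS, Multiset.map_map]; rfl
    rw [hS1, hS2]
    rcases isEmpty_or_nonempty κ with hκ | ⟨⟨j⟩⟩
    · rw [Finset.univ_eq_empty, Finset.sum_empty, Finset.prod_empty, add_zero, mul_one]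
      exact SignedPair.coeff_prod_sq_ne_zero S
    · have : Subsingleton κ := Fintype.card_le_one_iff_subsingleton.1 hL
      rw [Fintype.sum_subsingleton _ j, Fintype.prod_subsingleton _ j]
      exact SignedPair.coeff_prod_sq_mul_form_ne_zero S (L j).toSignedPair

end Assembly

/-! ### Splitting the tokens at one outer vertex into pairs. -/

section Pairings

variable {W : Type*}

/-- All entries of a multiset of pairs. -/
def ends (N : Multiset (W × W)) : Multiset W := N.map Prod.fst + N.map Prod.snd

@[simp] lemma ends_zero : ends (0 : Multiset (W × W)) = 0 := rfl

@[simp] lemma ends_cons (p : W × W) (N : Multiset (W × W)) :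
    ends (p ::ₘ N) = p.1 ::ₘ p.2 ::ₘ ends N := by
  simp only [ends, Multiset.map_cons, Multiset.cons_add, Multiset.add_cons]
  exact Multiset.cons_swap _ _ _

lemma exists_pairing [DecidableEq W] (r : W → W → Prop) [DecidableRel r] (hr : Equivalence r)
    (s : Finset W) (hs : ∀ x, Even (s.filter (r x)).card) :
    ∃ N : Multiset (W × W), (∀ p ∈ N, p.1 ≠ p.2 ∧ r p.1 p.2) ∧ ends N = s.val := by
  induction s using Finset.strongInduction with
  | H s ih =>
    rcases s.eq_empty_or_nonempty with rfl | ⟨x, hx⟩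
    · exact ⟨0, by simp, by simp⟩
    · have h1 : x ∈ s.filter (r x) := Finset.mem_filter.2 ⟨hx, hr.refl x⟩
      have h2 : 1 < (s.filter (r x)).card := by
        have := Finset.card_pos.2 ⟨x, h1⟩
        obtain ⟨k, hk⟩ := hs x
        omega
      obtain ⟨y, hy, hyx⟩ := Finset.exists_mem_ne h2 x
      obtain ⟨hys, hxy⟩ := Finset.mem_filter.1 hy
      have hy' : y ∈ s.erase x := Finset.mem_erase.2 ⟨hyx, hys⟩
      obtain ⟨N, hN1, hN2⟩ := ih ((s.erase x).erase y)
        ((Finset.erase_ssubset hy').trans (Finset.erase_ssubset hx)) (by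
          intro z
          by_cases hz : r z x
          · have hzy : r z y := hr.trans hz hxy
            have e1 : ((s.erase x).erase y).filter (r z) =
                ((s.filter (r z)).erase x).erase y := by
              rw [Finset.filter_erase, Finset.filter_erase]
            have m1 : x ∈ s.filter (r z) := Finset.mem_filter.2 ⟨hx, hz⟩
            have m2 : y ∈ (s.filter (r z)).erase x :=
              Finset.mem_erase.2 ⟨hyx, Finset.mem_filter.2 ⟨hys, hzy⟩⟩
            have c1 := Finset.card_erase_add_one m1
            have c2 := Finset.card_erase_add_one m2
            rw [e1]
            have := hs z
            rw [← c1, ← c2, add_assoc] at this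
            exact (Nat.even_add.1 this).2 even_two
          · have hzy : ¬ r z y := fun h => hz (hr.trans h (hr.symm hxy))
            have e1 : ((s.erase x).erase y).filter (r z) = s.filter (r z) := by
              rw [Finset.filter_erase, Finset.filter_erase, Finset.erase_eq_of_notMem,
                Finset.erase_eq_of_notMem]
              · exact fun h => hz (Finset.mem_filter.1 h).2
              · exact fun h => hzy (Finset.mem_filter.1 (Finset.mem_of_mem_erase h)).2
            rw [e1]
            exact hs z)
      refine ⟨(x, y) ::ₘ N, ?_, ?_⟩
      · intro p hp
        rcases Multiset.mem_cons.1 hp with rfl | hp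
        · exact ⟨hyx.symm, hxy⟩
        · exact hN1 p hp
      · rw [ends_cons, hN2, Finset.erase_val, Finset.erase_val]
        rw [Multiset.cons_erase, Multiset.cons_erase]
        · exact hx
        · rw [← Finset.erase_val]
          exact hy'

lemma exists_pairing_of_even [DecidableEq W] (s : Finset W) (hs : Even s.card) :
    ∃ N : Multiset (W × W), (∀ p ∈ N, p.1 ≠ p.2) ∧ ends N = s.val := by
  obtain ⟨N, h1, h2⟩ := exists_pairing (fun _ _ : W => True)
    ⟨fun _ => trivial, fun _ => trivial, fun _ _ => trivial⟩ s (fun x => by simpa using hs)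
  exact ⟨N, fun p hp => (h1 p hp).1, h2⟩

lemma exists_pairing_add_double [DecidableEq W] (s : Finset W) (hs : Even s.card)
    (h0 : s.Nonempty) (d : W) (hd : d ∉ s) :
    ∃ N : Multiset (W × W), (∀ p ∈ N, p.1 ≠ p.2) ∧ ends N = s.val + {d, d} := by
  obtain ⟨x, hx⟩ := h0
  have h1 : 1 < s.card := by
    have := Finset.card_pos.2 ⟨x, hx⟩
    obtain ⟨k, hk⟩ := hs
    omega
  obtain ⟨y, hy, hyx⟩ := Finset.exists_mem_ne h1 x
  have hy' : y ∈ s.erase x := Finset.mem_erase.2 ⟨hyx, hy⟩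
  obtain ⟨N, hN1, hN2⟩ := exists_pairing_of_even ((s.erase x).erase y) (by
    have c1 := Finset.card_erase_add_one hx
    have c2 := Finset.card_erase_add_one hy'
    obtain ⟨k, hk⟩ := hs
    exact ⟨k - 1, by omega⟩)
  refine ⟨(x, d) ::ₘ (y, d) ::ₘ N, ?_, ?_⟩
  · intro p hp
    rcases Multiset.mem_cons.1 hp with rfl | hp
    · exact fun h : x = d => hd (h ▸ hx)
    rcases Multiset.mem_cons.1 hp with rfl | hp
    · exact fun h : y = d => hd (h ▸ hy)
    · exact hN1 p hp
  · have e : s.val = x ::ₘ y ::ₘ ((s.erase x).erase y).val := by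
      rw [Finset.erase_val, Finset.erase_val, Multiset.cons_erase, Multiset.cons_erase]
      · exact hx
      · rw [← Finset.erase_val]
        exact hy'
    rw [ends_cons, ends_cons, hN2, e]
    simp only [← Multiset.singleton_add, Multiset.insert_eq_cons]
    abel

/-- The multiset of `A`-vertices delivered to a vertex: `P` once, `U` twice, and `d` twice if `e`. -/
def delivered (P U : Finset W) (d : W) (e : Prop) [Decidable e] : Multiset W :=
  P.val + 2 • U.val + if e then {d, d} else 0

/-- The delivered multiset is split into pairs of distinct vertices, an optional vertex `o`,
and `k` further vertices. -/
def Splits (M : Multiset W) (o : Option W) (k : ℕ) : Prop :=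
  ∃ (N : Multiset (W × W)) (S : Multiset W), (∀ p ∈ N, p.1 ≠ p.2) ∧ S.card = k ∧
    M = ends N + S + o.toFinset.val

/-- The two copies of `d` must go into different pairs. If `P` is nonempty it has two vertices to
absorb them; otherwise some `χ ∈ Q` is doubled and the pair `(d, χ)` is used twice. -/
lemma exists_splits_of_even [DecidableEq W] (P Q : Finset W) (d : W) (e : Prop) [Decidable e]
    (hdP : e → d ∉ P) (hdQ : e → d ∉ Q) (k : ℕ) (hk : k ≤ 1) (hek : e → k = 0)
    (hQ : e → P = ∅ → Q.Nonempty) (heven : Even (P.card + k)) :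
    ∃ U ⊆ Q, (¬ e → U = ∅) ∧ Splits (delivered P U d e) none k := by
  by_cases he : e
  · obtain rfl := hek he
    rcases P.eq_empty_or_nonempty with rfl | hP
    · obtain ⟨χ, hχ⟩ := hQ he rfl
      refine ⟨{χ}, by simpa using hχ, fun h => absurd he h,
        {(d, χ), (d, χ)}, 0, ?_, by simp, ?_⟩
      · intro p hp
        have : p = (d, χ) := by simpa using hp
        rw [this]
        exact fun h => hdQ he (by rw [show d = χ from h]; exact hχ)
      · ext a
        simp only [delivered, if_pos he, Multiset.insert_eq_cons, ← Multiset.cons_zero, ends_cons,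
          ends_zero, Multiset.count_add, Multiset.count_nsmul, Multiset.count_cons,
          Multiset.count_zero, Finset.empty_val, Finset.singleton_val, Option.toFinset_none]
        omega
    · obtain ⟨N, h1, h2⟩ := exists_pairing_add_double P (by simpa using heven) hP d (hdP he)
      exact ⟨∅, by simp, fun _ => rfl, N, 0, h1, by simp, by simp [delivered, he, h2]⟩
  · interval_cases k
    · obtain ⟨N, h1, h2⟩ := exists_pairing_of_even P (by simpa using heven)
      exact ⟨∅, by simp, fun _ => rfl, N, 0, h1, by simp, by simp [delivered, he, h2]⟩
    · obtain ⟨x, hx⟩ : P.Nonempty := by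
        rw [Finset.nonempty_iff_ne_empty]
        rintro rfl
        simp at heven
      have c1 := Finset.card_erase_add_one hx
      obtain ⟨N, h1, h2⟩ := exists_pairing_of_even (P.erase x) (by
        obtain ⟨m, hm⟩ := heven
        exact ⟨m - 1, by omega⟩)
      refine ⟨∅, by simp, fun _ => rfl, N, {x}, h1, by simp, ?_⟩
      have e : P.val = x ::ₘ (P.erase x).val := by
        rw [Finset.erase_val, Multiset.cons_erase]
        exact hx
      simp [delivered, he, h2]
      rw [← Multiset.singleton_add, Multiset.add_comm] at e
      simpa using e

lemma Splits.of_erase [DecidableEq W] {P U : Finset W} {d : W} {e : Prop} [Decidable e] {k : ℕ}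
    {x : W} (hx : x ∈ P) (h : Splits (delivered (P.erase x) U d e) none k) :
    Splits (delivered P U d e) (some x) k := by
  obtain ⟨N, S, h1, h2, h3⟩ := h
  refine ⟨N, S, h1, h2, ?_⟩
  have e1 : P.val = x ::ₘ (P.erase x).val := by
    rw [Finset.erase_val, Multiset.cons_erase]
    exact hx
  have e2 : delivered P U d e = x ::ₘ delivered (P.erase x) U d e := by
    simp only [delivered, e1, Multiset.cons_add]
  rw [e2, h3]
  simp [← Multiset.singleton_add, add_comm]

/-- Two different vertices to pass on are wanted, so that a clash at the far end of a path can be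
avoided. With two elements in `P` either may be passed. Otherwise a doubled `χ ∈ Q` supplies
alternatives, and the last two disjuncts record when the choice may be forced. -/
lemma exists_splits_of_odd [DecidableEq W] (P Q : Finset W) (d : W) (e : Prop) [Decidable e]
    (hdP : e → d ∉ P) (hdQ : e → d ∉ Q) (hPQ : Disjoint P Q) (k : ℕ) (hk : k ≤ 1) (hek : e → k = 0)
    (hne : (P ∪ Q).Nonempty) (hodd : Odd (P.card + k)) :
    ∃ o₁ o₂, (∃ U ⊆ Q, Splits (delivered P U d e) (some o₁) k) ∧
      (∃ U ⊆ Q, Splits (delivered P U d e) (some o₂) k) ∧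
      (o₁ ≠ o₂ ∨ (¬ e ∧ P ∪ Q = {o₁}) ∨ (e ∧ o₁ = d)) := by
  rcases Nat.lt_or_ge 1 P.card with hP | hP
  · have key : ∀ x ∈ P, ∃ U ⊆ Q, Splits (delivered P U d e) (some x) k := by
      intro x hx
      have c1 := Finset.card_erase_add_one hx
      have hne : (P.erase x).Nonempty := Finset.card_pos.1 (by omega)
      obtain ⟨U, hU, -, h⟩ := exists_splits_of_even (P.erase x) ∅ d e
        (fun h h' => hdP h (Finset.mem_of_mem_erase h')) (by simp) k hk hek
        (fun _ h => absurd h hne.ne_empty) (by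
          rw [← c1] at hodd
          obtain ⟨m, hm⟩ := hodd
          exact ⟨m, by omega⟩)
      exact ⟨U, hU.trans (Finset.empty_subset _), h.of_erase hx⟩
    obtain ⟨x, hx, y, hy, hxy⟩ := Finset.one_lt_card.1 hP
    exact ⟨x, y, key x hx, key y hy, Or.inl hxy⟩
  · have hpair : ∀ x y : W, ∀ p ∈ ({(x, y), (x, y)} : Multiset (W × W)), p = (x, y) := by
      intro x y p hp
      simpa using hp
    interval_cases k
    · have hP1 : P.card = 1 := by
        obtain ⟨m, hm⟩ := hodd
        omega
      obtain ⟨x, rfl⟩ := Finset.card_eq_one.1 hP1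
      by_cases he : e
      · have h1 : ∃ U ⊆ Q, Splits (delivered {x} U d e) (some d) 0 := by
          refine ⟨∅, by simp, {(x, d)}, 0, ?_, by simp, ?_⟩
          · intro p hp
            rw [Multiset.mem_singleton.1 hp]
            exact fun h : x = d => hdP he (Finset.mem_singleton.2 h.symm)
          · ext a
            simp only [delivered, if_pos he, Multiset.insert_eq_cons, ← Multiset.cons_zero,
              ends_cons, ends_zero, Multiset.count_add, Multiset.count_nsmul, Multiset.count_cons,
              Multiset.count_zero, Finset.empty_val, Finset.singleton_val, Option.toFinset_some]
            omega
        exact ⟨d, d, h1, h1, Or.inr (Or.inr ⟨he, rfl⟩)⟩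
      · have h1 : ∃ U ⊆ Q, Splits (delivered {x} U d e) (some x) 0 := by
          refine ⟨∅, by simp, 0, 0, by simp, by simp, ?_⟩
          simp [delivered, if_neg he]
        rcases Q.eq_empty_or_nonempty with rfl | ⟨χ, hχ⟩
        · exact ⟨x, x, h1, h1, Or.inr (Or.inl ⟨he, by simp⟩)⟩
        · have hχx : x ≠ χ := fun h => Finset.disjoint_left.1 hPQ (Finset.mem_singleton_self x)
            (h ▸ hχ)
          refine ⟨x, χ, h1, ⟨{χ}, by simpa using hχ, {(x, χ)}, 0, ?_, by simp, ?_⟩, Or.inl hχx⟩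
          · intro p hp
            rw [Multiset.mem_singleton.1 hp]
            exact hχx
          · ext a
            simp only [delivered, if_neg he, Multiset.insert_eq_cons, ← Multiset.cons_zero,
              ends_cons, ends_zero, Multiset.count_add, Multiset.count_nsmul, Multiset.count_cons,
              Multiset.count_zero, Finset.singleton_val, Option.toFinset_some]
            omega
    · have hP0 : P = ∅ := by
        rw [← Finset.card_eq_zero]
        obtain ⟨m, hm⟩ := hodd
        omega
      subst hP0
      have he : ¬ e := fun h => absurd (hek h) one_ne_zero
      rw [Finset.empty_union] at hne ⊢
      have key : ∀ χ ∈ Q, ∃ U ⊆ Q, Splits (delivered ∅ U d e) (some χ) 1 := by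
        intro χ hχ
        refine ⟨{χ}, by simpa using hχ, 0, {χ}, by simp, by simp, ?_⟩
        ext a
        simp only [delivered, if_neg he, Multiset.insert_eq_cons, ← Multiset.cons_zero,
          ends_zero, Multiset.count_add, Multiset.count_nsmul, Multiset.count_cons,
          Multiset.count_zero, Finset.empty_val, Finset.singleton_val, Option.toFinset_some]
        omega
      obtain ⟨χ, hχ⟩ := hne
      by_cases hQ : ∃ y ∈ Q, χ ≠ y
      · obtain ⟨y, hy, hne⟩ := hQ
        exact ⟨χ, y, key χ hχ, key y hy, Or.inl hne⟩
      · push Not at hQ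
        exact ⟨χ, χ, key χ hχ, key χ hχ, Or.inr (Or.inl ⟨he,
          Finset.eq_singleton_iff_unique_mem.2 ⟨hχ, fun y hy => (hQ y hy).symm⟩⟩)⟩

end Pairings

/-! ### Frames, and the marking that controls parity in the components. -/

section Recursion

variable {W : Type*} [Fintype W] [LinearOrder W]

open Classical in
-- The condition at `v` involves, besides `v`, only larger vertices, so membership is decided from
-- the largest vertex downwards.
lemma exists_parity_set (P : W → W) (f : W → ℕ) :
    ∃ X : Finset W, ∀ v, Even ((if v ∈ X then 1 else 0) +
      (X.filter fun c => v < c ∧ P c = v).card + f v) := by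
  have wf : WellFounded ((· > ·) : W → W → Prop) := wellFounded_gt
  let x : W → Prop := wf.fix fun v ih =>
    ¬ Even ((Finset.univ.filter fun c => ∃ h : c > v, P c = v ∧ ih c h).card + f v)
  have hx : ∀ v, x v ↔
      ¬ Even ((Finset.univ.filter fun c => ∃ _ : c > v, P c = v ∧ x c).card + f v) := by
    intro v
    exact Iff.of_eq (wf.fix_eq _ v)
  refine ⟨Finset.univ.filter x, fun v => ?_⟩
  have h1 : ((Finset.univ.filter x).filter fun c => v < c ∧ P c = v) =
      Finset.univ.filter fun c => ∃ _ : c > v, P c = v ∧ x c := by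
    ext c
    simp only [Finset.mem_filter, Finset.mem_univ, true_and, exists_prop]
    tauto
  rw [h1]
  have h2 := hx v
  simp only [Finset.mem_filter, Finset.mem_univ, true_and]
  by_cases h : x v
  · rw [if_pos h, add_assoc, add_comm, Nat.even_add_one]
    exact h2.1 h
  · rw [if_neg h, zero_add]
    by_contra h3
    exact h (h2.2 h3)

lemma exists_recursive_pred (g : W → W) (F : W → Prop → Prop) :
    ∃ x : W → Prop, ∀ v, g v < v → (x v ↔ F v (x (g v))) := by
  have wf : WellFounded ((· < ·) : W → W → Prop) := wellFounded_lt
  let x : W → Prop := wf.fix fun v ih => F v (∃ h : g v < v, ih (g v) h)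
  have hx : ∀ v, x v ↔ F v (∃ _ : g v < v, x (g v)) := fun v => Iff.of_eq (wf.fix_eq _ v)
  refine ⟨x, fun v hv => ?_⟩
  rw [hx v]
  have : (∃ _ : g v < v, x (g v)) = x (g v) := by simp [hv]
  rw [this]

end Recursion

/-- A graph with an ordered vertex set, each vertex except the least one having a smaller
neighbour, and a well-chosen dominating independent set `A`. -/
structure Frame {W : Type*} [LinearOrder W] (H : SimpleGraph W) where
  A : Finset W
  r : W
  indep : ∀ a ∈ A, ∀ b ∈ A, ¬ H.Adj a b
  dom : ∀ b ∉ A, ∃ a ∈ A, H.Adj b a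
  root_notMem : r ∉ A
  exists_smaller : ∀ v, v ≠ r → ∃ w, w < v ∧ H.Adj w v
  private_lt : ∀ b ∉ A, ∀ a, (∀ x ∈ A, H.Adj b x ↔ x = a) → b < a
  private_adj : ∀ b ∉ A, ∀ b' ∉ A, b ≠ b' → ∀ a, (∀ x ∈ A, H.Adj b x ↔ x = a) →
    (∀ x ∈ A, H.Adj b' x ↔ x = a) → H.Adj b b'
  swap_adj : ∀ b ∉ A, ∀ b' ∉ A, b ≠ b' → ∀ x a, a ∈ A → (∀ y ∈ A, H.Adj b y ↔ y = x ∨ y = a) →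
    (∀ y ∈ A, H.Adj b' y ↔ y = x) → a < b → a < b' → H.Adj b b'

namespace Frame

variable {W : Type*} [Fintype W] [LinearOrder W] {H : SimpleGraph W} (S : Frame H)

lemma root_le (v : W) : S.r ≤ v := by
  induction v using WellFoundedLT.induction with
  | ind v ih =>
    by_cases hv : v = S.r
    · exact hv.ge
    · obtain ⟨w, hw, -⟩ := S.exists_smaller v hv
      exact (ih w hw).trans hw.le

open Classical in
/-- A smaller neighbour. -/
noncomputable def par (v : W) : W := if h : v ≠ S.r then (S.exists_smaller v h).choose else v

lemma par_lt {v : W} (hv : v ≠ S.r) : S.par v < v := by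
  rw [par, dif_pos hv]
  exact (S.exists_smaller v hv).choose_spec.1

lemma par_adj {v : W} (hv : v ≠ S.r) : H.Adj (S.par v) v := by
  rw [par, dif_pos hv]
  exact (S.exists_smaller v hv).choose_spec.2

lemma ne_root {a : W} (ha : a ∈ S.A) : a ≠ S.r := fun h => S.root_notMem (h ▸ ha)

lemma par_notMem {a : W} (ha : a ∈ S.A) : S.par a ∉ S.A := fun h =>
  S.indep _ h _ ha (S.par_adj (S.ne_root ha))

/-- The subgraph induced on the complement of `A`. -/
def outer : SimpleGraph W where
  Adj a b := H.Adj a b ∧ a ∉ S.A ∧ b ∉ S.A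
  symm := ⟨fun _ _ h => ⟨h.1.symm, h.2.2, h.2.1⟩⟩
  loopless := ⟨fun _ h => h.1.ne rfl⟩

lemma outer_le : S.outer ≤ H := fun _ _ h => h.1

lemma notMem_of_reachable {a b : W} (h : S.outer.Reachable a b) (ha : a ∉ S.A) : b ∉ S.A := by
  obtain ⟨p⟩ := h
  induction p with
  | nil => exact ha
  | cons hadj _ ih => exact ih hadj.2.2

open Classical in
/-- The least vertex in the component of `b` in the outer graph. -/
noncomputable def top (b : W) : W :=
  (Finset.univ.filter fun y => S.outer.Reachable b y).min'
    ⟨b, by simp⟩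

lemma reachable_top (b : W) : S.outer.Reachable b (S.top b) := by
  classical
  have := Finset.min'_mem (Finset.univ.filter fun y => S.outer.Reachable b y) ⟨b, by simp⟩
  exact (Finset.mem_filter.1 this).2

lemma top_le {b y : W} (h : S.outer.Reachable b y) : S.top b ≤ y :=
  Finset.min'_le _ _ (by classical exact Finset.mem_filter.2 ⟨Finset.mem_univ _, h⟩)

lemma top_le_self (b : W) : S.top b ≤ b := S.top_le (SimpleGraph.Reachable.refl _)

lemma top_eq {b y : W} (h : S.outer.Reachable b y) : S.top b = S.top y :=
  le_antisymm (S.top_le (h.trans (S.reachable_top y)))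
    (S.top_le (h.symm.trans (S.reachable_top b)))

lemma reachable_iff {b y : W} : S.outer.Reachable b y ↔ S.top b = S.top y := by
  refine ⟨S.top_eq, fun h => ?_⟩
  exact (S.reachable_top b).trans (h ▸ (S.reachable_top y).symm)

lemma top_top (b : W) : S.top (S.top b) = S.top b := (S.top_eq (S.reachable_top b)).symm

lemma top_notMem {b : W} (hb : b ∉ S.A) : S.top b ∉ S.A :=
  S.notMem_of_reachable (S.reachable_top b) hb

lemma par_mem_of_top {t : W} (ht : t ∉ S.A) (htop : S.top t = t) (hr : t ≠ S.r) :
    S.par t ∈ S.A := by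
  by_contra h
  have h1 : S.outer.Adj t (S.par t) := ⟨(S.par_adj hr).symm, ht, h⟩
  have := S.top_le h1.reachable
  rw [htop] at this
  exact absurd this (S.par_lt hr).not_ge

lemma top_root : S.top S.r = S.r := le_antisymm (S.top_le_self _) (S.root_le _)

open Classical in
noncomputable def nbrs (b : W) : Finset W := S.A.filter (H.Adj b)

lemma mem_nbrs {a b : W} : a ∈ S.nbrs b ↔ a ∈ S.A ∧ H.Adj b a := by
  classical
  exact Finset.mem_filter

lemma nbrs_nonempty {b : W} (hb : b ∉ S.A) : (S.nbrs b).Nonempty := by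
  obtain ⟨a, ha, h⟩ := S.dom b hb
  exact ⟨a, S.mem_nbrs.2 ⟨ha, h⟩⟩

lemma adj_iff_of_nbrs_eq_singleton {b a : W} (h : S.nbrs b = {a}) :
    ∀ x ∈ S.A, H.Adj b x ↔ x = a := by
  intro x hx
  rw [← Finset.mem_singleton, ← h, S.mem_nbrs]
  exact ⟨fun h => ⟨hx, h⟩, fun h => h.2⟩

open Classical in
-- Parent map of a tree whose nodes are the outer components, represented by their least vertices,
-- and the vertices of `A`. The default value `v` is discarded by the condition `v < c` in
-- `even_marked`.
noncomputable def pointer (v : W) : W :=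
  if v ∈ S.A then S.top (S.par v) else if S.top v = v ∧ v ≠ S.r then S.par v else v

open Classical in
-- For a component top this counts the edges from its component to `A`, that is, the tokens before
-- correction; it is zero on `A`.
noncomputable def compDegree (v : W) : ℕ :=
  ∑ b ∈ Finset.univ.filter (fun b => b ∉ S.A ∧ S.top b = v), if v ∈ S.A then 0 else (S.nbrs b).card

/-- The set of marked vertices. -/
noncomputable def marked : Finset W := (exists_parity_set S.pointer S.compDegree).choose

open Classical in
lemma even_marked (v : W) : Even ((if v ∈ S.marked then 1 else 0) +
      (S.marked.filter fun c => v < c ∧ S.pointer c = v).card + S.compDegree v) := by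
  exact (exists_parity_set S.pointer S.compDegree).choose_spec v

/-- A marked component top other than the root. -/
def Loaded (b : W) : Prop := b ∉ S.A ∧ S.top b = b ∧ b ≠ S.r ∧ b ∈ S.marked

open Classical in
/-- The marked children in `A` of `b`. -/
noncomputable def children (b : W) : Finset W := S.A.filter fun a => a ∈ S.marked ∧ S.par a = b

open Classical in
/-- The neighbours in `A` of `b` which are neither marked children nor the parent of a loaded
vertex. -/
noncomputable def plain (b : W) : Finset W :=
  (S.nbrs b \ S.children b).filter fun a => ¬ (S.Loaded b ∧ a = S.par b)

lemma mem_children {a b : W} : a ∈ S.children b ↔ a ∈ S.A ∧ a ∈ S.marked ∧ S.par a = b := by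
  classical
  exact Finset.mem_filter

lemma mem_plain {a b : W} : a ∈ S.plain b ↔
    (a ∈ S.nbrs b ∧ a ∉ S.children b) ∧ ¬ (S.Loaded b ∧ a = S.par b) := by
  classical
  rw [plain, Finset.mem_filter, Finset.mem_sdiff]

lemma children_subset (b : W) : S.children b ⊆ S.nbrs b := by
  intro a ha
  obtain ⟨h1, -, rfl⟩ := S.mem_children.1 ha
  exact S.mem_nbrs.2 ⟨h1, S.par_adj (S.ne_root h1)⟩

lemma plain_subset (b : W) : S.plain b ⊆ S.nbrs b := fun _ h => (S.mem_plain.1 h).1.1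

lemma disjoint_plain_children (b : W) : Disjoint (S.plain b) (S.children b) :=
  Finset.disjoint_left.2 fun _ h => (S.mem_plain.1 h).1.2

lemma Loaded.par_mem {b : W} (h : S.Loaded b) : S.par b ∈ S.A :=
  S.par_mem_of_top h.1 h.2.1 h.2.2.1

lemma Loaded.par_mem_nbrs {b : W} (h : S.Loaded b) : S.par b ∈ S.nbrs b :=
  S.mem_nbrs.2 ⟨h.par_mem, (S.par_adj h.2.2.1).symm⟩

lemma par_notMem_children {b : W} (hb : b ≠ S.r) : S.par b ∉ S.children b := by
  intro h
  obtain ⟨h1, -, h3⟩ := S.mem_children.1 h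
  have h4 := S.par_lt (S.ne_root h1)
  rw [h3] at h4
  exact lt_asymm h4 (S.par_lt hb)

lemma Loaded.par_notMem_children {b : W} (h : S.Loaded b) : S.par b ∉ S.children b :=
  S.par_notMem_children h.2.2.1

lemma Loaded.par_notMem_plain {b : W} (h : S.Loaded b) : S.par b ∉ S.plain b := fun h' =>
  (S.mem_plain.1 h').2 ⟨h, rfl⟩

lemma mem_nbrs_iff {a b : W} : a ∈ S.nbrs b ↔
    a ∈ S.plain b ∨ a ∈ S.children b ∨ (S.Loaded b ∧ a = S.par b) := by
  constructor
  · intro h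
    by_contra h1
    push Not at h1
    exact h1.1 (S.mem_plain.2 ⟨⟨h, h1.2.1⟩, fun h2 => h1.2.2 h2.1 h2.2⟩)
  · rintro (h | h | ⟨h, rfl⟩)
    · exact S.plain_subset b h
    · exact S.children_subset b h
    · exact h.par_mem_nbrs

open Classical in
lemma card_nbrs (b : W) : (S.nbrs b).card =
    (S.plain b).card + (S.children b).card + if S.Loaded b then 1 else 0 := by
  rw [← Finset.card_union_of_disjoint (S.disjoint_plain_children b)]
  split_ifs with h
  · have h1 : S.nbrs b = insert (S.par b) (S.plain b ∪ S.children b) := by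
      ext a
      rw [S.mem_nbrs_iff, Finset.mem_insert, Finset.mem_union]
      tauto
    rw [h1, Finset.card_insert_of_notMem]
    rw [Finset.mem_union]
    rintro (h2 | h2)
    · exact h.par_notMem_plain S h2
    · exact h.par_notMem_children S h2
  · rw [add_zero]
    congr 1
    ext a
    rw [S.mem_nbrs_iff, Finset.mem_union]
    tauto

/-- The parent is a smaller neighbour in `A`, whereas by `private_lt` a unique neighbour in `A`
would be larger than `b`. -/
lemma Loaded.two_le_card_nbrs {b : W} (h : S.Loaded b) : 2 ≤ (S.nbrs b).card := by
  have h1 := Finset.card_pos.2 (S.nbrs_nonempty h.1)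
  by_contra h2
  have h3 : (S.nbrs b).card = 1 := by omega
  obtain ⟨a, ha⟩ := Finset.card_eq_one.1 h3
  have h4 := S.private_lt b h.1 a (S.adj_iff_of_nbrs_eq_singleton ha)
  have h5 := h.par_mem_nbrs
  rw [ha, Finset.mem_singleton] at h5
  exact lt_asymm h4 (h5 ▸ S.par_lt h.2.2.1)

open Classical in
/-- The number of tokens left over at `b`. -/
noncomputable def surplus (b : W) : ℕ := if b = S.r ∧ S.r ∈ S.marked then 1 else 0

lemma surplus_le_one (b : W) : S.surplus b ≤ 1 := by
  rw [surplus]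
  split_ifs <;> simp

lemma Loaded.surplus_eq_zero {b : W} (h : S.Loaded b) : S.surplus b = 0 :=
  if_neg fun h' => h.2.2.1 h'.1

open Classical in
-- Marked links carry zero or two tokens, so deleting them from the count leaves the parity
-- prescribed by the marking. The root has no link upwards, and its mark becomes the surplus.
lemma even_sum_plain (t : W) (ht : t ∉ S.A) (htop : S.top t = t) :
    Even (∑ b ∈ Finset.univ.filter (fun b => b ∉ S.A ∧ S.top b = t),
      ((S.plain b).card + S.surplus b)) := by
  set B := Finset.univ.filter (fun b => b ∉ S.A ∧ S.top b = t) with hB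
  have htB : t ∈ B := by simp [hB, ht, htop]
  have e1 : S.compDegree t = ∑ b ∈ B, (S.plain b).card + ∑ b ∈ B, (S.children b).card +
      ∑ b ∈ B, if S.Loaded b then 1 else 0 := by
    rw [compDegree, ← Finset.sum_add_distrib, ← Finset.sum_add_distrib]
    refine Finset.sum_congr rfl fun b _ => ?_
    rw [if_neg ht, S.card_nbrs]
  have e2 : (∑ b ∈ B, if S.Loaded b then 1 else 0) + ∑ b ∈ B, S.surplus b =
      if t ∈ S.marked then 1 else 0 := by
    have h1 : (∑ b ∈ B, if S.Loaded b then 1 else 0) = if S.Loaded t then 1 else 0 := by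
      refine Finset.sum_eq_single t ?_ (fun h => absurd htB h)
      intro b hb hbt
      rw [if_neg]
      intro h
      have h2 := (Finset.mem_filter.1 hb).2.2
      rw [h.2.1] at h2
      exact hbt h2
    have h2 : ∑ b ∈ B, S.surplus b = S.surplus t := by
      refine Finset.sum_eq_single t ?_ (fun h => absurd htB h)
      intro b hb hbt
      rw [surplus, if_neg]
      rintro ⟨rfl, -⟩
      have h2 := (Finset.mem_filter.1 hb).2.2
      rw [S.top_root] at h2
      exact hbt h2
    rw [h1, h2, surplus]
    by_cases hr : t = S.r
    · have h3 : ¬ S.Loaded t := fun h => h.2.2.1 hr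
      rw [if_neg h3, zero_add]
      simp [hr]
    · have h3 : S.Loaded t ↔ t ∈ S.marked := ⟨fun h => h.2.2.2, fun h => ⟨ht, htop, hr, h⟩⟩
      simp [h3, hr]
  have e3 : ∑ b ∈ B, (S.children b).card =
      (S.marked.filter fun c => t < c ∧ S.pointer c = t).card := by
    rw [← Finset.card_biUnion]
    · congr 1
      ext a
      simp only [Finset.mem_biUnion, Finset.mem_filter, hB, Finset.mem_univ, true_and,
        S.mem_children]
      constructor
      · rintro ⟨b, ⟨hb, hbt⟩, ha, ham, rfl⟩
        refine ⟨ham, ?_, ?_⟩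
        · rw [← hbt]
          exact (S.top_le_self _).trans_lt (S.par_lt (S.ne_root ha))
        · rw [pointer, if_pos ha, hbt]
      · rintro ⟨ham, hlt, hp⟩
        rw [pointer] at hp
        split_ifs at hp with h1 h2
        · exact ⟨S.par a, ⟨S.par_notMem h1, hp⟩, h1, ham, rfl⟩
        · exact absurd (hp ▸ S.par_mem_of_top h1 h2.1 h2.2) ht
        · exact absurd hp hlt.ne'
    · intro b _ b' _ hbb'
      rw [Function.onFun, Finset.disjoint_left]
      intro a ha ha'
      exact hbb' ((S.mem_children.1 ha).2.2.symm.trans (S.mem_children.1 ha').2.2)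
  have e4 := S.even_marked t
  rw [Finset.sum_add_distrib]
  obtain ⟨m, hm⟩ := e4
  rw [← e3, ← e2, e1] at hm
  exact ⟨m - (∑ b ∈ B, if S.Loaded b then 1 else 0) - ∑ b ∈ B, (S.children b).card, by omega⟩

open Classical in
/-- The outer vertices with an odd number of tokens to pass on. -/
noncomputable def oddSet : Finset W :=
  Finset.univ.filter fun b => b ∉ S.A ∧ Odd ((S.plain b).card + S.surplus b)

open Classical in
lemma even_card_oddSet (x : W) : Even (S.oddSet.filter (S.outer.Reachable x)).card := by
  by_cases hx : x ∈ S.A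
  · rw [Finset.filter_eq_empty_iff.2]
    · simp
    · intro y hy hxy
      exact S.notMem_of_reachable hxy.symm (Finset.mem_filter.1 hy).2.1 hx
  · have h1 := S.even_sum_plain (S.top x) (S.top_notMem hx) (S.top_top x)
    rw [Finset.even_sum_iff_even_card_odd] at h1
    convert h1 using 2
    ext y
    simp only [oddSet, Finset.mem_filter, Finset.mem_univ, true_and, S.reachable_iff]
    constructor
    · rintro ⟨⟨h1, h2⟩, h3⟩; exact ⟨⟨h1, h3.symm⟩, h2⟩
    · rintro ⟨⟨h1, h2⟩, h3⟩; exact ⟨⟨h1, h3⟩, h2.symm⟩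

end Frame

/-! ### Edge-disjoint shortest paths. -/

section MinimalPairing

variable {W : Type*}

lemma exists_split_of_mem_edges {G : SimpleGraph W} {x y : W} (w : G.Walk x y) {e : Sym2 W}
    (he : e ∈ w.edges) : ∃ p q, e = s(p, q) ∧ ∃ (w₁ : G.Walk x p) (w₂ : G.Walk q y),
      w₁.length + w₂.length + 1 = w.length := by
  induction w with
  | nil => simp at he
  | cons h w ih =>
    rw [SimpleGraph.Walk.edges_cons, List.mem_cons] at he
    rcases he with he | he
    · exact ⟨_, _, he, .nil, w, by simp⟩
    · obtain ⟨p, q, h1, w₁, w₂, h2⟩ := ih he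
      exact ⟨p, q, h1, .cons h w₁, w₂, by simp only [SimpleGraph.Walk.length_cons]; omega⟩

/-- An even set can be paired up along pairwise edge-disjoint shortest paths. -/
lemma exists_disjoint_pairing [DecidableEq W] (G : SimpleGraph W) [DecidableRel G.Reachable]
    (s : Finset W) (hs : ∀ x, Even (s.filter (G.Reachable x)).card) :
    ∃ N : Multiset (W × W), (∀ p ∈ N, p.1 ≠ p.2 ∧ G.Reachable p.1 p.2) ∧ ends N = s.val ∧
      ∀ p q N', N = p ::ₘ q ::ₘ N' → ∀ (w₁ : G.Walk p.1 p.2) (w₂ : G.Walk q.1 q.2),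
        w₁.length = G.dist p.1 p.2 → w₂.length = G.dist q.1 q.2 →
          ∀ e ∈ w₁.edges, e ∉ w₂.edges := by
  classical
  let T : ℕ → Prop := fun n => ∃ N : Multiset (W × W),
    ((∀ p ∈ N, p.1 ≠ p.2 ∧ G.Reachable p.1 p.2) ∧ ends N = s.val) ∧
      (N.map fun p => G.dist p.1 p.2).sum = n
  have hT : ∃ n, T n := by
    obtain ⟨N, hN⟩ := exists_pairing G.Reachable G.reachable_is_equivalence s hs
    exact ⟨_, N, hN, rfl⟩
  obtain ⟨N, ⟨h1, h2⟩, h3⟩ := Nat.find_spec hT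
  refine ⟨N, h1, h2, ?_⟩
  rintro ⟨x, y⟩ ⟨x', y'⟩ N' rfl w w' hw hw' e he he'
  simp only at w w' hw hw'
  have hnd : (ends ((x, y) ::ₘ (x', y') ::ₘ N')).Nodup := h2 ▸ s.nodup
  simp only [ends_cons, Multiset.nodup_cons, Multiset.mem_cons, not_or] at hnd
  have key : ∀ a b c d : W, a ≠ b → c ≠ d → G.Reachable a b → G.Reachable c d →
      a ::ₘ b ::ₘ c ::ₘ d ::ₘ ends N' = x ::ₘ y ::ₘ x' ::ₘ y' ::ₘ ends N' →
      G.dist x y + G.dist x' y' ≤ G.dist a b + G.dist c d := by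
    intro a b c d hab hcd rab rcd hends
    have hmin : Nat.find hT ≤ (((a, b) ::ₘ (c, d) ::ₘ N').map fun p => G.dist p.1 p.2).sum := by
      refine Nat.find_min' hT ⟨_, ⟨?_, ?_⟩, rfl⟩
      · intro p hp
        rcases Multiset.mem_cons.1 hp with rfl | hp
        · exact ⟨hab, rab⟩
        rcases Multiset.mem_cons.1 hp with rfl | hp
        · exact ⟨hcd, rcd⟩
        · exact h1 p (Multiset.mem_cons_of_mem (Multiset.mem_cons_of_mem hp))
      · rw [← h2]
        simpa using hends
    rw [← h3] at hmin
    simp only [Multiset.map_cons, Multiset.sum_cons] at hmin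
    omega
  -- If two paths share an edge, omit it from both and join the four remaining pieces crosswise,
  -- according to the directions of traversal. The new pairing is shorter by at least two, against
  -- minimality.
  obtain ⟨p, q, hpq, u, v, huv⟩ := exists_split_of_mem_edges w he
  obtain ⟨p', q', hpq', u', v', huv'⟩ := exists_split_of_mem_edges w' he'
  obtain ⟨rfl, rfl⟩ | ⟨rfl, rfl⟩ := Sym2.eq_iff.1 (hpq.symm.trans hpq')
  · have l1 := SimpleGraph.dist_le (u.append u'.reverse)
    have l2 := SimpleGraph.dist_le (v.reverse.append v')
    have l3 := key x x' y y' (by tauto) (by tauto) ⟨u.append u'.reverse⟩ ⟨v.reverse.append v'⟩ (by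
      ext a
      simp only [Multiset.count_cons]
      omega)
    simp only [SimpleGraph.Walk.length_append, SimpleGraph.Walk.length_reverse] at l1 l2
    omega
  · have l1 := SimpleGraph.dist_le (u.append v')
    have l2 := SimpleGraph.dist_le (u'.append v)
    have l3 := key x y' x' y (by tauto) (by tauto) ⟨u.append v'⟩ ⟨u'.append v⟩ (by
      ext a
      simp only [Multiset.count_cons]
      omega)
    simp only [SimpleGraph.Walk.length_append] at l1 l2
    omega

lemma exists_choice_of_pairs [DecidableEq W] (N : Multiset (W × W)) (hN : (ends N).Nodup)
    (Opt : W → W → Prop) (good : W × W → W → W → Prop)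
    (h : ∀ p ∈ N, ∃ x y, Opt p.1 x ∧ Opt p.2 y ∧ good p x y) :
    ∃ o : W → W, ∀ p ∈ N, Opt p.1 (o p.1) ∧ Opt p.2 (o p.2) ∧ good p (o p.1) (o p.2) := by
  induction N using Multiset.induction_on with
  | empty => exact ⟨id, by simp⟩
  | cons p N ih =>
    rw [ends_cons, Multiset.nodup_cons, Multiset.nodup_cons, Multiset.mem_cons, not_or] at hN
    obtain ⟨o, ho⟩ := ih hN.2.2 fun q hq => h q (Multiset.mem_cons_of_mem hq)
    obtain ⟨x, y, hx, hy, hxy⟩ := h p (Multiset.mem_cons_self p N)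
    refine ⟨Function.update (Function.update o p.1 x) p.2 y, ?_⟩
    have e1 : Function.update (Function.update o p.1 x) p.2 y p.1 = x := by
      rw [Function.update_of_ne hN.1.1, Function.update_self]
    have e2 : Function.update (Function.update o p.1 x) p.2 y p.2 = y := Function.update_self _ _ _
    intro q hq
    rcases Multiset.mem_cons.1 hq with rfl | hq
    · rw [e1, e2]; exact ⟨hx, hy, hxy⟩
    · have m1 : q.1 ∈ ends N := Multiset.mem_add.2 (Or.inl (Multiset.mem_map_of_mem _ hq))
      have m2 : q.2 ∈ ends N := Multiset.mem_add.2 (Or.inr (Multiset.mem_map_of_mem _ hq))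
      have e3 : ∀ z ∈ ends N, Function.update (Function.update o p.1 x) p.2 y z = o z := by
        intro z hz
        rw [Function.update_of_ne, Function.update_of_ne]
        · rintro rfl; exact hN.1.2 hz
        · rintro rfl; exact hN.2.1 hz
      rw [e3 _ m1, e3 _ m2]
      exact ho q hq

end MinimalPairing

/-! ### Choosing the vertices passed on, and which marked links are doubled. -/

namespace Frame

variable {W : Type*} [Fintype W] [LinearOrder W] {H : SimpleGraph W} (S : Frame H)

/-- The cases in which the vertex passed on by `b` is forced. -/
def Rigid (b o : W) : Prop :=
  (¬ S.Loaded b ∧ S.nbrs b = {o}) ∨ (S.Loaded b ∧ (S.nbrs b = {o, S.par b} ∨ o = S.par b))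

/-- A loaded `b` is the least vertex of its component, so `S.par b < b < b'`. If `o` is the parent
of `b`, this contradicts `private_lt` at `b'`; otherwise `swap_adj` applies with the parent as the
vertex exchanged along with `o`. -/
lemma Rigid.adj_of_loaded {b b' o : W} (hb' : b' ∉ S.A) (hne : b ≠ b')
    (htop : S.top b = S.top b') (hl : S.Loaded b) (hl' : ¬ S.Loaded b') (h : S.Rigid b o)
    (h' : S.Rigid b' o) : H.Adj b b' := by
  have hlt : b < b' := by
    refine lt_of_le_of_ne ?_ hne
    rw [← hl.2.1, htop]
    exact S.top_le_self b'
  have hpar := S.par_lt hl.2.2.1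
  obtain ⟨-, h1⟩ | ⟨h1, -⟩ := h'
  · obtain ⟨h2, -⟩ | ⟨-, h2 | rfl⟩ := h
    · exact absurd hl h2
    · refine S.swap_adj b hl.1 b' hb' hne o (S.par b) hl.par_mem ?_
        (S.adj_iff_of_nbrs_eq_singleton h1) hpar (hpar.trans hlt)
      intro y hy
      have h3 : y ∈ S.nbrs b ↔ y = o ∨ y = S.par b := by rw [h2]; simp
      rw [← h3, S.mem_nbrs]
      exact ⟨fun h => ⟨hy, h⟩, fun h => h.2⟩
    · have := S.private_lt b' hb' _ (S.adj_iff_of_nbrs_eq_singleton h1)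
      exact absurd (hlt.trans this) (lt_asymm hpar)
  · exact absurd h1 hl'

/-- At most one vertex of a component is loaded; for two unloaded ones `o` is a common private
neighbour and `private_adj` applies. -/
lemma Rigid.adj {b b' o : W} (hb : b ∉ S.A) (hb' : b' ∉ S.A) (hne : b ≠ b')
    (htop : S.top b = S.top b') (h : S.Rigid b o) (h' : S.Rigid b' o) : H.Adj b b' := by
  by_cases hl : S.Loaded b
  · refine h.adj_of_loaded S hb' hne htop hl (fun hl' => hne ?_) h'
    rw [← hl.2.1, htop, hl'.2.1]
  · by_cases hl' : S.Loaded b'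
    · exact (h'.adj_of_loaded S hb hne.symm htop.symm hl' hl h).symm
    · obtain ⟨-, h1⟩ | ⟨h1, -⟩ := h
      · obtain ⟨-, h2⟩ | ⟨h2, -⟩ := h'
        · exact S.private_adj b hb b' hb' hne o (S.adj_iff_of_nbrs_eq_singleton h1)
            (S.adj_iff_of_nbrs_eq_singleton h2)
        · exact absurd h2 hl'
      · exact absurd h1 hl

open Classical in
/-- The tokens delivered to `b`, where `l` tells whether a loaded vertex gets its parent. -/
noncomputable def package (l : Prop) (U : Finset W) (b : W) : Multiset W :=
  delivered (S.plain b) U (S.par b) (l ∧ S.Loaded b)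

/-- `b` can split its tokens into pairs while passing on `o`. -/
def CanPass (l : Prop) (b o : W) : Prop :=
  ∃ U ⊆ S.children b, Splits (S.package l U b) (some o) (S.surplus b)

lemma mem_oddSet {b : W} : b ∈ S.oddSet ↔ b ∉ S.A ∧ Odd ((S.plain b).card + S.surplus b) := by
  classical
  rw [oddSet, Finset.mem_filter]
  simp

lemma nbrs_eq_union {b : W} (h : ¬ S.Loaded b) : S.nbrs b = S.plain b ∪ S.children b := by
  ext a
  rw [S.mem_nbrs_iff, Finset.mem_union]
  tauto

lemma exists_canPass (l : Prop) {b : W} (hb : b ∈ S.oddSet) :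
    ∃ o₁ o₂, S.CanPass l b o₁ ∧ S.CanPass l b o₂ ∧ (o₁ ≠ o₂ ∨ S.Rigid b o₁) := by
  classical
  obtain ⟨hbA, hodd⟩ := S.mem_oddSet.1 hb
  have hne : (S.plain b ∪ S.children b).Nonempty := by
    by_cases hl : S.Loaded b
    · have h1 := hl.two_le_card_nbrs
      rw [S.card_nbrs, if_pos hl] at h1
      by_contra h2
      rw [Finset.not_nonempty_iff_eq_empty, Finset.union_eq_empty] at h2
      rw [h2.1, h2.2] at h1
      simp at h1
    · rw [← S.nbrs_eq_union hl]
      exact S.nbrs_nonempty hbA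
  obtain ⟨o₁, o₂, h1, h2, h3⟩ := exists_splits_of_odd (S.plain b) (S.children b) (S.par b)
    (l ∧ S.Loaded b) (fun h => h.2.par_notMem_plain) (fun h => h.2.par_notMem_children)
    (S.disjoint_plain_children b) (S.surplus b) (S.surplus_le_one b)
    (fun h => h.2.surplus_eq_zero) hne hodd
  refine ⟨o₁, o₂, h1, h2, h3.imp_right ?_⟩
  rintro (⟨h4, h5⟩ | ⟨h4, h5⟩)
  · by_cases hl : S.Loaded b
    · refine Or.inr ⟨hl, Or.inl ?_⟩
      ext a
      rw [S.mem_nbrs_iff, ← or_assoc, ← Finset.mem_union, h5]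
      simp [hl]
    · exact Or.inl ⟨hl, (S.nbrs_eq_union hl).trans h5⟩
  · exact Or.inr ⟨h4.2, Or.inr h5⟩

/-- A clash that cannot be avoided occurs only between two rigid vertices. These are adjacent, so
the connecting path has length one and the resulting closed walk is odd, with form `2 y_o`. -/
lemma exists_canPass_pair (l : Prop) {b b' : W} (hb : b ∈ S.oddSet) (hb' : b' ∈ S.oddSet)
    (hne : b ≠ b') (hr : S.outer.Reachable b b') :
    ∃ o o', S.CanPass l b o ∧ S.CanPass l b' o' ∧ (o ≠ o' ∨ Odd (S.outer.dist b b')) := by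
  obtain ⟨x₁, x₂, hx₁, hx₂, hx⟩ := S.exists_canPass l hb
  obtain ⟨y₁, y₂, hy₁, hy₂, hy⟩ := S.exists_canPass l hb'
  by_cases h1 : x₁ = y₁
  · subst h1
    rcases hx with hx | hx
    · exact ⟨x₂, x₁, hx₂, hy₁, Or.inl hx.symm⟩
    · rcases hy with hy | hy
      · exact ⟨x₁, y₂, hx₁, hy₂, Or.inl hy⟩
      · have hbA := (S.mem_oddSet.1 hb).1
        have hbA' := (S.mem_oddSet.1 hb').1
        have hadj : S.outer.Adj b b' := ⟨hx.adj S hbA hbA' hne (S.top_eq hr) hy, hbA, hbA'⟩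
        refine ⟨x₁, x₁, hx₁, hy₁, Or.inr ?_⟩
        rw [SimpleGraph.dist_eq_one_iff_adj.2 hadj]
        exact odd_one
  · exact ⟨x₁, y₁, hx₁, hy₁, Or.inl h1⟩

open Classical in
/-- A choice, at level `l`, of the doubled children and of the vertices passed on. -/
def IsChoice (N : Multiset (W × W)) (l : Prop) (U : W → Finset W) (o : W → W) : Prop :=
  (∀ b ∉ S.A, U b ⊆ S.children b ∧
    Splits (S.package l (U b) b) (if b ∈ S.oddSet then some (o b) else none) (S.surplus b) ∧
    (¬ S.Loaded b → b ∉ S.oddSet → U b = ∅)) ∧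
  ∀ p ∈ N, o p.1 ≠ o p.2 ∨ Odd (S.outer.dist p.1 p.2)

lemma exists_isChoice (N : Multiset (W × W)) (hN : ends N = S.oddSet.val)
    (hN' : ∀ p ∈ N, p.1 ≠ p.2 ∧ S.outer.Reachable p.1 p.2) (l : Prop) :
    ∃ U o, S.IsChoice N l U o := by
  classical
  have hmem : ∀ p ∈ N, p.1 ∈ S.oddSet ∧ p.2 ∈ S.oddSet := by
    intro p hp
    rw [← Finset.mem_val, ← Finset.mem_val, ← hN]
    exact ⟨Multiset.mem_add.2 (Or.inl (Multiset.mem_map_of_mem _ hp)),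
      Multiset.mem_add.2 (Or.inr (Multiset.mem_map_of_mem _ hp))⟩
  obtain ⟨o, ho⟩ := exists_choice_of_pairs N (hN ▸ S.oddSet.nodup) (S.CanPass l)
    (fun p x y => x ≠ y ∨ Odd (S.outer.dist p.1 p.2)) fun p hp =>
      S.exists_canPass_pair l (hmem p hp).1 (hmem p hp).2 (hN' p hp).1 (hN' p hp).2
  have key : ∀ b, ∃ U : Finset W, b ∉ S.A → U ⊆ S.children b ∧
      Splits (S.package l U b) (if b ∈ S.oddSet then some (o b) else none) (S.surplus b) ∧
      (¬ S.Loaded b → b ∉ S.oddSet → U = ∅) := by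
    intro b
    by_cases hb : b ∈ S.oddSet
    · have hb' : b ∈ ends N := by rw [hN]; exact hb
      have h1 : S.CanPass l b (o b) := by
        rcases Multiset.mem_add.1 hb' with h | h
        · obtain ⟨p, hp, rfl⟩ := Multiset.mem_map.1 h
          exact (ho p hp).1
        · obtain ⟨p, hp, rfl⟩ := Multiset.mem_map.1 h
          exact (ho p hp).2.1
      obtain ⟨U, hU, h2⟩ := h1
      refine ⟨U, fun _ => ⟨hU, ?_, fun _ h => absurd hb h⟩⟩
      rw [if_pos hb]
      exact h2
    · by_cases hbA : b ∈ S.A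
      · exact ⟨∅, fun h => absurd hbA h⟩
      · have heven : Even ((S.plain b).card + S.surplus b) := by
          rw [← Nat.not_odd_iff_even]
          exact fun h => hb (S.mem_oddSet.2 ⟨hbA, h⟩)
        obtain ⟨U, hU, h1, h2⟩ := exists_splits_of_even (S.plain b) (S.children b) (S.par b)
          (l ∧ S.Loaded b) (fun h => h.2.par_notMem_plain) (fun h => h.2.par_notMem_children)
          (S.surplus b) (S.surplus_le_one b) (fun h => h.2.surplus_eq_zero) (by
            rintro h h'
            have h3 := h.2.two_le_card_nbrs
            rw [S.card_nbrs, if_pos h.2, h'] at h3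
            refine Finset.card_pos.1 ?_
            rw [Finset.card_empty] at h3
            omega) heven
        refine ⟨U, fun _ => ⟨hU, ?_, fun h _ => h1 fun h' => h h'.2⟩⟩
        rw [if_neg hb]
        exact h2
  choose U hU using key
  exact ⟨U, o, hU, fun p hp => (ho p hp).2.2⟩

open Classical in
/-- The loaded vertices with parent `a`. -/
noncomputable def loadedChildren (a : W) : Finset W :=
  Finset.univ.filter fun t => S.Loaded t ∧ S.par t = a

lemma mem_loadedChildren {a t : W} : t ∈ S.loadedChildren a ↔ S.Loaded t ∧ S.par t = a := by
  classical
  rw [loadedChildren, Finset.mem_filter]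
  simp

open Classical in
lemma even_loadedChildren {a : W} (ha : a ∈ S.A) :
    Even ((S.loadedChildren a).card + if a ∈ S.marked then 1 else 0) := by
  have h1 := S.even_marked a
  have h2 : S.compDegree a = 0 := by
    rw [compDegree, Finset.sum_eq_zero]
    intro b _
    rw [if_pos ha]
  have h3 : (S.marked.filter fun c => a < c ∧ S.pointer c = a) = S.loadedChildren a := by
    ext c
    rw [Finset.mem_filter, S.mem_loadedChildren]
    constructor
    · rintro ⟨hc, hlt, hp⟩
      rw [pointer] at hp
      split_ifs at hp with h1 h2
      · exact absurd (hp ▸ ha) (S.top_notMem (S.par_notMem h1))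
      · exact ⟨⟨h1, h2.1, h2.2, hc⟩, hp⟩
      · exact absurd hp hlt.ne'
    · rintro ⟨hl, rfl⟩
      refine ⟨hl.2.2.2, S.par_lt hl.2.2.1, ?_⟩
      rw [pointer, if_neg hl.1, if_pos ⟨hl.2.1, hl.2.2.1⟩]
  rw [h2, h3, add_zero, add_comm] at h1
  exact h1

open Classical in
-- Of the evenly many marked links at `a`, exactly half are to be doubled. `δ` tells whether the
-- link to the parent already is, and `L` completes the half.
lemma exists_half_loadedChildren (a : W) (δ : Prop) :
    ∃ L : Finset W, a ∈ S.A → (δ → a ∈ S.marked) → L ⊆ S.loadedChildren a ∧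
      2 * L.card + 2 * (if δ then 1 else 0) =
        (S.loadedChildren a).card + if a ∈ S.marked then 1 else 0 := by
  by_cases ha : a ∈ S.A
  · obtain ⟨m, hm⟩ := S.even_loadedChildren ha
    by_cases hδ : δ → a ∈ S.marked
    · have hle : m - (if δ then 1 else 0) ≤ (S.loadedChildren a).card := by
        split_ifs at * <;> omega
      obtain ⟨L, hL, hLc⟩ := Finset.exists_subset_card_eq hle
      refine ⟨L, fun _ _ => ⟨hL, ?_⟩⟩
      rw [hLc, hm]
      by_cases h : δ
      · rw [if_pos (hδ h)] at hm
        rw [if_pos h]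
        omega
      · rw [if_neg h]
        omega
    · exact ⟨∅, fun _ h => absurd h hδ⟩
  · exact ⟨∅, fun h => absurd h ha⟩

open Classical in
lemma exists_levels (U : Prop → W → Finset W) (hU : ∀ l, ∀ b ∉ S.A, U l b ⊆ S.children b) :
    ∃ lev : W → Prop, ∀ a ∈ S.A, 
      2 * ((S.loadedChildren a).filter lev).card +
        2 * (if a ∈ U (lev (S.top (S.par a))) (S.par a) then 1 else 0) =
        (S.loadedChildren a).card + if a ∈ S.marked then 1 else 0 := by
  choose L hL using S.exists_half_loadedChildren
  -- Recursion down the tree: the level of a component fixes which children are doubled in it, hence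
  -- `δ` at `S.par t`, hence the level of the components below.
  obtain ⟨lev, hlev⟩ := exists_recursive_pred (fun t => S.top (S.par (S.par t)))
    (fun t y => t ∈ L (S.par t) (S.par t ∈ U y (S.par (S.par t))))
  refine ⟨lev, fun a ha => ?_⟩
  have h1 := hL a (a ∈ U (lev (S.top (S.par a))) (S.par a)) ha (fun h =>
    (S.mem_children.1 (hU _ _ (S.par_notMem ha) h)).2.1)
  have h2 : (S.loadedChildren a).filter lev = L a (a ∈ U (lev (S.top (S.par a))) (S.par a)) := by
    ext t
    rw [Finset.mem_filter]
    have h3 : t ∈ S.loadedChildren a →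
        (lev t ↔ t ∈ L a (a ∈ U (lev (S.top (S.par a))) (S.par a))) := by
      intro ht
      obtain ⟨h4, rfl⟩ := S.mem_loadedChildren.1 ht
      exact hlev t (((S.top_le_self _).trans_lt (S.par_lt (S.ne_root h4.par_mem))).trans
        (S.par_lt h4.2.2.1))
    constructor
    · rintro ⟨h4, h5⟩; exact (h3 h4).1 h5
    · intro h4; exact ⟨h1.1 h4, (h3 (h1.1 h4)).2 h4⟩
  rw [h2]
  convert h1.2 using 4

end Frame

/-! ### Delivering every vertex of `A` as often as its degree. -/

namespace Frame

variable {W : Type*} [Fintype W] [LinearOrder W] {H : SimpleGraph W} (S : Frame H)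

lemma count_package (l : Prop) (U : Finset W) (b a : W) :
    open Classical in
    (S.package l U b).count a = (if a ∈ S.plain b then 1 else 0) + 2 * (if a ∈ U then 1 else 0) +
      2 * (if l ∧ S.Loaded b ∧ S.par b = a then 1 else 0) := by
  classical
  have hval : ∀ s : Finset W, s.val.count a = if a ∈ s then 1 else 0 := by
    intro s
    rw [Multiset.count_eq_of_nodup s.nodup]
    rfl
  rw [package, delivered, Multiset.count_add, Multiset.count_add, Multiset.count_nsmul, hval, hval]
  congr 1
  by_cases h : l ∧ S.Loaded b
  · rw [if_pos h]
    simp only [Multiset.insert_eq_cons, ← Multiset.cons_zero, Multiset.count_cons,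
      Multiset.count_zero, eq_comm (a := a)]
    by_cases h2 : S.par b = a
    · simp [h, h2]
    · simp [h2]
  · rw [if_neg h, if_neg (fun h' => h ⟨h'.1, h'.2.1⟩), Multiset.count_zero]

open Classical in
-- Unmarked links deliver `a` once; marked ones deliver it twice or never, and by `h` the doubled
-- half makes up for the other half.
lemma sum_count_package (U : W → Finset W) (lev : W → Prop)
    (hU : ∀ b ∉ S.A, U b ⊆ S.children b) {a : W} (ha : a ∈ S.A)
    (h : 2 * ((S.loadedChildren a).filter lev).card + 2 * (if a ∈ U (S.par a) then 1 else 0) =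
        (S.loadedChildren a).card + if a ∈ S.marked then 1 else 0) :
    ∑ b ∈ Finset.univ.filter (· ∉ S.A), (S.package (lev (S.top b)) (U b) b).count a =
      (Finset.univ.filter fun y => H.Adj a y).card := by
  have hpar : S.par a ∈ Finset.univ.filter (· ∉ S.A) := by simp [S.par_notMem ha]
  have e1 : ∑ b ∈ Finset.univ.filter (· ∉ S.A), (if a ∈ U b then 1 else 0) =
      if a ∈ U (S.par a) then 1 else 0 := by
    refine Finset.sum_eq_single (S.par a) ?_ (fun h => absurd hpar h)
    intro b hb hne
    rw [if_neg]
    intro h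
    exact hne (S.mem_children.1 (hU b (Finset.mem_filter.1 hb).2 h)).2.2.symm
  have e2 : ∑ b ∈ Finset.univ.filter (· ∉ S.A), (if lev (S.top b) ∧ S.Loaded b ∧ S.par b = a
      then 1 else 0) = ((S.loadedChildren a).filter lev).card := by
    rw [← Finset.card_filter]
    congr 1
    ext b
    simp only [Finset.mem_filter, Finset.mem_univ, true_and, S.mem_loadedChildren]
    constructor
    · rintro ⟨-, h1, h2, h3⟩
      rw [h2.2.1] at h1
      exact ⟨⟨h2, h3⟩, h1⟩
    · rintro ⟨⟨h2, h3⟩, h1⟩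
      exact ⟨h2.1, by rwa [h2.2.1], h2, h3⟩
  have e3 : (Finset.univ.filter fun y => H.Adj a y).card =
      ∑ b ∈ Finset.univ.filter (· ∉ S.A), (if a ∈ S.plain b then 1 else 0) +
      (if a ∈ S.marked then 1 else 0) + (S.loadedChildren a).card := by
    have e4 : ∑ b ∈ Finset.univ.filter (· ∉ S.A), (if a ∈ S.children b then 1 else 0) =
        if a ∈ S.marked then 1 else 0 := by
      have : ∑ b ∈ Finset.univ.filter (· ∉ S.A), (if a ∈ S.children b then 1 else 0) =
          if a ∈ S.children (S.par a) then 1 else 0 := by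
        refine Finset.sum_eq_single (S.par a) ?_ (fun h => absurd hpar h)
        intro b hb hne
        rw [if_neg]
        intro h
        exact hne (S.mem_children.1 h).2.2.symm
      rw [this]
      simp [S.mem_children, ha]
    have e5 : ∑ b ∈ Finset.univ.filter (· ∉ S.A), (if S.Loaded b ∧ S.par b = a then 1 else 0) =
        (S.loadedChildren a).card := by
      rw [← Finset.card_filter]
      congr 1
      ext b
      simp only [Finset.mem_filter, Finset.mem_univ, true_and, S.mem_loadedChildren]
      exact ⟨fun h => h.2, fun h => ⟨h.1.1, h⟩⟩
    rw [← e4, ← e5, ← Finset.sum_add_distrib, ← Finset.sum_add_distrib]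
    have e6 : (Finset.univ.filter fun y => H.Adj a y) =
        (Finset.univ.filter (· ∉ S.A)).filter fun b => a ∈ S.nbrs b := by
      ext y
      simp only [Finset.mem_filter, Finset.mem_univ, true_and, S.mem_nbrs]
      exact ⟨fun h => ⟨fun hy => S.indep a ha y hy h, ha, h.symm⟩, fun h => h.2.2.symm⟩
    rw [e6, Finset.card_filter]
    refine Finset.sum_congr rfl fun b _ => ?_
    by_cases h1 : a ∈ S.plain b
    · have h2 : a ∉ S.children b := Finset.disjoint_left.1 (S.disjoint_plain_children b) h1
      have h3 : ¬ (S.Loaded b ∧ S.par b = a) := fun h =>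
        (S.mem_plain.1 h1).2 ⟨h.1, h.2.symm⟩
      rw [if_pos (S.plain_subset b h1), if_pos h1, if_neg h2, if_neg h3]
    · by_cases h2 : a ∈ S.children b
      · have h3 : ¬ (S.Loaded b ∧ S.par b = a) := by
          rintro ⟨h3, rfl⟩
          exact h3.par_notMem_children S h2
        rw [if_pos (S.children_subset b h2), if_neg h1, if_pos h2, if_neg h3]
      · by_cases h3 : S.Loaded b ∧ S.par b = a
        · rw [if_pos (S.mem_nbrs_iff.2 (Or.inr (Or.inr ⟨h3.1, h3.2.symm⟩))), if_neg h1, if_neg h2,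
            if_pos h3]
        · rw [if_neg h1, if_neg h2, if_neg h3, if_neg]
          rw [S.mem_nbrs_iff]
          rintro (h | h | h)
          · exact h1 h
          · exact h2 h
          · exact h3 ⟨h.1, h.2.symm⟩
  rw [Finset.sum_congr rfl fun b _ => S.count_package _ _ b a, Finset.sum_add_distrib,
    Finset.sum_add_distrib, ← Finset.mul_sum, ← Finset.mul_sum, e1, e2, e3]
  omega

open Classical in
/-- Every outer vertex gets a multiset of tokens; the tokens split into local pairs, the ones passed
on along the paths of a pairing of the odd set, and the surplus. -/
structure Delivery where
  N : Multiset (W × W)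
  M : W → Multiset W
  o : W → W
  reach : ∀ p ∈ N, S.outer.Reachable p.1 p.2
  ends_eq : ends N = S.oddSet.val
  disjoint : ∀ p q N', N = p ::ₘ q ::ₘ N' → ∀ (w₁ : S.outer.Walk p.1 p.2)
    (w₂ : S.outer.Walk q.1 q.2), w₁.length = S.outer.dist p.1 p.2 →
      w₂.length = S.outer.dist q.1 q.2 → ∀ e ∈ w₁.edges, e ∉ w₂.edges
  good : ∀ p ∈ N, o p.1 ≠ o p.2 ∨ Odd (S.outer.dist p.1 p.2)
  splits : ∀ b ∉ S.A, Splits (M b) (if b ∈ S.oddSet then some (o b) else none) (S.surplus b)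
  mem_nbrs : ∀ b ∉ S.A, ∀ a ∈ M b, a ∈ S.nbrs b
  count_le : ∀ b ∉ S.A, ∀ a, (M b).count a ≤ 2
  exit : ∀ b ∉ S.A, S.top b ≠ b → ∃ a ∈ S.nbrs b, (M b).count a ≤ 1
  count_root : S.r ∉ S.oddSet → ∀ a, (M S.r).count a ≤ 1
  sum_count : ∀ a ∈ S.A, ∑ b ∈ Finset.univ.filter (· ∉ S.A), (M b).count a =
    (Finset.univ.filter fun y => H.Adj a y).card

lemma nonempty_delivery : Nonempty S.Delivery := by
  classical
  obtain ⟨N, hN1, hN2, hN3⟩ := exists_disjoint_pairing S.outer S.oddSet S.even_card_oddSet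
  choose U o hUo using fun l : Prop => S.exists_isChoice N hN2 hN1 l
  obtain ⟨lev, hlev⟩ := S.exists_levels U (fun l b hb => ((hUo l).1 b hb).1)
  have hsub : ∀ b ∉ S.A, U (lev (S.top b)) b ⊆ S.children b := fun b hb => ((hUo _).1 b hb).1
  have hcount : ∀ b ∉ S.A, ∀ a, (a ∈ S.plain b → a ∉ U (lev (S.top b)) b) ∧
      (S.Loaded b → S.par b = a → a ∉ U (lev (S.top b)) b ∧ a ∉ S.plain b) := by
    intro b hb a
    refine ⟨fun h h' => Finset.disjoint_left.1 (S.disjoint_plain_children b) h (hsub b hb h'), ?_⟩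
    rintro h rfl
    exact ⟨fun h' => h.par_notMem_children S (hsub b hb h'), h.par_notMem_plain S⟩
  refine ⟨⟨N, fun b => S.package (lev (S.top b)) (U (lev (S.top b)) b) b,
    fun b => o (lev (S.top b)) b, fun p hp => (hN1 p hp).2, hN2, hN3, ?_, ?_, ?_, ?_, ?_, ?_, ?_⟩⟩
  · intro p hp
    have h1 := S.top_eq (hN1 p hp).2
    have h2 := (hUo (lev (S.top p.1))).2 p hp
    rw [← h1]
    exact h2
  · intro b hb
    exact ((hUo _).1 b hb).2.1
  · intro b hb a ha
    have h1 := Multiset.count_pos.2 ha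
    rw [S.count_package] at h1
    rw [S.mem_nbrs_iff]
    by_cases h2 : a ∈ S.plain b
    · exact Or.inl h2
    by_cases h3 : a ∈ U (lev (S.top b)) b
    · exact Or.inr (Or.inl (hsub b hb h3))
    by_cases h4 : lev (S.top b) ∧ S.Loaded b ∧ S.par b = a
    · exact Or.inr (Or.inr ⟨h4.2.1, h4.2.2.symm⟩)
    · rw [if_neg h2, if_neg h3, if_neg h4] at h1
      exact absurd h1 (lt_irrefl _)
  · intro b hb a
    rw [S.count_package]
    have h1 := hcount b hb a
    by_cases h4 : lev (S.top b) ∧ S.Loaded b ∧ S.par b = a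
    · rw [if_neg (h1.2 h4.2.1 h4.2.2).1, if_neg (h1.2 h4.2.1 h4.2.2).2, if_pos h4]
    · by_cases h2 : a ∈ S.plain b
      · rw [if_pos h2, if_neg (h1.1 h2), if_neg h4]
        omega
      · rw [if_neg h2, if_neg h4]
        split_ifs <;> omega
  · intro b hb htop
    have hl : ¬ S.Loaded b := fun h => htop h.2.1
    by_cases hP : (S.plain b).Nonempty
    · obtain ⟨a, ha⟩ := hP
      refine ⟨a, S.plain_subset b ha, ?_⟩
      rw [S.count_package, if_pos ha, if_neg ((hcount b hb a).1 ha), if_neg fun h => hl h.2.1]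
    -- Without plain neighbours, `b` is neither odd nor loaded, so it receives no tokens and every
    -- neighbour in `A` can serve as exit.
    · rw [Finset.not_nonempty_iff_eq_empty] at hP
      obtain ⟨a, ha⟩ := S.nbrs_nonempty hb
      refine ⟨a, ha, ?_⟩
      have hr : b ≠ S.r := fun h => htop (h ▸ S.top_root)
      have hodd : b ∉ S.oddSet := by
        rw [S.mem_oddSet, hP, surplus, if_neg fun h => hr h.1]
        simp
      rw [S.count_package, ((hUo _).1 b hb).2.2 hl hodd, hP]
      simp [hl]
  · intro hr a
    have hl : ¬ S.Loaded S.r := fun h => h.2.2.1 rfl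
    rw [S.count_package, ((hUo _).1 _ S.root_notMem).2.2 hl hr]
    simp only [Finset.notMem_empty, if_false, hl, false_and, and_false]
    split_ifs <;> simp
  · intro a ha
    refine S.sum_count_package (fun b => U (lev (S.top b)) b) lev hsub ha ?_
    exact hlev a ha

end Frame

lemma exists_fin_map {α : Type*} (R : Multiset α) :
    ∃ (n : ℕ) (f : Fin n → α), n = R.card ∧ R = Finset.univ.val.map f := by
  induction R using Quotient.inductionOn with
  | _ l => exact ⟨l.length, l.get, rfl, by simp [Fin.univ_val_map]⟩

lemma card_filter_eq_countP {α ι : Type*} [Fintype ι] (f : ι → α) (p : α → Prop)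
    [DecidablePred p] :
    (Finset.univ.filter fun i => p (f i)).card = (Finset.univ.val.map f).countP p := by
  rw [Multiset.countP_map]
  rfl

lemma exists_cons_cons_of_two_le_countP {α : Type*} {p : α → Prop} [DecidablePred p]
    {N : Multiset α} (h : 2 ≤ N.countP p) :
    ∃ a b N', N = a ::ₘ b ::ₘ N' ∧ p a ∧ p b := by
  obtain ⟨a, ha, hpa⟩ := Multiset.countP_pos.1 (by omega : 0 < N.countP p)
  obtain ⟨N₁, rfl⟩ := Multiset.exists_cons_of_mem ha
  rw [Multiset.countP_cons, if_pos hpa] at h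
  obtain ⟨b, hb, hpb⟩ := Multiset.countP_pos.1 (by omega : 0 < N₁.countP p)
  obtain ⟨N₂, rfl⟩ := Multiset.exists_cons_of_mem hb
  exact ⟨a, b, N₂, rfl, hpa, hpb⟩

lemma countP_le_count_ends {W : Type*} [DecidableEq W] (N : Multiset (W × W)) (x : W)
    (p : W × W → Prop) [DecidablePred p] (h : ∀ q ∈ N, p q → q.1 = x ∨ q.2 = x) :
    N.countP p ≤ (ends N).count x := by
  induction N using Multiset.induction_on with
  | empty => simp
  | cons q N ih =>
    have h1 := ih fun q' hq' => h q' (Multiset.mem_cons_of_mem hq')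
    have h2 := h q (Multiset.mem_cons_self q N)
    rw [ends_cons, Multiset.count_cons, Multiset.count_cons, Multiset.countP_cons]
    by_cases hq : p q
    · rw [if_pos hq]
      rcases h2 hq with h3 | h3
      · rw [if_pos h3.symm]; split_ifs <;> omega
      · rw [if_pos h3.symm]; split_ifs <;> omega
    · rw [if_neg hq]; split_ifs <;> omega

/-! ### Turning a delivery into trails. -/

namespace Frame

variable {W : Type*} [Fintype W] [LinearOrder W] {H : SimpleGraph W} (S : Frame H)

lemma nonempty_trail (S : Frame H) : Nonempty (Trail H) := by
  obtain ⟨a, -, h⟩ := S.dom S.r S.root_notMem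
  exact ⟨⟨S.r, a, .cons h .nil, Or.inl h.ne⟩⟩

variable {S} (D : S.Delivery)

/-- Two-edge trails at an outer vertex realizing pairs of tokens. -/
lemma exists_local_trail (S : Frame H) (b : W) : ∃ g : W × W → Trail H, ∀ p : W × W, p.1 ≠ p.2 → H.Adj b p.1 →
    H.Adj b p.2 → (g p).fst = p.1 ∧ (g p).snd = p.2 ∧
      ∀ e ∈ (g p).walk.edges, e = s(p.1, b) ∨ e = s(p.2, b) := by
  have : ∀ p : W × W, ∃ t : Trail H, p.1 ≠ p.2 → H.Adj b p.1 →
    H.Adj b p.2 → t.fst = p.1 ∧ t.snd = p.2 ∧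
      ∀ e ∈ t.walk.edges, e = s(p.1, b) ∨ e = s(p.2, b) := by
    intro p
    by_cases h : p.1 ≠ p.2 ∧ H.Adj b p.1 ∧ H.Adj b p.2
    · refine ⟨⟨p.1, p.2, .cons h.2.1.symm (.cons h.2.2 .nil), Or.inl h.1⟩, fun _ _ _ =>
        ⟨rfl, rfl, ?_⟩⟩
      intro e he
      simp only [SimpleGraph.Walk.edges_cons, SimpleGraph.Walk.edges_nil, List.mem_cons,
        List.not_mem_nil, or_false] at he
      rw [Sym2.eq_swap (a := p.2)]
      exact he
    · exact ⟨(S.nonempty_trail).some, fun h1 h2 h3 => absurd ⟨h1, h2, h3⟩ h⟩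
  choose g hg using this
  exact ⟨g, hg⟩

lemma Delivery.passed_mem {b : W} (hb : b ∈ S.oddSet) : D.o b ∈ S.nbrs b := by
  classical
  have hbA := (S.mem_oddSet.1 hb).1
  obtain ⟨N, T, -, -, h⟩ := D.splits b hbA
  refine D.mem_nbrs b hbA _ ?_
  rw [h, if_pos hb]
  simp

lemma Delivery.mem_oddSet_of_mem {p : W × W} (hp : p ∈ D.N) :
    p.1 ∈ S.oddSet ∧ p.2 ∈ S.oddSet := by
  rw [← Finset.mem_val, ← Finset.mem_val, ← D.ends_eq]
  exact ⟨Multiset.mem_add.2 (Or.inl (Multiset.mem_map_of_mem _ hp)),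
    Multiset.mem_add.2 (Or.inr (Multiset.mem_map_of_mem _ hp))⟩

/-- Trails along shortest outer paths between two paired vertices, extended by the vertices they
pass on. -/
lemma Delivery.exists_path_trail : ∃ g : W × W → Trail H, ∀ p ∈ D.N,
    (g p).fst = D.o p.1 ∧ (g p).snd = D.o p.2 ∧ ∃ w : S.outer.Walk p.1 p.2,
      w.length = S.outer.dist p.1 p.2 ∧
      ∀ e ∈ (g p).walk.edges, e = s(D.o p.1, p.1) ∨ e = s(D.o p.2, p.2) ∨ e ∈ w.edges := by
  have : ∀ p : W × W, ∃ t : Trail H, p ∈ D.N →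
    t.fst = D.o p.1 ∧ t.snd = D.o p.2 ∧ ∃ w : S.outer.Walk p.1 p.2,
      w.length = S.outer.dist p.1 p.2 ∧
      ∀ e ∈ t.walk.edges, e = s(D.o p.1, p.1) ∨ e = s(D.o p.2, p.2) ∨ e ∈ w.edges := by
    intro p
    by_cases hp : p ∈ D.N
    · obtain ⟨w, hw⟩ := (D.reach p hp).exists_walk_length_eq_dist
      have h1 := S.mem_nbrs.1 (D.passed_mem (D.mem_oddSet_of_mem hp).1)
      have h2 := S.mem_nbrs.1 (D.passed_mem (D.mem_oddSet_of_mem hp).2)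
      refine ⟨⟨D.o p.1, D.o p.2, .cons h1.2.symm ((w.mapLe S.outer_le).append (.cons h2.2 .nil)),
        (D.good p hp).imp_right fun h => ?_⟩, fun _ => ⟨rfl, rfl, w, hw, ?_⟩⟩
      · simp only [SimpleGraph.Walk.length_cons, SimpleGraph.Walk.length_append,
          SimpleGraph.Walk.length_nil, SimpleGraph.Walk.length_map, SimpleGraph.Walk.mapLe, hw]
        exact h.add_even even_two
      · intro e he
        simp only [SimpleGraph.Walk.edges_cons, SimpleGraph.Walk.edges_nil, List.mem_cons,
          List.not_mem_nil, or_false, SimpleGraph.Walk.edges_append, List.mem_append,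
          SimpleGraph.Walk.edges_mapLe_eq_edges] at he
        rw [Sym2.eq_swap (a := D.o p.2)]
        tauto
    · exact ⟨(S.nonempty_trail).some, fun h => absurd h hp⟩
  choose g hg using this
  exact ⟨g, hg⟩

end Frame

lemma countP_sum_map {α β ι : Type*} (s : Finset ι) (N : ι → Multiset α) (g : ι → α → β)
    (p : β → Prop) [DecidablePred p] :
    (∑ b ∈ s, (N b).map (g b)).countP p = ∑ b ∈ s, (N b).countP fun a => p (g b a) := by
  rw [← Multiset.coe_countPAddMonoidHom, map_sum]
  refine Finset.sum_congr rfl fun b _ => ?_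
  rw [Multiset.coe_countPAddMonoidHom, Multiset.countP_map, Multiset.countP_eq_card_filter]

lemma countP_map' {α β : Type*} (N : Multiset α) (g : α → β) (p : β → Prop) [DecidablePred p] :
    (N.map g).countP p = N.countP fun a => p (g a) := by
  rw [Multiset.countP_map, Multiset.countP_eq_card_filter]

lemma countP_ends {W : Type*} (N : Multiset (W × W)) (p : W → Prop) [DecidablePred p] :
    (ends N).countP p = (N.countP fun q => p q.1) + N.countP fun q => p q.2 := by
  rw [ends, Multiset.countP_add, countP_map', countP_map']

namespace Frame

variable {W : Type*} [Fintype W] [LinearOrder W] {H : SimpleGraph W} {S : Frame H}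

open Classical in
-- Local pairs give walks of length two, and pairs of odd vertices give shortest outer paths
-- lengthened at both ends. An edge from `b` to `a` is charged to a token `a` at `b`; an edge
-- between outer vertices lies on at most one trail because the paths are disjoint. `T` is the
-- surplus at the root.
lemma Delivery.exists_trails (D : S.Delivery) : ∃ (R : Multiset (Trail H)) (T : Multiset W),
    T.card = S.surplus S.r ∧ (∀ a ∈ T, a ∈ S.nbrs S.r) ∧
    (∀ x, R.countP (fun t => t.fst = x) + R.countP (fun t => t.snd = x) + T.count x =
      if x ∈ S.A then (Finset.univ.filter fun y => H.Adj x y).card else 0) ∧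
    (∀ a ∈ S.A, ∀ b ∉ S.A, R.countP (fun t => s(a, b) ∈ t.walk.edges) +
      (if b = S.r then T.count a else 0) ≤ (D.M b).count a) ∧
    ∀ b ∉ S.A, ∀ b' ∉ S.A, R.countP (fun t => s(b, b') ∈ t.walk.edges) ≤ 1 := by
  choose gl hgl using S.exists_local_trail
  obtain ⟨gp, hgp⟩ := D.exists_path_trail
  have hsp : ∀ b, ∃ (N : Multiset (W × W)) (T : Multiset W), b ∉ S.A →
      (∀ p ∈ N, p.1 ≠ p.2) ∧ T.card = S.surplus b ∧
      D.M b = ends N + T + (if b ∈ S.oddSet then some (D.o b) else none).toFinset.val := by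
    intro b
    by_cases hb : b ∈ S.A
    · exact ⟨0, 0, fun h => absurd hb h⟩
    · obtain ⟨N, T, h⟩ := D.splits b hb
      exact ⟨N, T, fun _ => h⟩
  choose NP T hNP using hsp
  set B := Finset.univ.filter (· ∉ S.A) with hB
  have hBmem : ∀ b, b ∈ B ↔ b ∉ S.A := fun b => by simp [hB]
  have hcount : ∀ b ∉ S.A, ∀ x, (D.M b).count x = (ends (NP b)).count x + (T b).count x +
      if b ∈ S.oddSet ∧ D.o b = x then 1 else 0 := by
    intro b hb x
    conv_lhs => rw [(hNP b hb).2.2]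
    rw [Multiset.count_add, Multiset.count_add]
    congr 1
    by_cases h : b ∈ S.oddSet
    · rw [if_pos h, Option.toFinset_some, Finset.singleton_val, Multiset.count_singleton]
      simp [h, eq_comm]
    · simp [h]
  have hmemNP : ∀ b ∉ S.A, ∀ q ∈ NP b, q.1 ∈ S.nbrs b ∧ q.2 ∈ S.nbrs b := by
    intro b hb q hq
    have h1 : ∀ x ∈ ends (NP b), x ∈ S.nbrs b := by
      intro x hx
      refine D.mem_nbrs b hb x ?_
      rw [(hNP b hb).2.2]
      exact Multiset.mem_add.2 (Or.inl (Multiset.mem_add.2 (Or.inl hx)))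
    exact ⟨h1 _ (Multiset.mem_add.2 (Or.inl (Multiset.mem_map_of_mem _ hq))),
      h1 _ (Multiset.mem_add.2 (Or.inr (Multiset.mem_map_of_mem _ hq)))⟩
  have hglspec : ∀ b ∉ S.A, ∀ q ∈ NP b, (gl b q).fst = q.1 ∧ (gl b q).snd = q.2 ∧
      ∀ e ∈ (gl b q).walk.edges, e = s(q.1, b) ∨ e = s(q.2, b) := by
    intro b hb q hq
    have h1 := hmemNP b hb q hq
    exact hgl b q ((hNP b hb).1 q hq) (S.mem_nbrs.1 h1.1).2 (S.mem_nbrs.1 h1.2).2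
  have hT0 : ∀ b ∉ S.A, b ≠ S.r → T b = 0 := by
    intro b hb hr
    rw [← Multiset.card_eq_zero, (hNP b hb).2.1, surplus, if_neg fun h => hr h.1]
  have hcountP : ∀ (p : Trail H → Prop) [DecidablePred p], ((∑ b ∈ B, (NP b).map (gl b)) + D.N.map gp).countP p =
      ∑ b ∈ B, ((NP b).countP fun q => p (gl b q)) + D.N.countP fun q => p (gp q) := by
    intro p _
    rw [Multiset.countP_add, countP_sum_map, countP_map']
  refine ⟨(∑ b ∈ B, (NP b).map (gl b)) + D.N.map gp, T S.r,
    (hNP _ S.root_notMem).2.1, ?_, ?_, ?_, ?_⟩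
  · intro a ha
    refine D.mem_nbrs _ S.root_notMem a ?_
    rw [(hNP _ S.root_notMem).2.2]
    exact Multiset.mem_add.2 (Or.inl (Multiset.mem_add.2 (Or.inr ha)))
  · intro x
    have h1 : ((∑ b ∈ B, ((NP b).countP fun q => (gl b q).fst = x)) +
        ∑ b ∈ B, ((NP b).countP fun q => (gl b q).snd = x)) = ∑ b ∈ B, (ends (NP b)).count x := by
      rw [← Finset.sum_add_distrib]
      refine Finset.sum_congr rfl fun b hb => ?_
      have hb' := (hBmem b).1 hb
      rw [Multiset.count, countP_ends]
      congr 1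
      · exact Multiset.countP_congr rfl fun q hq => by rw [(hglspec b hb' q hq).1]; exact propext eq_comm
      · exact Multiset.countP_congr rfl fun q hq => by rw [(hglspec b hb' q hq).2.1]; exact propext eq_comm
    have h2 : (D.N.countP fun q => (gp q).fst = x) + (D.N.countP fun q => (gp q).snd = x) =
        ∑ b ∈ B, if b ∈ S.oddSet ∧ D.o b = x then 1 else 0 := by
      have h3 : (D.N.countP fun q => (gp q).fst = x) + (D.N.countP fun q => (gp q).snd = x) =
          (ends D.N).countP fun b => D.o b = x := by
        rw [countP_ends]
        congr 1
        · exact Multiset.countP_congr rfl fun q hq => by rw [(hgp q hq).1]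
        · exact Multiset.countP_congr rfl fun q hq => by rw [(hgp q hq).2.1]
      rw [h3, D.ends_eq, ← Finset.card_filter, Multiset.countP_eq_card_filter]
      change (S.oddSet.filter fun b => D.o b = x).card = _
      congr 1
      ext b
      rw [Finset.mem_filter, Finset.mem_filter, hBmem]
      exact ⟨fun h => ⟨(S.mem_oddSet.1 h.1).1, h⟩, fun h => h.2⟩
    have h4 : ∑ b ∈ B, (T b).count x = (T S.r).count x := by
      refine Finset.sum_eq_single S.r ?_ fun h => absurd ((hBmem _).2 S.root_notMem) h
      intro b hb hr
      rw [hT0 b ((hBmem b).1 hb) hr, Multiset.count_zero]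
    have h5 : ∑ b ∈ B, (D.M b).count x = ∑ b ∈ B, (ends (NP b)).count x + (T S.r).count x +
        ∑ b ∈ B, if b ∈ S.oddSet ∧ D.o b = x then 1 else 0 := by
      rw [← h4, ← Finset.sum_add_distrib, ← Finset.sum_add_distrib]
      exact Finset.sum_congr rfl fun b hb => hcount b ((hBmem b).1 hb) x
    rw [hcountP, hcountP]
    have h6 : ∑ b ∈ B, (D.M b).count x =
        if x ∈ S.A then (Finset.univ.filter fun y => H.Adj x y).card else 0 := by
      split_ifs with hx
      · convert D.sum_count x hx
      · refine Finset.sum_eq_zero fun b hb => ?_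
        rw [Multiset.count_eq_zero]
        exact fun h => hx (S.mem_nbrs.1 (D.mem_nbrs b ((hBmem b).1 hb) x h)).1
    rw [← h6, h5, ← h1, ← h2]
    ring
  · intro a ha b hb
    rw [hcountP, hcount b hb a]
    have h1 : (∑ b' ∈ B, (NP b').countP fun q => s(a, b) ∈ (gl b' q).walk.edges) ≤
        (ends (NP b)).count a := by
      rw [Finset.sum_eq_single b]
      · refine countP_le_count_ends _ _ _ fun q hq he => ?_
        have h2 := (hglspec b hb q hq).2.2 _ he
        rw [Sym2.congr_left, Sym2.congr_left] at h2
        exact h2.imp Eq.symm Eq.symm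
      · intro b' hb' hne
        have hb'' := (hBmem b').1 hb'
        rw [Multiset.countP_eq_zero]
        intro q hq he
        have h3 := hmemNP b' hb'' q hq
        have h4 : ∀ x ∈ S.nbrs b', s(a, b) ≠ s(x, b') := by
          intro x hx heq
          obtain ⟨-, h5⟩ | ⟨h5, -⟩ := Sym2.eq_iff.1 heq
          · exact hne h5.symm
          · exact hb'' (h5 ▸ ha)
        rcases (hglspec b' hb'' q hq).2.2 _ he with h2 | h2
        · exact h4 _ h3.1 h2
        · exact h4 _ h3.2 h2
      · exact fun h => absurd ((hBmem b).2 hb) h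
    have h2 : (D.N.countP fun q => s(a, b) ∈ (gp q).walk.edges) ≤
        if b ∈ S.oddSet ∧ D.o b = a then 1 else 0 := by
      have hkey : ∀ q ∈ D.N, s(a, b) ∈ (gp q).walk.edges →
          D.o b = a ∧ (q.1 = b ∨ q.2 = b) := by
        intro q hq he
        obtain ⟨-, -, w, -, hw⟩ := hgp q hq
        have hq1 := (S.mem_oddSet.1 (D.mem_oddSet_of_mem hq).1).1
        have hq2 := (S.mem_oddSet.1 (D.mem_oddSet_of_mem hq).2).1
        rcases hw _ he with h | h | h
        · obtain ⟨h5, h6⟩ | ⟨h5, -⟩ := Sym2.eq_iff.1 h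
          · exact ⟨by rw [h6, h5], Or.inl h6.symm⟩
          · exact absurd (h5 ▸ ha) hq1
        · obtain ⟨h5, h6⟩ | ⟨h5, -⟩ := Sym2.eq_iff.1 h
          · exact ⟨by rw [h6, h5], Or.inr h6.symm⟩
          · exact absurd (h5 ▸ ha) hq2
        · have h5 := w.edges_subset_edgeSet h
          rw [SimpleGraph.mem_edgeSet] at h5
          exact absurd ha h5.2.1
      by_cases ho : D.o b = a
      · refine (countP_le_count_ends _ b _ fun q hq he => (hkey q hq he).2).trans ?_
        rw [D.ends_eq, Multiset.count_eq_of_nodup S.oddSet.nodup]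
        by_cases hbo : b ∈ S.oddSet
        · rw [if_pos (⟨hbo, ho⟩ : b ∈ S.oddSet ∧ D.o b = a)]
          split_ifs <;> simp
        · rw [if_neg (by exact hbo)]
          exact Nat.zero_le _
      · rw [Multiset.countP_eq_zero.2 fun q hq he => ho (hkey q hq he).1]
        exact Nat.zero_le _
    have h3 : (if b = S.r then (T S.r).count a else 0) ≤ (T b).count a := by
      split_ifs with h
      · rw [h]
      · exact Nat.zero_le _
    omega
  · intro b hb b' hb'
    rw [hcountP, Finset.sum_eq_zero, zero_add]
    · by_contra hlt
      obtain ⟨p, q, N', hN, hp, hq⟩ := exists_cons_cons_of_two_le_countP (not_le.1 hlt)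
      have hpN : p ∈ D.N := by rw [hN]; simp
      have hqN : q ∈ D.N := by rw [hN]; simp
      obtain ⟨-, -, w, hw, hwe⟩ := hgp p hpN
      obtain ⟨-, -, w', hw', hwe'⟩ := hgp q hqN
      have h4 : ∀ c ∈ S.oddSet, s(b, b') ≠ s(D.o c, c) := by
        intro c hc heq
        have h5 := (S.mem_nbrs.1 (D.passed_mem hc)).1
        have h6 : D.o c ∈ s(b, b') := heq ▸ Sym2.mem_mk_left _ _
        rcases Sym2.mem_iff.1 h6 with h7 | h7
        · exact hb (h7 ▸ h5)
        · exact hb' (h7 ▸ h5)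
      have hpO := D.mem_oddSet_of_mem hpN
      have hqO := D.mem_oddSet_of_mem hqN
      refine D.disjoint p q N' hN w w' hw hw' s(b, b') ?_ ?_
      · rcases hwe _ hp with h | h | h
        · exact absurd h (h4 _ hpO.1)
        · exact absurd h (h4 _ hpO.2)
        · exact h
      · rcases hwe' _ hq with h | h | h
        · exact absurd h (h4 _ hqO.1)
        · exact absurd h (h4 _ hqO.2)
        · exact h
    · intro c hc
      rw [Multiset.countP_eq_zero]
      intro q hq he
      have hc' := (hBmem c).1 hc
      have h3 := hmemNP c hc' q hq
      have h4 : ∀ x ∈ S.nbrs c, s(b, b') ≠ s(x, c) := by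
        intro x hx heq
        have h6 : x ∈ s(b, b') := heq ▸ Sym2.mem_mk_left _ _
        have h5 := (S.mem_nbrs.1 hx).1
        rcases Sym2.mem_iff.1 h6 with h7 | h7
        · exact hb (h7 ▸ h5)
        · exact hb' (h7 ▸ h5)
      rcases (hglspec c hc' q hq).2.2 _ he with h2 | h2
      · exact h4 _ h3.1 h2
      · exact h4 _ h3.2 h2

end Frame

/-! ### The surplus token at the root, and the bound for a frame. -/

namespace Frame

variable {W : Type*} [Fintype W] [LinearOrder W] {H : SimpleGraph W} {S : Frame H}

/-- The condition on the root under which a surplus token can be used up. -/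
def RootCondition (S : Frame H) : Prop :=
  (∃ v, v ∉ S.A ∧ H.Adj S.r v ∧ ∀ w < v, w = S.r) ∨
    ((∀ b ∉ S.A, ∀ b' ∉ S.A, ¬ H.Adj b b') ∧ 2 ≤ (S.nbrs S.r).card)

/-- The component of the root is the root alone, so the parity of its component is its own. -/
lemma root_notMem_oddSet (hB : ∀ b ∉ S.A, ∀ b' ∉ S.A, ¬ H.Adj b b') : S.r ∉ S.oddSet := by
  classical
  have h1 := S.even_sum_plain S.r S.root_notMem S.top_root
  have h2 : ∀ b y, S.outer.Reachable b y → b = y := by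
    rintro b y ⟨w⟩
    cases w with
    | nil => rfl
    | cons h _ => exact absurd h.1 (hB _ h.2.1 _ h.2.2)
  have h3 : Finset.univ.filter (fun b => b ∉ S.A ∧ S.top b = S.r) = {S.r} := by
    ext b
    simp only [Finset.mem_filter, Finset.mem_univ, true_and, Finset.mem_singleton]
    constructor
    · rintro ⟨-, h⟩
      rw [h2 b _ (S.reachable_top b), h]
    · rintro rfl
      exact ⟨S.root_notMem, S.top_root⟩
  rw [h3, Finset.sum_singleton] at h1
  rw [S.mem_oddSet]
  rintro ⟨-, h4⟩
  exact Nat.not_even_iff_odd.2 h4 h1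

/-- In the first case the walk is `x, r, c, z` with `z` an exit of `c`; its length is odd, so `z =
x` is allowed. In the second it is `x, r, z` with `z ≠ x`. The conditions on `c` and `z` say that
the edges used have room for one more use. -/
lemma Delivery.exists_surplus_trail (D : S.Delivery) (hroot : S.RootCondition) {x : W}
    (hx : x ∈ S.nbrs S.r) : ∃ (t : Trail H) (z c : W), t.fst = x ∧ t.snd = z ∧ z ∈ S.A ∧
      c ∉ S.A ∧ (D.M c).count z ≤ 1 ∧ (c ≠ S.r → ∀ w < c, w = S.r) ∧
      ∀ e ∈ t.walk.edges, e = s(x, S.r) ∨ e = s(z, c) ∨ (c ≠ S.r ∧ e = s(S.r, c)) := by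
  have hx' := S.mem_nbrs.1 hx
  rcases hroot with ⟨c, hc, hadj, hmin⟩ | ⟨hB, h2⟩
  · have htop : S.top c ≠ c := by
      have h1 : S.outer.Adj c S.r := ⟨hadj.symm, hc, S.root_notMem⟩
      intro h
      have := S.top_le h1.reachable
      rw [h] at this
      exact hadj.ne (le_antisymm (S.root_le c) this)
    obtain ⟨z, hz, hz1⟩ := D.exit c hc htop
    have hz' := S.mem_nbrs.1 hz
    refine ⟨⟨x, z, .cons hx'.2.symm (.cons hadj (.cons hz'.2 .nil)), Or.inr ?_⟩, z, c, rfl, rfl,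
      hz'.1, hc, hz1, fun _ => hmin, ?_⟩
    · exact ⟨1, rfl⟩
    · intro e he
      simp only [SimpleGraph.Walk.edges_cons, SimpleGraph.Walk.edges_nil, List.mem_cons,
        List.not_mem_nil, or_false] at he
      rw [Sym2.eq_swap (a := z)]
      have := hadj.ne'
      tauto
  · obtain ⟨z, hz, hzx⟩ := Finset.exists_mem_ne (by omega : 1 < (S.nbrs S.r).card) x
    have hz' := S.mem_nbrs.1 hz
    refine ⟨⟨x, z, .cons hx'.2.symm (.cons hz'.2 .nil), Or.inl hzx.symm⟩, z, S.r, rfl, rfl,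
      hz'.1, S.root_notMem, D.count_root (root_notMem_oddSet hB) z, fun h => absurd rfl h, ?_⟩
    intro e he
    simp only [SimpleGraph.Walk.edges_cons, SimpleGraph.Walk.edges_nil, List.mem_cons,
      List.not_mem_nil, or_false] at he
    rw [Sym2.eq_swap (a := z)]
    tauto

open Classical in
lemma exists_surplus_trails (D : S.Delivery) (hroot : S.RootCondition) (T : Multiset W)
    (hT : T.card ≤ 1) (hT' : ∀ a ∈ T, a ∈ S.nbrs S.r) : ∃ L : Multiset (Trail H), L.card ≤ 1 ∧
      (∀ t ∈ L, t.snd ∈ S.A) ∧ (∀ x, L.countP (fun t => t.fst = x) = T.count x) ∧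
      (∀ a ∈ S.A, ∀ b ∉ S.A, 0 < L.countP (fun t => s(a, b) ∈ t.walk.edges) →
        (D.M b).count a ≤ 1 ∨ (b = S.r ∧ 0 < T.count a)) ∧
      ∀ b ∉ S.A, ∀ b' ∉ S.A, b < b' → 0 < L.countP (fun t => s(b, b') ∈ t.walk.edges) →
        ∀ w < b', w ≤ b := by
  rcases Multiset.empty_or_exists_mem T with rfl | ⟨x, hx⟩
  · exact ⟨0, by simp, by simp, by simp, by simp, by simp⟩
  · obtain ⟨T', rfl⟩ := Multiset.exists_cons_of_mem hx
    have hT0 : T' = 0 := by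
      rw [Multiset.card_cons] at hT
      exact Multiset.card_eq_zero.1 (by omega)
    subst hT0
    obtain ⟨t, z, c, h1, h2, h3, h4, h5, h6, h7⟩ := D.exists_surplus_trail hroot (hT' x hx)
    refine ⟨{t}, by simp, ?_, ?_, ?_, ?_⟩
    · intro t' ht'
      rw [Multiset.mem_singleton.1 ht', h2]
      exact h3
    · intro y
      rw [← Multiset.cons_zero, Multiset.countP_cons, Multiset.countP_zero, Multiset.count_cons,
        Multiset.count_zero, h1]
      simp only [eq_comm]
    · intro a ha b hb hpos
      obtain ⟨t', ht', he⟩ := Multiset.countP_pos.1 hpos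
      rw [Multiset.mem_singleton.1 ht'] at he
      rcases h7 _ he with h | h | ⟨-, h⟩
      · obtain ⟨rfl, rfl⟩ | ⟨rfl, -⟩ := Sym2.eq_iff.1 h
        · exact Or.inr ⟨rfl, by simp⟩
        · exact absurd ha S.root_notMem
      · obtain ⟨rfl, rfl⟩ | ⟨rfl, -⟩ := Sym2.eq_iff.1 h
        · exact Or.inl h5
        · exact absurd ha h4
      · obtain ⟨rfl, -⟩ | ⟨rfl, -⟩ := Sym2.eq_iff.1 h
        · exact absurd ha S.root_notMem
        · exact absurd ha h4
    · intro b hb b' hb' hlt hpos w hw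
      obtain ⟨t', ht', he⟩ := Multiset.countP_pos.1 hpos
      rw [Multiset.mem_singleton.1 ht'] at he
      rcases h7 _ he with h | h | ⟨hc, h⟩
      · have h8 : x ∈ s(b, b') := h ▸ Sym2.mem_mk_left _ _
        have h9 := (S.mem_nbrs.1 (hT' x hx)).1
        rcases Sym2.mem_iff.1 h8 with rfl | rfl
        · exact absurd h9 hb
        · exact absurd h9 hb'
      · have h8 : z ∈ s(b, b') := h ▸ Sym2.mem_mk_left _ _
        rcases Sym2.mem_iff.1 h8 with rfl | rfl
        · exact absurd h3 hb
        · exact absurd h3 hb'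
      · obtain ⟨rfl, rfl⟩ | ⟨rfl, rfl⟩ := Sym2.eq_iff.1 h
        · exact (h6 hc w hw).le
        · exact absurd hlt (S.root_le _).not_gt

theorem hasSmallExponent (S : Frame H) [Fintype H.edgeSet] (hroot : S.RootCondition) :
    HasSmallExponent H := by
  classical
  obtain ⟨D⟩ := S.nonempty_delivery
  obtain ⟨R, T, hT1, hT2, htok, huse, huse'⟩ := D.exists_trails
  have hTc : T.card ≤ 1 := hT1 ▸ S.surplus_le_one _
  obtain ⟨L, hL1, hL2, hL3, hL4, hL5⟩ := exists_surplus_trails D hroot T hTc hT2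
  -- The default `b` is outer, so a vertex without an exit imposes no condition `a = ex b` with `a ∈
  -- A`.
  let ex : W → W := fun b => if h : ∃ a ∈ S.nbrs b, (D.M b).count a ≤ 1 then h.choose else b
  have hex : ∀ b, (∃ a ∈ S.nbrs b, (D.M b).count a ≤ 1) →
      ex b ∈ S.nbrs b ∧ (D.M b).count (ex b) ≤ 1 := by
    intro b h
    simp only [ex, dif_pos h]
    exact h.choose_spec
  obtain ⟨n, R', -, rfl⟩ := exists_fin_map R
  obtain ⟨m, L', hm, rfl⟩ := exists_fin_map L
  refine hasSmallExponent_of_trails (A := S.A) (ex := ex) S.indep ?_ R' L' ?_ ?_ ?_ ?_ ?_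
  · rintro b hb ⟨b', hb', hadj, hlt⟩
    have htop : S.top b ≠ b := by
      have h1 : S.outer.Adj b b' := ⟨hadj.symm, hb, hb'⟩
      intro h
      have := S.top_le h1.reachable
      rw [h] at this
      exact absurd hlt this.not_gt
    have h2 := S.mem_nbrs.1 (hex b (D.exit b hb htop)).1
    exact ⟨h2.1, h2.2.symm⟩
  · rw [Fintype.card_fin, hm]
    exact hL1
  · intro j
    exact hL2 _ (Multiset.mem_map_of_mem _ (Finset.mem_univ_val j))
  · intro x
    rw [card_filter_eq_countP R' fun t => t.fst = x, card_filter_eq_countP R' fun t => t.snd = x,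
      card_filter_eq_countP L' fun t => t.fst = x, hL3]
    convert htok x
  · intro a ha b hb hadj
    rw [card_filter_eq_countP R' fun t => s(a, b) ∈ t.walk.edges,
      card_filter_eq_countP L' fun t => s(a, b) ∈ t.walk.edges]
    have h1 := huse a ha b hb
    have h2 := D.count_le b hb a
    have h3 := hL4 a ha b hb
    have h4 := (Multiset.countP_le_card (fun t : Trail H => s(a, b) ∈ t.walk.edges)
      (Finset.univ.val.map L')).trans hL1
    have h5 : a = ex b → (D.M b).count a ≤ 1 := by
      intro h
      by_cases h6 : ∃ a ∈ S.nbrs b, (D.M b).count a ≤ 1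
      · rw [h]
        exact (hex b h6).2
      · simp only [ex, dif_neg h6] at h
        exact absurd (h ▸ ha) hb
    -- On an edge used by the extra trail at most one doubled trail remains, so the total is at most
    -- `2 + 1`, which suits exit edges too.
    by_cases h7 : 0 < (Finset.univ.val.map L').countP (fun t => s(a, b) ∈ t.walk.edges)
    · have h8 : (Finset.univ.val.map R').countP (fun t => s(a, b) ∈ t.walk.edges) ≤ 1 := by
        rcases h3 h7 with h8 | ⟨h8, h9⟩
        · omega
        · rw [if_pos h8] at h1
          omega
      split_ifs <;> omega
    · split_ifs with h8
      · have := h5 h8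
        omega
      · omega
  · intro b hb b' hb' hadj hlt
    rw [card_filter_eq_countP R' fun t => s(b, b') ∈ t.walk.edges,
      card_filter_eq_countP L' fun t => s(b, b') ∈ t.walk.edges]
    have h1 := huse' b hb b' hb'
    have h4 := (Multiset.countP_le_card (fun t : Trail H => s(b, b') ∈ t.walk.edges)
      (Finset.univ.val.map L')).trans hL1
    have h5 := hL5 b hb b' hb' hlt
    split_ifs with h6
    · omega
    · have h7 : ¬ 0 < (Finset.univ.val.map L').countP (fun t => s(b, b') ∈ t.walk.edges) :=
        fun h => h6 fun w _ _ hw => h5 h w hw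
      omega

end Frame

/-! ### A cheapest maximum independent set. -/

section IndependentSets

variable {W : Type*} (H : SimpleGraph W)

def IsIndep (A : Finset W) : Prop := ∀ a ∈ A, ∀ b ∈ A, ¬ H.Adj a b

def IsMaxIndep (A : Finset W) : Prop := IsIndep H A ∧ ∀ A', IsIndep H A' → A'.card ≤ A.card

variable {H}

lemma IsIndep.mono {A A' : Finset W} (h : IsIndep H A) (hs : A' ⊆ A) : IsIndep H A' :=
  fun a ha b hb => h a (hs ha) b (hs hb)

lemma IsIndep.insert [DecidableEq W] {A : Finset W} (h : IsIndep H A) {b : W}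
    (hb : ∀ x ∈ A, ¬ H.Adj b x) : IsIndep H (insert b A) := by
  intro x hx y hy hxy
  rw [Finset.mem_insert] at hx hy
  rcases hx with h1 | h1
  · rcases hy with h2 | h2
    · exact hxy.ne (h1.trans h2.symm)
    · exact hb y h2 (h1 ▸ hxy)
  · rcases hy with h2 | h2
    · exact hb x h1 (h2 ▸ hxy.symm)
    · exact h x h1 y h2 hxy

lemma exists_isMaxIndep [Fintype W] (H : SimpleGraph W) : ∃ A, IsMaxIndep H A := by
  classical
  obtain ⟨A, hA, hmax⟩ := Finset.exists_max_image (Finset.univ.filter (IsIndep H)) Finset.card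
    ⟨∅, by simp [IsIndep]⟩
  exact ⟨A, (Finset.mem_filter.1 hA).2, fun A' h =>
    hmax A' (Finset.mem_filter.2 ⟨Finset.mem_univ _, h⟩)⟩

variable [Fintype W] [LinearOrder W]

/-- Rapidly decreasing weights. -/
def cost (v : W) : ℕ := 2 ^ (Finset.univ.filter fun u => v < u).card

lemma card_gt_lt_of_lt {u v : W} (h : v < u) :
    (Finset.univ.filter fun w => u < w).card < (Finset.univ.filter fun w => v < w).card := by
  refine Finset.card_lt_card ?_
  rw [Finset.ssubset_iff_of_subset]
  · exact ⟨u, by simpa using h, by simp⟩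
  · intro z hz
    simp only [Finset.mem_filter, Finset.mem_univ, true_and] at hz ⊢
    exact h.trans hz

/-- Distinct powers of two: a vertex costs more than all later vertices together. -/
lemma sum_cost_lt (s : Finset W) (v : W) (hs : ∀ u ∈ s, v < u) : ∑ u ∈ s, cost u < cost v := by
  have hinj : Function.Injective fun u : W => (Finset.univ.filter fun w => u < w).card := by
    intro x y hxy
    rcases lt_trichotomy x y with h | h | h
    · exact absurd hxy (card_gt_lt_of_lt h).ne'
    · exact h
    · exact absurd hxy (card_gt_lt_of_lt h).ne
  have := Nat.geomSum_lt (m := 2) (s := s.image fun u : W => (Finset.univ.filter fun w => u < w).card)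
    (n := (Finset.univ.filter fun w => v < w).card) le_rfl (by
      intro k hk
      obtain ⟨u, hu, rfl⟩ := Finset.mem_image.1 hk
      exact card_gt_lt_of_lt (hs u hu))
  rwa [Finset.sum_image fun x _ y _ h => hinj h] at this

lemma cost_lt {u v : W} (h : v < u) : cost u < cost v := by
  simpa using sum_cost_lt {u} v (by simpa using h)

/-- A cheapest maximum independent set gives a frame. -/
lemma exists_frame (r : W) (hr : ∀ v, v ≠ r → ∃ w, w < v ∧ H.Adj w v) {A₀ : Finset W}
    (hA₀ : IsMaxIndep H A₀) (hmin : ∀ v, r ≤ v) (hrA : r ∉ A₀) :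
    ∃ S : Frame H, S.r = r ∧ IsMaxIndep H S.A ∧ ∑ v ∈ S.A, cost v ≤ ∑ v ∈ A₀, cost v := by
  classical
  obtain ⟨A, hA, hcost⟩ := Finset.exists_min_image (Finset.univ.filter (IsMaxIndep H))
    (fun A => ∑ v ∈ A, cost v) ⟨A₀, by simpa using hA₀⟩
  rw [Finset.mem_filter] at hA
  obtain ⟨-, hind, hmax⟩ := hA
  have hopt : ∀ A', IsIndep H A' → A'.card = A.card → ∑ v ∈ A, cost v ≤ ∑ v ∈ A', cost v := by
    intro A' h1 h2
    refine hcost A' (Finset.mem_filter.2 ⟨Finset.mem_univ _, h1, fun A'' h3 => ?_⟩)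
    rw [h2]
    exact hmax A'' h3
  have hle : ∑ v ∈ A, cost v ≤ ∑ v ∈ A₀, cost v := hopt A₀ hA₀.1 (le_antisymm (hmax _ hA₀.1)
    (hA₀.2 _ hind))
  have hdom : ∀ b ∉ A, ∃ a ∈ A, H.Adj b a := by
    intro b hb
    by_contra hcon
    push Not at hcon
    have := hmax _ (hind.insert hcon)
    rw [Finset.card_insert_of_notMem hb] at this
    omega
  have hmem : ∀ b ∉ A, ∀ a, (∀ x ∈ A, H.Adj b x ↔ x = a) → a ∈ A := by
    intro b hb a ha
    obtain ⟨x, hx, hbx⟩ := hdom b hb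
    rwa [← (ha x hx).1 hbx]
  -- Exchanging `a` for `b` keeps the set independent and of maximum size, so it must not become
  -- cheaper.
  have hlt : ∀ b ∉ A, ∀ a, (∀ x ∈ A, H.Adj b x ↔ x = a) → b < a := by
    intro b hb a ha
    have haA := hmem b hb a ha
    have hbe : b ∉ A.erase a := fun h => hb (Finset.mem_of_mem_erase h)
    have h1 : IsIndep H (insert b (A.erase a)) := (hind.mono (Finset.erase_subset _ _)).insert
      fun x hx h => (Finset.mem_erase.1 hx).1 ((ha x (Finset.mem_erase.1 hx).2).1 h)
    have h2 := hopt _ h1 (by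
      rw [Finset.card_insert_of_notMem hbe, Finset.card_erase_add_one haA])
    rw [Finset.sum_insert hbe, ← Finset.add_sum_erase A _ haA] at h2
    by_contra h3
    rcases (not_lt.1 h3).eq_or_lt with h4 | h4
    · exact hb (h4 ▸ haA)
    · have := cost_lt h4
      omega
  refine ⟨⟨A, r, hind, hdom, ?_, hr, hlt, ?_, ?_⟩, rfl, ⟨hind, hmax⟩, hle⟩
  · intro h
    have h1 := sum_cost_lt A₀ r fun u hu => lt_of_le_of_ne (hmin u) fun h => hrA (h ▸ hu)
    have h2 := Finset.single_le_sum (f := cost) (fun _ _ => Nat.zero_le _) h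
    omega
  · intro b hb b' hb' hne a ha ha'
    by_contra hadj
    have haA := hmem b hb a ha
    have h1 : IsIndep H (insert b' (A.erase a)) := (hind.mono (Finset.erase_subset _ _)).insert
      fun x hx h => (Finset.mem_erase.1 hx).1 ((ha' x (Finset.mem_erase.1 hx).2).1 h)
    -- Nonadjacent `b` and `b'` could replace `a` and give a larger independent set.
    have h2 : IsIndep H (insert b (insert b' (A.erase a))) := h1.insert fun x hx h => by
      rcases Finset.mem_insert.1 hx with rfl | hx
      · exact hadj h
      · exact (Finset.mem_erase.1 hx).1 ((ha x (Finset.mem_erase.1 hx).2).1 h)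
    have h3 := hmax _ h2
    rw [Finset.card_insert_of_notMem, Finset.card_insert_of_notMem,
      Finset.card_erase_add_one haA] at h3
    · omega
    · exact fun h => hb' (Finset.mem_of_mem_erase h)
    · rw [Finset.mem_insert]
      rintro (h | h)
      · exact hne h
      · exact hb (Finset.mem_of_mem_erase h)
  · intro b hb b' hb' hne x a haA ha hx hab hab'
    by_contra hadj
    have hxA := hmem b' hb' x hx
    by_cases hxa : x = a
    · subst hxa
      exact lt_asymm hab (hlt b hb x fun y hy => by rw [ha y hy, or_self])
    · have haA' : a ∈ A.erase x := Finset.mem_erase.2 ⟨fun h => hxa h.symm, haA⟩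
      have hsub : (A.erase x).erase a ⊆ A := (Finset.erase_subset _ _).trans (Finset.erase_subset _ _)
      have h1 : IsIndep H (insert b' ((A.erase x).erase a)) := (hind.mono hsub).insert
        fun y hy h => by
          have h1 := Finset.mem_erase.1 (Finset.mem_erase.1 hy).2
          exact h1.1 ((hx y h1.2).1 h)
      have h2 : IsIndep H (insert b (insert b' ((A.erase x).erase a))) := h1.insert fun y hy h => by
        rcases Finset.mem_insert.1 hy with rfl | hy
        · exact hadj h
        · have h1 := Finset.mem_erase.1 (Finset.mem_erase.1 hy).2
          rcases (ha y h1.2).1 h with h2 | h2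
          · exact h1.1 h2
          · exact (Finset.mem_erase.1 hy).1 h2
      have hb1 : b' ∉ (A.erase x).erase a := fun h => hb' (hsub h)
      have hb2 : b ∉ insert b' ((A.erase x).erase a) := by
        rw [Finset.mem_insert]
        rintro (h | h)
        · exact hne h
        · exact hb (hsub h)
      have h3 := hopt _ h2 (by
        rw [Finset.card_insert_of_notMem hb2, Finset.card_insert_of_notMem hb1,
          Finset.card_erase_add_one haA', Finset.card_erase_add_one hxA])
      rw [Finset.sum_insert hb2, Finset.sum_insert hb1, ← Finset.add_sum_erase A _ hxA,
        ← Finset.add_sum_erase (A.erase x) _ haA'] at h3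
      -- Replacing `x` and `a` by `b` and `b'` keeps the size, and `a` alone costs more than `b` and
      -- `b'` together.
      have h4 := sum_cost_lt {b, b'} a (by simp [hab, hab'])
      rw [Finset.sum_pair hne] at h4
      omega

end IndependentSets

/-! ### Choosing the root and the order in a connected graph. -/

section Order

variable {W : Type*} [Fintype W] {H : SimpleGraph W}

/-- Order the vertices by their distance from `r`, with `c` first among the neighbours. -/
lemma exists_linearOrder (hH : H.Connected) (r c : W) (hc : c = r ∨ H.Adj r c) :
    ∃ _ : LinearOrder W, (∀ v, r ≤ v) ∧ (∀ v, v ≠ r → ∃ w, w < v ∧ H.Adj w v) ∧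
      (c ≠ r → ∀ w < c, w = r) := by
  classical
  -- With `idx < N` the key orders lexicographically by distance, then index; index `0` is reserved
  -- for `c`.
  let N := Fintype.card W + 1
  let idx : W → ℕ := fun v => if v = c then 0 else Fintype.equivFin W v + 1
  have hidx : ∀ v, idx v < N := by
    intro v
    simp only [idx, N]
    split_ifs
    · omega
    · have := (Fintype.equivFin W v).2
      omega
  have hidx_inj : Function.Injective idx := by
    intro x y hxy
    simp only [idx] at hxy
    split_ifs at hxy with h1 h2 h2
    · exact h1.trans h2.symm
    · exact (Fintype.equivFin W).injective (Fin.ext (by omega))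
  let key : W → ℕ := fun v => H.dist v r * N + idx v
  have hkey_lt : ∀ v w, H.dist v r < H.dist w r → key v < key w := by
    intro v w h
    have h1 := hidx v
    have h2 : (H.dist v r + 1) * N ≤ H.dist w r * N := Nat.mul_le_mul_right _ h
    simp only [key]
    rw [add_mul, one_mul] at h2
    omega
  have hkey_inj : Function.Injective key := by
    intro x y hxy
    rcases lt_trichotomy (H.dist x r) (H.dist y r) with h | h | h
    · exact absurd hxy (hkey_lt _ _ h).ne
    · simp only [key, h] at hxy
      exact hidx_inj (by omega)
    · exact absurd hxy (hkey_lt _ _ h).ne'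
  have hdist : ∀ v, v ≠ r → 0 < H.dist v r := fun v hv => hH.pos_dist_of_ne hv
  have hdr : H.dist r r = 0 := SimpleGraph.dist_self
  refine ⟨LinearOrder.lift' key hkey_inj, ?_, ?_, ?_⟩
  · intro v
    change key r ≤ key v
    by_cases hv : v = r
    · rw [hv]
    · exact (hkey_lt _ _ (by rw [hdr]; exact hdist v hv)).le
  · intro v hv
    obtain ⟨p, hp⟩ := hH.exists_walk_length_eq_dist v r
    cases p with
    | nil => exact absurd rfl hv
    | @cons _ w _ h p =>
      refine ⟨w, ?_, h.symm⟩
      change key w < key v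
      refine hkey_lt _ _ ?_
      rw [← hp, SimpleGraph.Walk.length_cons]
      exact Nat.lt_succ_of_le (SimpleGraph.dist_le p)
  · intro hcr w hw
    change key w < key c at hw
    by_contra hwr
    have h1 : H.dist c r = 1 := SimpleGraph.dist_eq_one_iff_adj.2 (hc.resolve_left hcr).symm
    have h2 := hdist w hwr
    have h3 : idx c = 0 := by simp [idx]
    rcases Nat.lt_or_ge 1 (H.dist w r) with h4 | h4
    · exact absurd hw (hkey_lt c w (by rw [h1]; exact h4)).not_gt
    · have h5 : H.dist w r = 1 := by omega
      simp only [key, h1, h5, h3] at hw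
      omega

/-- Otherwise the two ends of an edge would be closed under walks and form the whole graph. -/
lemma exists_two_neighbors (hH : H.Connected) (hcard : 3 ≤ Fintype.card W) :
    ∃ w b₁ b₂, b₁ ≠ b₂ ∧ H.Adj w b₁ ∧ H.Adj w b₂ := by
  classical
  by_contra hcon
  push Not at hcon
  obtain ⟨x, y, hxy⟩ := Fintype.exists_pair_of_one_lt_card (by omega : 1 < Fintype.card W)
  obtain ⟨p⟩ := hH.preconnected x y
  cases p with
  | nil => exact hxy rfl
  | @cons _ w _ h p =>
    have hclosed : ∀ u v, H.Walk u v → (u = x ∨ u = w) → v = x ∨ v = w := by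
      intro u v q hu
      induction q with
      | nil => exact hu
      | @cons a b c hab _ ih =>
        refine ih ?_
        rcases hu with rfl | rfl
        · by_contra h2
          push Not at h2
          exact hcon a b w h2.2 hab h
        · by_contra h2
          push Not at h2
          exact hcon a b x h2.1 hab h.symm
    have hsub : (Finset.univ : Finset W) ⊆ {x, w} := by
      intro z _
      obtain ⟨q⟩ := hH.preconnected x z
      rcases hclosed x z q (Or.inl rfl) with h1 | h1 <;> simp [h1]
    have h1 := Finset.card_le_card hsub
    have h2 := Finset.card_le_two (a := x) (b := w)
    rw [Finset.card_univ] at h1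
    omega

/-- The two cases match `RootCondition`. If some maximum independent set misses both ends of an
edge, these ends come first in the order. If not, the complement of every maximum independent set is
independent, and the root only needs two neighbours. -/
theorem hasSmallExponent_of_connected [DecidableEq W] [Fintype H.edgeSet] (hH : H.Connected)
    (hcard : 3 ≤ Fintype.card W) : HasSmallExponent H := by
  classical
  have key : ∃ (_ : LinearOrder W) (S : Frame H), S.RootCondition := by
    by_cases hcase : ∃ A₀, IsMaxIndep H A₀ ∧ ∃ u v, u ∉ A₀ ∧ v ∉ A₀ ∧ H.Adj u v
    · obtain ⟨A₀, hA₀, r, c, hr, hc, hadj⟩ := hcase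
      obtain ⟨ord, h1, h2, h3⟩ := exists_linearOrder hH r c (Or.inr hadj)
      obtain ⟨S, hSr, -, hcost⟩ := exists_frame r h2 hA₀ h1 hr
      refine ⟨ord, S, Or.inl ⟨c, ?_, hSr ▸ hadj, by rw [hSr]; exact h3 hadj.ne'⟩⟩
      intro hcS
      -- All of `A₀` comes after `c`, so a set containing `c` would cost more than `A₀`.
      have h4 := sum_cost_lt A₀ c fun u hu => by
        by_contra h
        rcases (not_lt.1 h).eq_or_lt with h5 | h5
        · exact hc (h5 ▸ hu)
        · exact hr (h3 hadj.ne' u h5 ▸ hu)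
      have h5 := Finset.single_le_sum (f := cost) (fun _ _ => Nat.zero_le _) hcS
      omega
    · push Not at hcase
      obtain ⟨A₀, hA₀⟩ := exists_isMaxIndep H
      obtain ⟨r, hr, y, z, hyz, hy, hz⟩ : ∃ r, r ∉ A₀ ∧ ∃ y z, y ≠ z ∧ H.Adj r y ∧ H.Adj r z := by
        obtain ⟨w, b₁, b₂, hne, hb₁, hb₂⟩ := exists_two_neighbors hH hcard
        by_contra hcon
        push Not at hcon
        have hw : w ∈ A₀ := by
          by_contra hw
          exact hcon w hw b₁ b₂ hne hb₁ hb₂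
        have h1 : b₁ ∉ A₀ := fun h => hA₀.1 _ hw _ h hb₁
        have h2 : b₂ ∉ A₀ := fun h => hA₀.1 _ hw _ h hb₂
        -- If no vertex outside `A₀` has two neighbours, `b₁` and `b₂` are leaves at `w`, and
        -- trading `w` for both enlarges `A₀`.
        have h3 : ∀ b, b ∉ A₀ → H.Adj w b → ∀ x, x ≠ w → ¬ H.Adj b x := fun b hb hwb x hx hbx =>
          hcon b hb x w hx hbx hwb.symm
        have h4 : IsIndep H (insert b₁ (A₀.erase w)) :=
          (hA₀.1.mono (Finset.erase_subset _ _)).insert fun x hx =>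
            h3 b₁ h1 hb₁ x (Finset.mem_erase.1 hx).1
        have h5 : IsIndep H (insert b₂ (insert b₁ (A₀.erase w))) := h4.insert fun x hx => by
          refine h3 b₂ h2 hb₂ x ?_
          rcases Finset.mem_insert.1 hx with rfl | hx
          · exact hb₁.ne'
          · exact (Finset.mem_erase.1 hx).1
        have h6 := hA₀.2 _ h5
        rw [Finset.card_insert_of_notMem, Finset.card_insert_of_notMem,
          Finset.card_erase_add_one hw] at h6
        · omega
        · exact fun h => h1 (Finset.mem_of_mem_erase h)
        · rw [Finset.mem_insert]
          rintro (h | h)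
          · exact hne h.symm
          · exact h2 (Finset.mem_of_mem_erase h)
      obtain ⟨ord, h1, h2, -⟩ := exists_linearOrder hH r r (Or.inl rfl)
      obtain ⟨S, hSr, hmax, -⟩ := exists_frame r h2 hA₀ h1 hr
      have hB : ∀ b ∉ S.A, ∀ b' ∉ S.A, ¬ H.Adj b b' := fun b hb b' hb' =>
        hcase S.A hmax b b' hb hb'
      refine ⟨ord, S, Or.inr ⟨hB, ?_⟩⟩
      have hmem : ∀ x, H.Adj r x → x ∈ S.nbrs S.r := by
        intro x hx
        rw [S.mem_nbrs, hSr]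
        refine ⟨?_, hx⟩
        by_contra h
        exact hB r (hSr ▸ S.root_notMem) x h hx
      exact Finset.one_lt_card.2 ⟨y, hmem y hy, z, hmem z hz, hyz⟩
  obtain ⟨ord, S, hS⟩ := key
  convert S.hasSmallExponent hS

end Order

end TotalWeight

theorem mainTheorem2 {V : Type*} [Fintype V] [LinearOrder V] (G : SimpleGraph V)
    [DecidableRel G.Adj] (hG : TotalWeight.IsNice G) :
    TotalWeight.AlgebraicChoosable G 1 5 ∧
      ∃ K : G.edgeSet →₀ ℕ,
        ∑ e, K e = Fintype.card G.edgeSet ∧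
        (∀ e : G.edgeSet, K e ≤ 4) ∧
        (TotalWeight.graphPoly G).coeff K ≠ 0 := by
  obtain ⟨K, hK4, hK⟩ := TotalWeight.exists_coeff_graphPoly_ne_zero G hG
    fun W _ _ H _ hH hcard => TotalWeight.hasSmallExponent_of_connected hH hcard
  exact ⟨TotalWeight.algebraicChoosable_one_five G K hK4 hK, K,
    TotalWeight.sum_eq_card_of_coeff_graphPoly_ne_zero G K hK, hK4, hK⟩
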